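/- For elements $x,y$ of a group put $[x,y]=x^{-1}y^{-1}xy$, $[x,_0y]=x$ and $[x,_{i+1}y]=[[x,_iy],y]$ for $i\ge 0$. For a group $G$ and $n\ge 1$ let $I_n(G)=\{x\in G : [x,_ny]=[y,_nx]=1 \text{ for every } y\in G\}$, and let the Engel graph $\Gamma_n(G)$ be the directed graph with vertex set $G\setminus I_n(G)$ in which $(x,y)$ is an arc if and only if $[x,_ny]=1$. A directed graph is strongly connected if for any two vertices there is a directed path from the first to the second. A finite group $G$ is almost simple if it has a normal non-abelian simple subgroup with trivial centralizer in $G$ (equivalently, $\mathrm{Inn}(S)\le G\le \mathrm{Aut}(S)$ up to isomorphism, for a non-abelian simple group $S$); the socle of $G$ is the subgroup generated by its minimal normal subgroups. Let $q\ge 4$ be an even prime power and let $G$ be a finite almost simple group with socle isomorphic to $\mathrm{PSL}_3(q)$. Then $\Gamma_2(G)$ is strongly connected if and only if $G\not\cong\mathrm{PSL}_3(4)$. Moreover, $\Gamma_3(\mathrm{PSL}_3(4))$ is strongly connected. In particular, the smallest integer $n\ge 2$ such that $\Gamma_n(G)$ is strongly connected exists; it equals $3$ if $G\cong\mathrm{PSL}_3(4)$,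 and it equals $2$ otherwise. -/

import Mathlib

namespace EngelGraphs

/-- The commutator `[x, y] = x⁻¹ y⁻¹ x y`. (Mathlib's `⁅x, y⁆` is `x y x⁻¹ y⁻¹`.) -/
def comm {G : Type*} [Group G] (x y : G) : G := x⁻¹ * y⁻¹ * x * y

/-- The `n`-th Engel word: `[x,₀ y] = x` and `[x,ₙ₊₁ y] = [[x,ₙ y], y]`. -/
def engelWord {G : Type*} [Group G] : ℕ → G → G → G
  | 0, x, _ => x
  | n + 1, x, y => comm (engelWord n x y) y

/-- The set `I_n(G)` of the elements of `G` that are both right and left `n`-Engel. -/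
def biEngelSet (n : ℕ) (G : Type*) [Group G] : Set G :=
  {x | ∀ y : G, engelWord n x y = 1 ∧ engelWord n y x = 1}

/-- The `n`-th Engel graph `Γ_n(G)`: its vertices are the elements of `G` outside `I_n(G)`, and
`(x, y)` is an arc if and only if `[x,ₙ y] = 1`. -/
def engelGraph (n : ℕ) (G : Type*) [Group G] : Digraph {x : G // x ∉ biEngelSet n G} where
  Adj x y := engelWord n (x : G) (y : G) = 1

/-- A directed graph is strongly connected if for any two vertices there is a directed path from
the first to the second. -/
def IsStronglyConnected {V : Type*} (D : Digraph V) : Prop :=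
  ∀ v w : V, Relation.ReflTransGen D.Adj v w

/-- Minimal normal subgroups of a group. -/
def IsMinimalNormal {G : Type*} [Group G] (N : Subgroup G) : Prop :=
  N.Normal ∧ N ≠ ⊥ ∧ ∀ M : Subgroup G, M.Normal → M ≤ N → M = ⊥ ∨ M = N

/-- The socle of a group: the subgroup generated by its minimal normal subgroups. -/
def socle (G : Type*) [Group G] : Subgroup G :=
  sSup {N : Subgroup G | IsMinimalNormal N}

/-- A group `G` is almost simple if it has a normal non-abelian simple subgroup `S` whose
centralizer in `G` is trivial; equivalently (let `G` act on `S` by conjugation),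
`Inn S ≤ G ≤ Aut S` up to isomorphism. -/
def IsAlmostSimple (G : Type*) [Group G] : Prop :=
  ∃ S : Subgroup G, S.Normal ∧ IsSimpleGroup S ∧ (∃ a b : S, a * b ≠ b * a) ∧
    Subgroup.centralizer (S : Set G) = ⊥

end EngelGraphs

open scoped MatrixGroups

namespace EngelGraphs

/-! ### Engel words, Engel graphs and paths of nontrivial elements. -/

section Engel

variable {G H : Type*} [Group G] [Group H]

/-! By `engelWord_two_eq_one_iff`, Γ_2 has an arc from x to y exactly when y commutes with its
conjugate x⁻¹yx. I_2(G) and I_3(PSL_3(q)) are trivial, so the vertices are the nontrivial elements.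
The involutions of S = PSL_3(q) serve as a hub: in characteristic 2 they are the images of
transvections, and any two are joined through commuting ones (`engelPath_of_isInvol`).

Call a matrix reducible if it has an eigenvector. A reducible X has an arc to every transvection
centered at an eigenvector, and some involution has an arc to X (`IsReducible.exists_isInvol`). An
irreducible X generates a cubic field K; a nontrivial Galois automorphism of K, viewed in SL_3(q),
is reducible and normalizes K, hence has an arc to X. So involutions reach all of S. Conversely, if
q > 4 and a³ ≠ 1, then diag(a, a⁻², a), written in a cyclic basis of X, is the end of an arc from an
irreducible X.

If q = 4, irreducible matrices have order 7 modulo scalars, and an arc from one of them leads only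
to elements commuting with it (`commute_of_commute_conj`): otherwise it would induce a nontrivial
automorphism of order prime to 7. So a path from an irreducible element never leaves its
centralizer, and Γ_2(PSL_3(4)) is not strongly connected. In Γ_3 every element has an arc to an
involution (`exists_isInvol_engelWord_three`). If G is larger than PSL_3(4), conjugation by an outer
element is semilinear up to inverse transpose (`exists_semilinear`), and this yields an outer
element through which an irreducible element escapes to the involutions
(`reachesInvol_companionSL`).

Elements of G outside S are handled by counting fixed points: an element of prime order commutes
with a nontrivial element of S (`exists_commute_of_orderOf_prime`), so every nontrivial element of G
is joined to S in both directions. -/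

lemma engelWord_succ (n : ℕ) (x y : G) :
    engelWord (n + 1) x y = comm (engelWord n x y) y := rfl

lemma comm_one_left (y : G) : comm 1 y = 1 := by simp [comm]

lemma engelWord_succ_eq_one {n : ℕ} {x y : G} (h : engelWord n x y = 1) :
    engelWord (n + 1) x y = 1 := by
  rw [engelWord_succ, h, comm_one_left]

lemma comm_eq_one_iff (x y : G) : comm x y = 1 ↔ Commute x y := by
  have : comm x y = (y * x)⁻¹ * (x * y) := by simp [comm, mul_assoc]
  rw [this, inv_mul_eq_one]
  exact eq_comm

/-- Since [x, y] = (x⁻¹yx)⁻¹y, this commutes with y if and only if x⁻¹yx does. All arcs of Γ_2 are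
handled in this form. -/
lemma engelWord_two_eq_one_iff (x y : G) :
    engelWord 2 x y = 1 ↔ Commute y (x⁻¹ * y * x) := by
  change comm (comm x y) y = 1 ↔ _
  rw [comm_eq_one_iff]
  have h : comm x y = (x⁻¹ * y * x)⁻¹ * y := by simp [comm, mul_assoc]
  rw [h]
  constructor
  · intro h1
    have h2 := h1.mul_left (Commute.refl y).inv_left
    rw [mul_inv_cancel_right] at h2
    simpa using h2.inv_left.symm
  · intro h1
    exact h1.symm.inv_left.mul_left (Commute.refl y)

lemma map_engelWord (f : G →* H) (n : ℕ) (x y : G) :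
    f (engelWord n x y) = engelWord n (f x) (f y) := by
  induction n with
  | zero => rfl
  | succ n ih => rw [engelWord_succ, engelWord_succ, ← ih]; simp [comm]

lemma biEngelSet_subset_succ (n : ℕ) : biEngelSet n G ⊆ biEngelSet (n + 1) G :=
  fun _ hx y => ⟨engelWord_succ_eq_one (hx y).1, engelWord_succ_eq_one (hx y).2⟩

lemma one_mem_biEngelSet {n : ℕ} (hn : n ≠ 0) : (1 : G) ∈ biEngelSet n G := by
  obtain ⟨n, rfl⟩ := Nat.exists_eq_succ_of_ne_zero hn
  intro y
  have h1 : ∀ k, engelWord k (1 : G) y = 1 := by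
    intro k
    induction k with
    | zero => rfl
    | succ k ih => exact engelWord_succ_eq_one ih
  exact ⟨h1 _, by simp [engelWord_succ, comm]⟩

lemma ne_one_of_notMem_biEngelSet {n : ℕ} (hn : n ≠ 0) {x : G} (hx : x ∉ biEngelSet n G) :
    x ≠ 1 := fun h => hx (h ▸ one_mem_biEngelSet hn)

/-- A directed path through nontrivial elements with `[x,ₙ y] = 1` along each arc. -/
def EngelPath (n : ℕ) : G → G → Prop :=
  Relation.ReflTransGen fun x y => x ≠ 1 ∧ y ≠ 1 ∧ engelWord n x y = 1

namespace EngelPath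

lemma trans {n : ℕ} {x y z : G} (h : EngelPath n x y) (h' : EngelPath n y z) :
    EngelPath n x z := Relation.ReflTransGen.trans h h'

lemma single {n : ℕ} {x y : G} (hx : x ≠ 1) (hy : y ≠ 1) (h : engelWord n x y = 1) :
    EngelPath n x y := Relation.ReflTransGen.single ⟨hx, hy, h⟩

lemma of_commute_conj {x y : G} (hx : x ≠ 1) (hy : y ≠ 1) (h : Commute y (x⁻¹ * y * x)) :
    EngelPath 2 x y := single hx hy ((engelWord_two_eq_one_iff x y).2 h)

lemma of_commute {x y : G} (hx : x ≠ 1) (hy : y ≠ 1) (h : Commute x y) :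
    EngelPath 2 x y :=
  of_commute_conj hx hy (by rw [mul_assoc, ← h.eq, inv_mul_cancel_left])

lemma succ {n : ℕ} {x y : G} (h : EngelPath n x y) : EngelPath (n + 1) x y :=
  Relation.ReflTransGen.mono (fun _ _ h => ⟨h.1, h.2.1, engelWord_succ_eq_one h.2.2⟩) _ _ h

end EngelPath

/-- When I_n is trivial, paths can be built in the group itself, without carrying proofs of
membership in the vertex set. -/
lemma isStronglyConnected_of_engelPath {n : ℕ} (hn : n ≠ 0)
    (hI : ∀ x : G, x ≠ 1 → x ∉ biEngelSet n G)
    (hp : ∀ x y : G, x ≠ 1 → y ≠ 1 → EngelPath n x y) :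
    IsStronglyConnected (engelGraph n G) := by
  rintro ⟨v, hv⟩ ⟨w, hw⟩
  have key : ∀ y : G, EngelPath n v y → ∀ hy : y ∉ biEngelSet n G,
      Relation.ReflTransGen (engelGraph n G).Adj ⟨v, hv⟩ ⟨y, hy⟩ := by
    intro y hy
    induction hy with
    | refl => intro _; exact Relation.ReflTransGen.refl
    | tail _ hbc ih => intro hc; exact (ih (hI _ hbc.1)).tail hbc.2.2
  exact key w (hp v w (ne_one_of_notMem_biEngelSet hn hv) (ne_one_of_notMem_biEngelSet hn hw)) hw

lemma mem_biEngelSet_map_iff (e : G ≃* H) (n : ℕ) (x : G) :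
    e x ∈ biEngelSet n H ↔ x ∈ biEngelSet n G := by
  have h : ∀ a b : G, engelWord n (e a) (e b) = 1 ↔ engelWord n a b = 1 := by
    intro a b
    rw [← e.map_eq_one_iff (x := engelWord n a b)]
    exact (congrArg (· = 1) (map_engelWord e.toMonoidHom n a b)).to_iff.symm
  constructor
  · intro hx y
    exact ⟨(h _ _).1 (hx (e y)).1, (h _ _).1 (hx (e y)).2⟩
  · intro hx y
    obtain ⟨y, rfl⟩ := e.surjective y
    exact ⟨(h _ _).2 (hx y).1, (h _ _).2 (hx y).2⟩

lemma IsStronglyConnected.map_equiv {n : ℕ} (e : G ≃* H)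
    (h : IsStronglyConnected (engelGraph n G)) : IsStronglyConnected (engelGraph n H) := by
  rintro ⟨v, hv⟩ ⟨w, hw⟩
  obtain ⟨v, rfl⟩ := e.surjective v
  obtain ⟨w, rfl⟩ := e.surjective w
  have hv' := fun h' => hv ((mem_biEngelSet_map_iff e n v).2 h')
  have hw' := fun h' => hw ((mem_biEngelSet_map_iff e n w).2 h')
  refine Relation.ReflTransGen.lift
    (fun x : {x : G // x ∉ biEngelSet n G} =>
      (⟨e x, fun h' => x.2 ((mem_biEngelSet_map_iff e n x).1 h')⟩ :
        {x : H // x ∉ biEngelSet n H})) ?_ _ _ (h ⟨v, hv'⟩ ⟨w, hw'⟩)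
  intro a b hab
  change engelWord n (e a) (e b) = 1
  have := map_engelWord e.toMonoidHom n a.1 b.1
  rw [show engelWord n a.1 b.1 = 1 from hab] at this
  simpa using this.symm

end Engel

/-! ### Almost simple groups: the socle and the triviality of I_2. -/

section AlmostSimple

variable {G : Type*} [Group G]

lemma eq_bot_or_eq_of_normal_of_le {S : Subgroup G} [IsSimpleGroup S] {M : Subgroup G}
    (hM : M.Normal) (hMS : M ≤ S) : M = ⊥ ∨ M = S := by
  have hn : (M.subgroupOf S).Normal := hM.subgroupOf S
  rcases hn.eq_bot_or_eq_top with h | h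
  · left
    rw [Subgroup.subgroupOf_eq_bot, disjoint_iff, inf_eq_left.2 hMS] at h
    exact h
  · right
    exact le_antisymm hMS (Subgroup.subgroupOf_eq_top.1 h)

lemma le_centralizer_of_inf_eq_bot {S N : Subgroup G} (hS : S.Normal) (hN : N.Normal)
    (h : N ⊓ S = ⊥) : N ≤ Subgroup.centralizer (S : Set G) := by
  intro x hx
  rw [Subgroup.mem_centralizer_iff]
  intro s hs
  exact (Subgroup.commute_of_normal_of_disjoint S N hS hN
    (disjoint_iff.2 (by rw [inf_comm]; exact h)) s x hs hx)

/-- A minimal normal subgroup N meeting S trivially would centralize S, hence be trivial; so N ≤ S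
by minimality. Thus the subgroup witnessing `IsAlmostSimple` is the socle. -/
lemma socle_eq_of_isSimpleGroup {S : Subgroup G} (hS : S.Normal) [IsSimpleGroup S]
    (hC : Subgroup.centralizer (S : Set G) = ⊥) : socle G = S := by
  have hSbot : S ≠ ⊥ := by
    intro h
    exact (Subgroup.nontrivial_iff_ne_bot S).1 inferInstance h
  apply le_antisymm
  · refine sSup_le fun N hN => ?_
    rcases hN.2.2 (N ⊓ S) (@Subgroup.normal_inf_normal _ _ N S hN.1 hS) inf_le_left with h | h
    · exact absurd (le_bot_iff.1 (hC ▸ le_centralizer_of_inf_eq_bot hS hN.1 h)) hN.2.1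
    · exact inf_eq_left.1 h
  · exact le_sSup ⟨hS, hSbot, fun M hM hMS => eq_bot_or_eq_of_normal_of_le hM hMS⟩

/-- An element of I_2 commutes with all its conjugates, so its normal closure N is abelian. Either N
centralizes S or N contains S, and both are impossible. -/
lemma notMem_biEngelSet_two {S : Subgroup G} (hS : S.Normal) [IsSimpleGroup S]
    (hna : ∃ a b : S, a * b ≠ b * a)
    (hC : Subgroup.centralizer (S : Set G) = ⊥) {x : G} (hx : x ≠ 1) :
    x ∉ biEngelSet 2 G := by
  intro hI
  let N := Subgroup.normalClosure {x}
  have hconj : ∀ a ∈ Group.conjugatesOfSet {x}, ∀ b ∈ Group.conjugatesOfSet {x},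
      a * b = b * a := by
    intro a ha b hb
    simp only [Group.mem_conjugatesOfSet_iff, Set.mem_singleton_iff, exists_eq_left,
      isConj_iff] at ha hb
    obtain ⟨c, rfl⟩ := ha
    obtain ⟨d, rfl⟩ := hb
    -- Conjugating this relation by c makes cxc⁻¹ and dxd⁻¹ commute.
    have h := (engelWord_two_eq_one_iff (d⁻¹ * c) x).1 (hI _).2
    have h2 := h.map (MulAut.conj c).toMonoidHom
    simp only [MulEquiv.coe_toMonoidHom, MulAut.conj_apply] at h2
    have h3 : c * ((d⁻¹ * c)⁻¹ * x * (d⁻¹ * c)) * c⁻¹ = d * x * d⁻¹ := by group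
    rw [h3] at h2
    exact h2
  have hcomm : ∀ a ∈ N, ∀ b ∈ N, a * b = b * a := by
    intro a ha b hb
    have := Subgroup.isMulCommutative_closure (k := Group.conjugatesOfSet {x}) hconj
    exact congrArg Subtype.val
      (this.is_comm.comm (⟨a, ha⟩ : Subgroup.closure (Group.conjugatesOfSet {x})) ⟨b, hb⟩)
  have hxN : x ∈ N := Subgroup.subset_normalClosure rfl
  have hNn : N.Normal := Subgroup.normalClosure_normal
  rcases eq_bot_or_eq_of_normal_of_le
    (@Subgroup.normal_inf_normal _ _ N S hNn hS) (inf_le_right : N ⊓ S ≤ S) with h | h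
  · have := le_centralizer_of_inf_eq_bot hS hNn h hxN
    rw [hC] at this
    exact hx this
  · obtain ⟨a, b, hab⟩ := hna
    have hSN : S ≤ N := inf_eq_right.1 h
    exact hab (Subtype.ext (hcomm a (hSN a.2) b (hSN b.2)))

end AlmostSimple

end EngelGraphs

namespace EngelGraphs

open Matrix

/-! ### Transvections of SL(3, F); in characteristic 2 they are the involutions. -/

section Transvections

variable {F : Type*} [Field F]

lemma coe_injective {A B : SL(3, F)}
    (h : (A : Matrix (Fin 3) (Fin 3) F) = (B : Matrix (Fin 3) (Fin 3) F)) : A = B :=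
  Subtype.ext h

lemma coe_congr {A B : SL(3, F)} (h : A = B) :
    (A : Matrix (Fin 3) (Fin 3) F) = (B : Matrix (Fin 3) (Fin 3) F) := by rw [h]

/-- The transvection `1 + a f` with center `a` and axis `f = 0`. -/
def tv (a f : Fin 3 → F) (h : f ⬝ᵥ a = 0) : SL(3, F) :=
  ⟨1 + vecMulVec a f, by
    rw [vecMulVec_eq Unit, det_one_add_replicateCol_mul_replicateRow, h, add_zero]⟩

lemma coe_tv (a f : Fin 3 → F) (h : f ⬝ᵥ a = 0) :
    (tv a f h : Matrix (Fin 3) (Fin 3) F) = 1 + vecMulVec a f := rfl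

/-- The involutions of `SL(3, F)`. -/
def IsInvol {G : Type*} [Monoid G] (T : G) : Prop := T ≠ 1 ∧ T * T = 1

lemma IsInvol.inv_eq {G : Type*} [Group G] {T : G} (h : IsInvol T) : T⁻¹ = T :=
  inv_eq_of_mul_eq_one_left h.2

lemma IsInvol.map_injective {G H : Type*} [Group G] [Group H] {T : G} (h : IsInvol T)
    (f : G →* H) (hf : Function.Injective f) : IsInvol (f T) :=
  ⟨fun h1 => h.1 (hf (by rw [h1, map_one])), by rw [← map_mul, h.2, map_one]⟩

lemma vecMulVec_ne_zero {a f : Fin 3 → F} (ha : a ≠ 0) (hf : f ≠ 0) : vecMulVec a f ≠ 0 := by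
  intro h
  obtain ⟨i, hi⟩ := Function.ne_iff.1 ha
  obtain ⟨j, hj⟩ := Function.ne_iff.1 hf
  have := congrFun (congrFun h i) j
  rw [vecMulVec_apply] at this
  exact (mul_eq_zero.1 this).elim hi hj

lemma vecMulVec_mul_vecMulVec' (a f b g : Fin 3 → F) :
    vecMulVec a f * vecMulVec b g = (f ⬝ᵥ b) • vecMulVec a g := by
  ext i j
  simp [Matrix.mul_apply, vecMulVec_apply, dotProduct, Fin.sum_univ_three]
  ring

lemma tv_mul_tv (a f b g : Fin 3 → F) (h : f ⬝ᵥ a = 0) (h' : g ⬝ᵥ b = 0) :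
    ((tv a f h * tv b g h' : SL(3, F)) : Matrix (Fin 3) (Fin 3) F) =
      1 + (vecMulVec a f + vecMulVec b g + (f ⬝ᵥ b) • vecMulVec a g) := by
  rw [Matrix.SpecialLinearGroup.coe_mul, coe_tv, coe_tv, add_mul, one_mul, mul_add, mul_one,
    vecMulVec_mul_vecMulVec']
  abel

lemma commute_tv_of {a f b g : Fin 3 → F} (h : f ⬝ᵥ a = 0) (h' : g ⬝ᵥ b = 0)
    (h1 : f ⬝ᵥ b = 0) (h2 : g ⬝ᵥ a = 0) : Commute (tv a f h) (tv b g h') := by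
  apply coe_injective
  rw [tv_mul_tv, tv_mul_tv, h1, h2, zero_smul, zero_smul, add_comm (vecMulVec a f)]

/-- Comparing the two products leaves (f·b) a⊗g = (g·a) b⊗f. Applied to b, the left side vanishes
because g·b = 0; so if f·b ≠ 0, then (g·a)b = 0 and a⊗g = 0, a contradiction. -/
lemma dotProduct_eq_zero_of_commute_tv {a f b g : Fin 3 → F} (h : f ⬝ᵥ a = 0) (h' : g ⬝ᵥ b = 0)
    (ha : a ≠ 0) (hg : g ≠ 0)
    (hc : Commute (tv a f h) (tv b g h')) : f ⬝ᵥ b = 0 := by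
  have h0 := coe_congr hc.eq
  rw [tv_mul_tv, tv_mul_tv, add_comm (vecMulVec b g)] at h0
  have h1 : (f ⬝ᵥ b) • vecMulVec a g = (g ⬝ᵥ a) • vecMulVec b f :=
    add_left_cancel (add_left_cancel h0)
  have h2 := congrArg (fun M => M *ᵥ b) h1
  simp only [smul_mulVec, vecMulVec_mulVec, h'] at h2
  simp only [MulOpposite.op_zero, zero_smul, smul_zero] at h2
  by_contra hfb
  have hgb : (g ⬝ᵥ a) • b = 0 := by
    have h3 := h2.symm
    rw [op_smul_eq_smul, smul_comm] at h3
    exact (smul_eq_zero.1 h3).resolve_left hfb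
  have h3 : (f ⬝ᵥ b) • vecMulVec a g = 0 := by
    rw [h1, ← smul_vecMulVec, hgb, zero_vecMulVec]
  exact vecMulVec_ne_zero ha hg ((smul_eq_zero.1 h3).resolve_left hfb)

lemma commute_tv_iff {a f b g : Fin 3 → F} (h : f ⬝ᵥ a = 0) (h' : g ⬝ᵥ b = 0)
    (ha : a ≠ 0) (hf : f ≠ 0) (hb : b ≠ 0) (hg : g ≠ 0) :
    Commute (tv a f h) (tv b g h') ↔ f ⬝ᵥ b = 0 ∧ g ⬝ᵥ a = 0 :=
  ⟨fun hc => ⟨dotProduct_eq_zero_of_commute_tv h h' ha hg hc,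
    dotProduct_eq_zero_of_commute_tv h' h hb hf hc.symm⟩, fun hc => commute_tv_of h h' hc.1 hc.2⟩

lemma exists_dotProduct_eq_zero (a b : Fin 3 → F) :
    ∃ f : Fin 3 → F, f ≠ 0 ∧ f ⬝ᵥ a = 0 ∧ f ⬝ᵥ b = 0 := by
  -- The zero row pads two linear conditions to a singular square system.
  have : (Matrix.of ![a, b, 0]).det = 0 := by
    simp [det_fin_three]
  obtain ⟨f, hf, h⟩ := Matrix.exists_mulVec_eq_zero_iff.2 this
  refine ⟨f, hf, ?_, ?_⟩
  · have := congrFun h 0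
    rw [dotProduct_comm]
    simpa [mulVec] using this
  · have := congrFun h 1
    rw [dotProduct_comm]
    simpa [mulVec] using this

variable [CharP F 2]

lemma isInvol_tv {a f : Fin 3 → F} (h : f ⬝ᵥ a = 0) (ha : a ≠ 0) (hf : f ≠ 0) :
    IsInvol (tv a f h) := by
  constructor
  · intro h1
    have h2 := coe_congr h1
    rw [coe_tv] at h2
    exact vecMulVec_ne_zero ha hf (add_eq_left.1 h2)
  · apply coe_injective
    rw [tv_mul_tv, h, zero_smul, add_zero, CharTwo.add_self_eq_zero, add_zero]
    rfl

/-- In characteristic 2, N = T - 1 squares to zero, so its range lies in its kernel and its rank is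
at most 3/2, hence one. Writing N = a⊗f, the relation N² = 0 becomes f·a = 0. -/
lemma IsInvol.exists_eq_tv {T : SL(3, F)} (hT : IsInvol T) :
    ∃ (a f : Fin 3 → F) (h : f ⬝ᵥ a = 0), a ≠ 0 ∧ f ≠ 0 ∧ T = tv a f h := by
  set N : Matrix (Fin 3) (Fin 3) F := T - 1 with hN
  have hTN : (T : Matrix (Fin 3) (Fin 3) F) = 1 + N := by rw [hN]; abel
  have hNN : N * N = 0 := by
    have h := coe_congr hT.2
    rw [Matrix.SpecialLinearGroup.coe_mul] at h
    rw [hN, sub_mul, mul_sub, mul_sub, h]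
    simp only [Matrix.SpecialLinearGroup.coe_one, mul_one, one_mul]
    have h2 : (1 - (T : Matrix (Fin 3) (Fin 3) F) - (T - 1)) = 1 + 1 - (T + T) := by abel
    rw [h2, CharTwo.add_self_eq_zero, CharTwo.add_self_eq_zero, sub_zero]
  have hN0 : N ≠ 0 := by
    intro h
    rw [h, add_zero] at hTN
    exact hT.1 (coe_injective hTN)
  have hle : LinearMap.range N.mulVecLin ≤ LinearMap.ker N.mulVecLin := by
    rintro _ ⟨x, rfl⟩
    simp [hNN]
  have hr := LinearMap.finrank_range_add_finrank_ker N.mulVecLin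
  have hle' := Submodule.finrank_mono hle
  simp only [Module.finrank_fintype_fun_eq_card, Fintype.card_fin] at hr
  obtain ⟨a, ha⟩ := finrank_le_one_iff.1
    (show Module.finrank F (LinearMap.range N.mulVecLin) ≤ 1 by omega)
  choose c hc using ha
  let f : Fin 3 → F := fun j => c ⟨N.mulVecLin (Pi.single j 1), ⟨_, rfl⟩⟩
  have hNf : N = vecMulVec a.1 f := by
    ext i j
    have := congrFun (congrArg Subtype.val (hc ⟨N.mulVecLin (Pi.single j 1), ⟨_, rfl⟩⟩)) i
    simp only [mulVecLin_apply, SetLike.val_smul, Pi.smul_apply, smul_eq_mul, mulVec_single_one,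
      col_apply] at this
    rw [vecMulVec_apply, ← this, mul_comm]
    simp [f]
  have ha0 : a.1 ≠ 0 := by
    intro h
    rw [h, zero_vecMulVec] at hNf
    exact hN0 hNf
  have hf0 : f ≠ 0 := by
    intro h
    rw [h, vecMulVec_zero] at hNf
    exact hN0 hNf
  have hfa : f ⬝ᵥ a.1 = 0 := by
    rw [hNf, vecMulVec_mul_vecMulVec'] at hNN
    exact (smul_eq_zero.1 hNN).resolve_right (vecMulVec_ne_zero ha0 hf0)
  exact ⟨a.1, f, hfa, ha0, hf0, coe_injective (by rw [hTN, coe_tv, ← hNf])⟩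

end Transvections

/-! ### Homomorphisms `φ` on SL(3, F) whose kernel is the center: PSL(3, F) and its copies inside G.
-/

section Projective

variable {F : Type*} [Field F] {G : Type*} [Group G] {φ : SL(3, F) →* G}

lemma mem_center_iff_scalar {A : SL(3, F)} :
    A ∈ Subgroup.center SL(3, F) ↔ ∃ r : F, (A : Matrix (Fin 3) (Fin 3) F) = r • 1 := by
  rw [Matrix.SpecialLinearGroup.mem_center_iff]
  constructor
  · rintro ⟨r, -, hr⟩
    exact ⟨r, by rw [← hr, smul_one_eq_diagonal]; rfl⟩
  · rintro ⟨r, hr⟩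
    refine ⟨r, ?_, by rw [hr, smul_one_eq_diagonal]; rfl⟩
    have h := A.2
    rw [hr, det_smul, det_one, mul_one] at h
    exact h

lemma pow_three_eq_one_of_smul {A B : SL(3, F)} {r : F}
    (h : (A : Matrix (Fin 3) (Fin 3) F) = r • (B : Matrix (Fin 3) (Fin 3) F)) : r ^ 3 = 1 := by
  have h' := A.2
  rw [h, det_smul, B.2, mul_one] at h'
  simpa using h'

lemma map_eq_one_iff_scalar (hφ : φ.ker = Subgroup.center SL(3, F)) {A : SL(3, F)} :
    φ A = 1 ↔ ∃ r : F, (A : Matrix (Fin 3) (Fin 3) F) = r • 1 := by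
  rw [← MonoidHom.mem_ker, hφ, mem_center_iff_scalar]

lemma map_eq_map_iff_smul (hφ : φ.ker = Subgroup.center SL(3, F)) {A B : SL(3, F)} :
    φ A = φ B ↔ ∃ r : F, (A : Matrix (Fin 3) (Fin 3) F) = r • (B : Matrix (Fin 3) (Fin 3) F) := by
  rw [← mul_inv_eq_one, ← map_inv, ← map_mul, map_eq_one_iff_scalar hφ]
  have : ∀ r : F, ((A * B⁻¹ : SL(3, F)) : Matrix (Fin 3) (Fin 3) F) = r • 1 ↔
      (A : Matrix (Fin 3) (Fin 3) F) = r • (B : Matrix (Fin 3) (Fin 3) F) := by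
    intro r
    have hB : ((B⁻¹ : SL(3, F)) : Matrix (Fin 3) (Fin 3) F) * B = 1 := by
      rw [← Matrix.SpecialLinearGroup.coe_mul, inv_mul_cancel, Matrix.SpecialLinearGroup.coe_one]
    have hB' : (B : Matrix (Fin 3) (Fin 3) F) * (B⁻¹ : SL(3, F)) = 1 := by
      rw [← Matrix.SpecialLinearGroup.coe_mul, mul_inv_cancel, Matrix.SpecialLinearGroup.coe_one]
    rw [Matrix.SpecialLinearGroup.coe_mul]
    constructor
    · intro h
      have := congrArg (· * (B : Matrix (Fin 3) (Fin 3) F)) h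
      simp only [mul_assoc, hB, mul_one, smul_mul_assoc, one_mul] at this
      exact this
    · intro h
      rw [h, smul_mul_assoc, hB']
  simp_rw [this]

/-- Multiplication by a cube root of unity preserves `SL(3, F)`. -/
def scaleSL (r : F) (hr : r ^ 3 = 1) (A : SL(3, F)) : SL(3, F) :=
  ⟨r • (A : Matrix (Fin 3) (Fin 3) F), by rw [det_smul, A.2, mul_one]; simpa using hr⟩

lemma coe_scaleSL (r : F) (hr : r ^ 3 = 1) (A : SL(3, F)) :
    (scaleSL r hr A : Matrix (Fin 3) (Fin 3) F) = r • (A : Matrix (Fin 3) (Fin 3) F) := rfl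

lemma map_scaleSL (hφ : φ.ker = Subgroup.center SL(3, F)) (r : F) (hr : r ^ 3 = 1)
    (A : SL(3, F)) : φ (scaleSL r hr A) = φ A :=
  (map_eq_map_iff_smul hφ).2 ⟨r, rfl⟩

lemma eq_one_of_smul_one_eq_one {r : F} (h : (r • 1 : Matrix (Fin 3) (Fin 3) F) = 1) : r = 1 := by
  simpa using congrFun (congrFun h 0) 0

/-- A preimage A has A² = c scalar with c³ = 1, and then cA is an involution with the same image. -/
lemma IsInvol.exists_lift (hφ : φ.ker = Subgroup.center SL(3, F)) {t : G} (ht : IsInvol t)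
    (hr : t ∈ φ.range) : ∃ T, IsInvol T ∧ φ T = t := by
  obtain ⟨A, rfl⟩ := hr
  have h1 := ht.2
  rw [← map_mul, map_eq_one_iff_scalar hφ] at h1
  obtain ⟨c, hc⟩ := h1
  have hc3 : c ^ 3 = 1 := pow_three_eq_one_of_smul (A := A * A) (B := 1) hc
  refine ⟨scaleSL c hc3 A, ⟨?_, ?_⟩, map_scaleSL hφ c hc3 A⟩
  · intro h
    apply ht.1
    rw [← map_scaleSL hφ c hc3 A, h, map_one]
  · apply coe_injective
    rw [Matrix.SpecialLinearGroup.coe_mul, coe_scaleSL, smul_mul_smul_comm,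
      ← Matrix.SpecialLinearGroup.coe_mul, hc, smul_smul,
      show c * c * c = c ^ 3 by ring, hc3, one_smul]
    rfl

variable [CharP F 2]

lemma eq_one_of_sq_eq_one {r : F} (h : r ^ 2 = 1) : r = 1 := by
  have h2 : (r + 1) ^ 2 = 0 := by
    rw [CharTwo.add_sq, h, one_pow, CharTwo.add_self_eq_zero]
  exact CharTwo.add_eq_zero.1 (pow_eq_zero_iff two_ne_zero |>.1 h2)

lemma IsInvol.map_ne_one (hφ : φ.ker = Subgroup.center SL(3, F)) {T : SL(3, F)}
    (hT : IsInvol T) : φ T ≠ 1 := by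
  intro h
  obtain ⟨r, hr⟩ := (map_eq_one_iff_scalar hφ).1 h
  have h2 := coe_congr hT.2
  rw [Matrix.SpecialLinearGroup.coe_mul, hr, smul_mul_smul_comm, one_mul, ← pow_two] at h2
  have := eq_one_of_sq_eq_one (eq_one_of_smul_one_eq_one h2)
  rw [this, one_smul] at hr
  exact hT.1 (coe_injective hr)

lemma IsInvol.map_isInvol (hφ : φ.ker = Subgroup.center SL(3, F)) {T : SL(3, F)}
    (hT : IsInvol T) : IsInvol (φ T) :=
  ⟨hT.map_ne_one hφ, by rw [← map_mul, hT.2, map_one]⟩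

/-- The scalar relating T and U has square 1, hence is 1 in characteristic 2. So an involution of
the image has only one lift of square 1, and commutation of images lifts as well. -/
lemma IsInvol.eq_of_map_eq (hφ : φ.ker = Subgroup.center SL(3, F)) {T U : SL(3, F)}
    (hT : IsInvol T) (hU : U * U = 1) (h : φ T = φ U) : T = U := by
  obtain ⟨r, hr⟩ := (map_eq_map_iff_smul hφ).1 h
  have h2 := coe_congr hT.2
  have h3 := coe_congr hU
  rw [Matrix.SpecialLinearGroup.coe_mul] at h3
  rw [Matrix.SpecialLinearGroup.coe_mul, hr, smul_mul_smul_comm, h3, ← pow_two] at h2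
  have := eq_one_of_sq_eq_one (eq_one_of_smul_one_eq_one h2)
  rw [this, one_smul] at hr
  exact coe_injective hr

lemma IsInvol.commute_of_map (hφ : φ.ker = Subgroup.center SL(3, F)) {T U : SL(3, F)}
    (hU : IsInvol U) (h : Commute (φ T) (φ U)) : Commute T U := by
  have h1 : φ (T * U * T⁻¹) = φ U := by
    rw [map_mul, map_mul, map_inv, h.eq, mul_inv_cancel_right]
  have h2 : (T * U * T⁻¹) * (T * U * T⁻¹) = 1 := by
    have : (T * U * T⁻¹) * (T * U * T⁻¹) = T * (U * U) * T⁻¹ := by group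
    rw [this, hU.2, mul_one, mul_inv_cancel]
  have := hU.eq_of_map_eq hφ h2 h1.symm
  exact (mul_inv_eq_iff_eq_mul.1 this.symm)

/-- Any two involutions of `PSL(3, F)` are joined by a path of commuting involutions. -/
lemma engelPath_of_isInvol (hφ : φ.ker = Subgroup.center SL(3, F)) {T U : SL(3, F)}
    (hT : IsInvol T) (hU : IsInvol U) : EngelPath 2 (φ T) (φ U) := by
  obtain ⟨a, f, h, ha, hf, rfl⟩ := hT.exists_eq_tv
  obtain ⟨b, g, h', hb, hg, rfl⟩ := hU.exists_eq_tv
  -- An axis k through both centers gives a path (a, f), (a, k), (b, k), (b, g) of pairwise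
  -- consecutive commuting transvections.
  obtain ⟨k, hk, hka, hkb⟩ := exists_dotProduct_eq_zero a b
  have h1 := (isInvol_tv hka ha hk).map_ne_one hφ
  have h2 := (isInvol_tv hkb hb hk).map_ne_one hφ
  exact ((EngelPath.of_commute (hT.map_ne_one hφ) h1 ((commute_tv_of _ _ h hka).map φ)).trans
    (EngelPath.of_commute h1 h2 ((commute_tv_of _ _ hkb hka).map φ))).trans
    (EngelPath.of_commute h2 (hU.map_ne_one hφ) ((commute_tv_of _ _ hkb h').map φ))

end Projective

end EngelGraphs

namespace EngelGraphs

open Matrix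

/-! ### Change of basis: conjugation by GL(3, F). -/

section Conjugation

variable {F : Type*} [Field F]

/-- Conjugation by an element of `GL(3, F)`, as an endomorphism of `SL(3, F)`. -/
def conjGL (P : GL (Fin 3) F) : SL(3, F) →* SL(3, F) where
  toFun A := ⟨(P : Matrix (Fin 3) (Fin 3) F) * A * (P⁻¹ : GL (Fin 3) F), by
    rw [det_mul, det_mul, A.2, mul_one, ← det_mul, ← Units.val_mul, mul_inv_cancel,
      Units.val_one, det_one]⟩
  map_one' := coe_injective (by
    change (P : Matrix (Fin 3) (Fin 3) F) * 1 * (P⁻¹ : GL (Fin 3) F) = 1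
    rw [mul_one, ← Units.val_mul, mul_inv_cancel, Units.val_one])
  map_mul' A B := coe_injective (by
    change (P : Matrix (Fin 3) (Fin 3) F) * (A * B) * (P⁻¹ : GL (Fin 3) F) =
      ((P : Matrix (Fin 3) (Fin 3) F) * A * (P⁻¹ : GL (Fin 3) F)) *
        ((P : Matrix (Fin 3) (Fin 3) F) * B * (P⁻¹ : GL (Fin 3) F))
    simp only [mul_assoc, Units.inv_mul_cancel_left])

lemma coe_conjGL (P : GL (Fin 3) F) (A : SL(3, F)) :
    (conjGL P A : Matrix (Fin 3) (Fin 3) F) =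
      (P : Matrix (Fin 3) (Fin 3) F) * A * (P⁻¹ : GL (Fin 3) F) := rfl

lemma conjGL_mul (P Q : GL (Fin 3) F) (A : SL(3, F)) :
    conjGL (P * Q) A = conjGL P (conjGL Q A) := by
  apply coe_injective
  simp only [coe_conjGL, _root_.mul_inv_rev, Units.val_mul, mul_assoc]

lemma conjGL_one (A : SL(3, F)) : conjGL 1 A = A := by
  apply coe_injective
  rw [coe_conjGL, inv_one, Units.val_one, one_mul, mul_one]

lemma conjGL_injective (P : GL (Fin 3) F) : Function.Injective (conjGL P) := by
  intro A B h
  have := congrArg (conjGL P⁻¹) h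
  rwa [← conjGL_mul, ← conjGL_mul, inv_mul_cancel, conjGL_one, conjGL_one] at this

lemma eq_conjGL_iff {P : GL (Fin 3) F} {A B : SL(3, F)} :
    A = conjGL P B ↔ (A : Matrix (Fin 3) (Fin 3) F) * P =
      (P : Matrix (Fin 3) (Fin 3) F) * B := by
  constructor
  · rintro rfl
    rw [coe_conjGL, mul_assoc, ← Units.val_mul, inv_mul_cancel, Units.val_one, mul_one]
  · intro h
    apply coe_injective
    rw [coe_conjGL, ← h, mul_assoc, ← Units.val_mul, mul_inv_cancel, Units.val_one, mul_one]

lemma exists_eq_conjGL (X : SL(3, F)) {b : Fin 3 → Fin 3 → F} (hb : LinearIndependent F b)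
    (N : Matrix (Fin 3) (Fin 3) F)
    (h : ∀ j, (X : Matrix (Fin 3) (Fin 3) F) *ᵥ b j = ∑ i, N i j • b i) :
    ∃ (P : GL (Fin 3) F) (N' : SL(3, F)), (N' : Matrix (Fin 3) (Fin 3) F) = N ∧
      X = conjGL P N' ∧ (P : Matrix (Fin 3) (Fin 3) F) = (Matrix.of b)ᵀ := by
  have hu : IsUnit (Matrix.of b)ᵀ := by
    rw [← Matrix.linearIndependent_cols_iff_isUnit]
    exact hb
  obtain ⟨P, hP⟩ := hu
  have hXP : (X : Matrix (Fin 3) (Fin 3) F) * P = (P : Matrix (Fin 3) (Fin 3) F) * N := by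
    ext i j
    have := congrFun (h j) i
    rw [hP]
    simp only [Matrix.mul_apply, transpose_apply, of_apply]
    simp only [mulVec, dotProduct, Finset.sum_apply, Pi.smul_apply, smul_eq_mul] at this
    rw [this]
    exact Finset.sum_congr rfl fun k _ => mul_comm _ _
  have hdet : N.det = 1 := by
    have h1 := congrArg det hXP
    rw [det_mul, det_mul, X.2, one_mul] at h1
    have h2 : (P : Matrix (Fin 3) (Fin 3) F).det ≠ 0 :=
      ((Matrix.isUnit_iff_isUnit_det _).1 P.isUnit).ne_zero
    exact mul_left_cancel₀ h2 (by rw [mul_one]; exact h1.symm)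
  exact ⟨P, ⟨N, hdet⟩, rfl, eq_conjGL_iff.2 hXP, hP⟩

lemma linearIndependent_three {v w x : Fin 3 → F} (h : (v ⨯₃ w) ⬝ᵥ x ≠ 0) :
    LinearIndependent F ![v, w, x] := by
  have : (Matrix.of ![v, w, x]).det ≠ 0 := by
    have h1 : (Matrix.of ![v, w, x]).det = (v ⨯₃ w) ⬝ᵥ x := by
      simp [det_fin_three, cross_apply, dotProduct, Fin.sum_univ_three]
      ring
    rwa [h1]
  exact Matrix.linearIndependent_rows_iff_isUnit.2
    ((Matrix.isUnit_iff_isUnit_det _).2 (isUnit_iff_ne_zero.2 this))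

end Conjugation

/-! ### Matrices with an eigenvector and their arcs to and from involutions. -/

section Reducible

variable {F : Type*} [Field F]

/-- A matrix of determinant one is reducible if it has an eigenvector over the base field. -/
def IsReducible (X : SL(3, F)) : Prop :=
  ∃ v : Fin 3 → F, v ≠ 0 ∧ ∃ l : F, (X : Matrix (Fin 3) (Fin 3) F) *ᵥ v = l • v

lemma mulVec_tv_conj {X : SL(3, F)} {a f : Fin 3 → F} (h : f ⬝ᵥ a = 0) :
    ∃ h', X⁻¹ * tv a f h * X = tv ((X⁻¹ : SL(3, F)).1 *ᵥ a) (f ᵥ* X.1) h' := by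
  have hX : X.1 * (X⁻¹ : SL(3, F)).1 = 1 := by
    have := coe_congr (mul_inv_cancel X)
    rwa [Matrix.SpecialLinearGroup.coe_mul, Matrix.SpecialLinearGroup.coe_one] at this
  have hX' : (X⁻¹ : SL(3, F)).1 * X.1 = 1 := by
    have := coe_congr (inv_mul_cancel X)
    rwa [Matrix.SpecialLinearGroup.coe_mul, Matrix.SpecialLinearGroup.coe_one] at this
  refine ⟨?_, ?_⟩
  · rw [dotProduct_mulVec, vecMul_vecMul, hX, vecMul_one, h]
  · apply coe_injective
    rw [Matrix.SpecialLinearGroup.coe_mul, Matrix.SpecialLinearGroup.coe_mul, coe_tv, coe_tv,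
      mul_add, add_mul, mul_one, mul_vecMulVec, vecMulVec_mul, hX']

/-- If `X` fixes the center of a transvection `T`, then `T` commutes with `X⁻¹ T X`. -/
lemma commute_tv_conj {X : SL(3, F)} {v f : Fin 3 → F} {l : F}
    (hX : X.1 *ᵥ v = l • v) (h : f ⬝ᵥ v = 0) :
    Commute (tv v f h) (X⁻¹ * tv v f h * X) := by
  obtain ⟨h', h2⟩ := mulVec_tv_conj (X := X) h
  rw [h2]
  have hX' : (X⁻¹ : SL(3, F)).1 * X.1 = 1 := by
    have := coe_congr (inv_mul_cancel X)
    rwa [Matrix.SpecialLinearGroup.coe_mul, Matrix.SpecialLinearGroup.coe_one] at this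
  refine commute_tv_of _ _ ?_ ?_
  · by_cases hl : l = 0
    · have h3 := congrArg (fun w => (X⁻¹ : SL(3, F)).1 *ᵥ w) hX
      simp only [mulVec_mulVec, hX', one_mulVec, hl, zero_smul, mulVec_zero] at h3
      rw [h3, mulVec_zero, dotProduct_zero]
    · have h3 : v = l • ((X⁻¹ : SL(3, F)).1 *ᵥ v) := by
        have h3 := congrArg (fun w => (X⁻¹ : SL(3, F)).1 *ᵥ w) hX
        simpa only [mulVec_mulVec, hX', one_mulVec, mulVec_smul] using h3
      have h4 : l * (f ⬝ᵥ ((X⁻¹ : SL(3, F)).1 *ᵥ v)) = 0 := by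
        rw [← smul_eq_mul, ← dotProduct_smul, ← h3, h]
      exact (mul_eq_zero.1 h4).resolve_left hl
  · rw [← dotProduct_mulVec, hX, dotProduct_smul, h, smul_zero]

lemma commute_conj_conjGL {P : GL (Fin 3) F} {N T : SL(3, F)} (h : Commute N (T⁻¹ * N * T)) :
    Commute (conjGL P N) ((conjGL P T)⁻¹ * conjGL P N * conjGL P T) := by
  have := h.map (conjGL P)
  simpa using this

/-- An explicit basis w, x of the plane f = 0, chosen according to a nonzero coordinate of f so that
(v × w)·x is that coordinate, up to sign, times f·v. -/
lemma exists_basis_of_dotProduct_ne_zero {f v : Fin 3 → F} (hfv : f ⬝ᵥ v ≠ 0) :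
    ∃ w x : Fin 3 → F, f ⬝ᵥ w = 0 ∧ f ⬝ᵥ x = 0 ∧ (v ⨯₃ w) ⬝ᵥ x ≠ 0 := by
  have hf : f ≠ 0 := by
    rintro rfl
    exact hfv (zero_dotProduct _)
  have key : ∀ (w x : Fin 3 → F) (c : F), c ≠ 0 → f ⬝ᵥ w = 0 → f ⬝ᵥ x = 0 →
      (v ⨯₃ w) ⬝ᵥ x = c * (f ⬝ᵥ v) →
      ∃ w x : Fin 3 → F, f ⬝ᵥ w = 0 ∧ f ⬝ᵥ x = 0 ∧ (v ⨯₃ w) ⬝ᵥ x ≠ 0 := by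
    intro w x c hc h1 h2 h3
    exact ⟨w, x, h1, h2, h3 ▸ mul_ne_zero hc hfv⟩
  obtain ⟨i, hi⟩ := Function.ne_iff.1 hf
  fin_cases i
  · refine key ![-f 1, f 0, 0] ![-f 2, 0, f 0] (f 0) hi ?_ ?_ ?_ <;>
      simp [cross_apply, dotProduct, Fin.sum_univ_three] <;> ring
  · refine key ![f 1, -f 0, 0] ![0, -f 2, f 1] (- f 1) (neg_ne_zero.2 hi) ?_ ?_ ?_ <;>
      simp [cross_apply, dotProduct, Fin.sum_univ_three] <;> ring
  · refine key ![f 2, 0, -f 0] ![0, f 2, -f 1] (f 2) hi ?_ ?_ ?_ <;>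
      simp [cross_apply, dotProduct, Fin.sum_univ_three] <;> ring

/-- A vector in the span of three independent vectors, expanded through a dual functional. -/
lemma exists_eq_of_linearIndependent {b : Fin 3 → Fin 3 → F} (hb : LinearIndependent F b)
    (y : Fin 3 → F) : ∃ c : Fin 3 → F, y = ∑ i, c i • b i := by
  have hspan : Submodule.span F (Set.range b) = ⊤ :=
    hb.span_eq_top_of_card_eq_finrank (by simp)
  have hy : y ∈ Submodule.span F (Set.range b) := hspan ▸ Submodule.mem_top
  obtain ⟨c, hc⟩ := (Submodule.mem_span_range_iff_exists_fun F).1 hy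
  exact ⟨c, hc.symm⟩

variable [CharP F 2]

/-- T fixes the first coordinate and acts on the plane of the lower block B by a matrix of square 1.
If the diagonal entries of B agree, T is chosen to centralize B. If not, T conjugates B to its
adjugate, which commutes with B; in characteristic 2 the adjugate only swaps the diagonal entries.
-/
lemma exists_isInvol_of_block [Finite F] {N : SL(3, F)} {l p q r s : F}
    (hN : (N : Matrix (Fin 3) (Fin 3) F) = !![l, 0, 0; 0, p, q; 0, r, s]) :
    ∃ T : SL(3, F), IsInvol T ∧ Commute N (T⁻¹ * N * T) := by
  have two : (2 : F) = 0 := CharTwo.two_eq_zero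
  have key : ∀ (a b c : F) (hd : a * a + b * c = 1) (_ : ¬ (b = 0 ∧ c = 0))
      (N' : Matrix (Fin 3) (Fin 3) F)
      (_ : !![l, 0, 0; 0, p, q; 0, r, s] * !![1, 0, 0; 0, a, b; 0, c, a] =
        !![1, 0, 0; 0, a, b; 0, c, a] * N')
      (_ : !![l, 0, 0; 0, p, q; 0, r, s] * N' = N' * !![l, 0, 0; 0, p, q; 0, r, s]),
      ∃ T : SL(3, F), IsInvol T ∧ Commute N (T⁻¹ * N * T) := by
    intro a b c hd hbc N' h1 h2
    let T : SL(3, F) := ⟨!![1, 0, 0; 0, a, b; 0, c, a], by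
      simp [det_fin_three]
      linear_combination hd - b * c * two⟩
    have hT : IsInvol T := by
      constructor
      · intro h
        have h' := coe_congr h
        apply hbc
        constructor
        · simpa [T] using congrFun (congrFun h' 1) 2
        · simpa [T] using congrFun (congrFun h' 2) 1
      · apply coe_injective
        rw [Matrix.SpecialLinearGroup.coe_mul]
        ext i j
        fin_cases i <;> fin_cases j <;> simp [T, Matrix.mul_apply, Fin.sum_univ_three]
        · linear_combination hd
        · linear_combination a * b * two
        · linear_combination a * c * two
        · linear_combination hd
    have hTT : T.1 * T.1 = 1 := by
      have := coe_congr hT.2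
      rwa [Matrix.SpecialLinearGroup.coe_mul, Matrix.SpecialLinearGroup.coe_one] at this
    refine ⟨T, hT, ?_⟩
    rw [hT.inv_eq]
    have h3 : ((T * N * T : SL(3, F)) : Matrix (Fin 3) (Fin 3) F) = N' := by
      rw [Matrix.SpecialLinearGroup.coe_mul, Matrix.SpecialLinearGroup.coe_mul, hN, mul_assoc]
      change T.1 * (_ * !![1, 0, 0; 0, a, b; 0, c, a]) = _
      rw [h1, ← mul_assoc]
      change T.1 * T.1 * N' = N'
      rw [hTT, one_mul]
    apply coe_injective
    rw [Matrix.SpecialLinearGroup.coe_mul, h3, Matrix.SpecialLinearGroup.coe_mul, h3, hN, h2]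
  by_cases hr : r = 0
  · subst hr
    by_cases hps : p = s
    · subst hps
      refine key 1 1 0 (by ring) (by simp) !![l, 0, 0; 0, p, q; 0, 0, p] ?_ ?_
      · simp [add_comm]
      · rfl
    · by_cases hq : q = 0
      · subst hq
        refine key 0 1 1 (by ring) (by simp) !![l, 0, 0; 0, s, 0; 0, 0, p] ?_ ?_
        · simp
        · simp [mul_comm]
      · refine key 1 0 ((p + s) / q) (by ring) ?_ !![l, 0, 0; 0, s, q; 0, 0, p] ?_ ?_
        · rintro ⟨-, h⟩
          rw [div_eq_zero_iff] at h
          rcases h with h | h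
          · exact hps (CharTwo.add_eq_zero.1 h)
          · exact hq h
        · have h1 : p + q * ((p + s) / q) = s := by
            field_simp
            linear_combination p * two
          have h2 : (p + s) / q * q = p + s := by field_simp
          have h3 : s * ((p + s) / q) = (p + s) / q * s := mul_comm _ _
          simp [h1, h2, h3]
          linear_combination -p * two
        · simp [mul_comm]
          linear_combination (p * q - q * s) * two
  · by_cases hps : p = s
    · subst hps
      obtain ⟨e, he⟩ := FiniteField.isSquare_of_char_two (F := F)
        (ringChar.eq_iff.2 inferInstance) (q / r)
      have hq : q = e * e * r := by rw [← he]; field_simp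
      refine key (1 + e * r) q r ?_ (fun h => hr h.2) !![l, 0, 0; 0, p, q; 0, r, p] ?_ rfl
      · rw [hq]
        linear_combination (e * r + e * e * r * r) * two
      · simp
        refine ⟨⟨?_, ?_⟩, ?_, ?_⟩ <;> ring
    · refine key 1 ((p + s) / r) 0 (by ring) ?_ !![l, 0, 0; 0, s, q; 0, r, p] ?_ ?_
      · rintro ⟨h, -⟩
        rw [div_eq_zero_iff] at h
        rcases h with h | h
        · exact hps (CharTwo.add_eq_zero.1 h)
        · exact hr h
      · have h1 : r * ((p + s) / r) = p + s := by field_simp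
        have h2 : (p + s) / r * r = p + s := by field_simp
        have h3 : p * ((p + s) / r) = (p + s) / r * p := mul_comm _ _
        simp [h1, h2, h3]
        refine ⟨⟨?_, ?_⟩, ?_⟩
        · linear_combination - s * two
        · ring
        · linear_combination s * two
      · simp [mul_comm]
        exact ⟨by linear_combination (p * q - q * s) * two,
          by linear_combination (r * s - p * r) * two⟩

/-- A reducible matrix admits an involution `T` with `[T, X, X] = 1`. -/
lemma IsReducible.exists_isInvol [Finite F] {X : SL(3, F)} (hX : IsReducible X) :
    ∃ T : SL(3, F), IsInvol T ∧ Commute X (T⁻¹ * X * T) := by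
  obtain ⟨v, hv, l, hl⟩ := hX
  -- The eigenvalue l of v also has a left eigenvector f.
  have hdet : (X.1 - l • 1).det = 0 := by
    rw [← Matrix.exists_mulVec_eq_zero_iff]
    refine ⟨v, hv, ?_⟩
    rw [sub_mulVec, hl, smul_mulVec, one_mulVec, sub_self]
  obtain ⟨f, hf, hfX⟩ := Matrix.exists_vecMul_eq_zero_iff.2 hdet
  rw [vecMul_sub, vecMul_smul, vecMul_one, sub_eq_zero] at hfX
  -- If f·v = 0, the transvection with center v and axis f commutes with X. Otherwise the space is
  -- the sum of the invariant subspaces spanned by v and given by f = 0, which is the block form.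
  by_cases hfv : f ⬝ᵥ v = 0
  · refine ⟨tv v f hfv, isInvol_tv hfv hv hf, ?_⟩
    have h1 : Commute X (tv v f hfv) := by
      apply coe_injective
      rw [Matrix.SpecialLinearGroup.coe_mul, Matrix.SpecialLinearGroup.coe_mul, coe_tv, mul_add,
        add_mul, mul_one, one_mul, mul_vecMulVec, vecMulVec_mul, hl, hfX, smul_vecMulVec,
        vecMulVec_smul]
    rw [mul_assoc, h1.eq, inv_mul_cancel_left]
  · obtain ⟨w, x, hw, hx, hb⟩ := exists_basis_of_dotProduct_ne_zero hfv
    have hb := linearIndependent_three hb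
    have hmem : ∀ y : Fin 3 → F, f ⬝ᵥ y = 0 → ∃ c d : F, X.1 *ᵥ y = c • w + d • x := by
      intro y hy
      obtain ⟨c, hc⟩ := exists_eq_of_linearIndependent hb (X.1 *ᵥ y)
      have h1 : f ⬝ᵥ (X.1 *ᵥ y) = 0 := by
        rw [dotProduct_mulVec, hfX, smul_dotProduct, hy, smul_zero]
      rw [hc] at h1
      simp only [Fin.sum_univ_three, cons_val_zero, cons_val_one, cons_val, dotProduct_add,
        dotProduct_smul, hw, hx, smul_eq_mul, mul_zero, add_zero] at h1
      have h2 := (mul_eq_zero.1 h1).resolve_right hfv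
      refine ⟨c 1, c 2, ?_⟩
      rw [hc, Fin.sum_univ_three, h2]
      simp
    obtain ⟨p, r, h1⟩ := hmem w hw
    obtain ⟨q, s, h2⟩ := hmem x hx
    obtain ⟨P, N, hN, rfl, -⟩ := exists_eq_conjGL X hb !![l, 0, 0; 0, p, q; 0, r, s] (by
      intro j
      fin_cases j
      · simpa [Fin.sum_univ_three] using hl
      · simpa [Fin.sum_univ_three] using h1
      · simpa [Fin.sum_univ_three] using h2)
    obtain ⟨T, hT, hc⟩ := exists_isInvol_of_block hN
    exact ⟨conjGL P T, hT.map_injective _ (conjGL_injective P), commute_conj_conjGL hc⟩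

end Reducible

end EngelGraphs

namespace EngelGraphs

open Matrix

/-! ### Irreducible matrices and the cubic field they generate. -/

section Irreducible

universe u

variable {F : Type u} [Field F]

lemma irreducible_charpoly {X : SL(3, F)} (hX : ¬ IsReducible X) : Irreducible X.1.charpoly := by
  apply Polynomial.irreducible_of_degree_le_three_of_not_isRoot
  · rw [charpoly_natDegree_eq_dim]
    simp
  · intro l hl
    rw [Polynomial.IsRoot, eval_charpoly] at hl
    obtain ⟨v, hv, h⟩ := Matrix.exists_mulVec_eq_zero_iff.2 hl
    refine hX ⟨v, hv, l, ?_⟩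
    rw [sub_mulVec, sub_eq_zero] at h
    rw [← h, scalar_apply, ← smul_one_eq_diagonal, smul_mulVec, one_mulVec]

/-- The regular representation of a cubic field embedded in the matrix algebra is the natural
module. -/
lemma exists_linearEquiv_of_cubic {K : Type*} [Field K] [Algebra F K]
    (L : K →ₐ[F] Matrix (Fin 3) (Fin 3) F) (hK : Module.finrank F K = 3) {v : Fin 3 → F}
    (hv : v ≠ 0) : ∃ E : K ≃ₗ[F] (Fin 3 → F), ∀ k, E k = L k *ᵥ v := by
  let E : K →ₗ[F] (Fin 3 → F) :=
    { toFun := fun k => L k *ᵥ v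
      map_add' := fun k k' => by rw [map_add, add_mulVec]
      map_smul' := fun c k => by rw [map_smul, smul_mulVec]; rfl }
  have hE : Function.Injective E := by
    rw [injective_iff_map_eq_zero]
    intro k hk
    by_contra hk0
    apply hv
    have h1 : L k⁻¹ *ᵥ (L k *ᵥ v) = 0 := by
      rw [show L k *ᵥ v = 0 from hk, mulVec_zero]
    rwa [mulVec_mulVec, ← map_mul, inv_mul_cancel₀ hk0, map_one, one_mulVec] at h1
  have : FiniteDimensional F K := FiniteDimensional.of_finrank_pos (by rw [hK]; norm_num)
  exact ⟨LinearEquiv.ofInjectiveOfFinrankEq E hE (by simp [hK]), fun k => rfl⟩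

/-- An irreducible matrix generates a cubic field extension inside the matrix algebra, which is
its own centralizer. -/
lemma exists_cubic_field {X : SL(3, F)} (hX : ¬ IsReducible X) :
    ∃ (K : Type u) (_ : Field K) (_ : Algebra F K) (L : K →ₐ[F] Matrix (Fin 3) (Fin 3) F) (θ : K),
      Module.finrank F K = 3 ∧ L θ = X.1 ∧ LinearIndependent F ![1, θ, θ ^ 2] ∧
      (∀ k : K, ∃ p : Polynomial F, Polynomial.aeval θ p = k) ∧
      ∀ Y : Matrix (Fin 3) (Fin 3) F, Commute Y X.1 → ∃ k, L k = Y := by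
  have hirr := irreducible_charpoly hX
  have hdeg : X.1.charpoly.natDegree = 3 := by
    rw [charpoly_natDegree_eq_dim]; simp
  have : Fact (Irreducible X.1.charpoly) := ⟨hirr⟩
  let L : AdjoinRoot X.1.charpoly →ₐ[F] Matrix (Fin 3) (Fin 3) F :=
    Ideal.Quotient.liftₐ _ (Polynomial.aeval X.1) (by
      intro p hp
      obtain ⟨r, rfl⟩ := Ideal.mem_span_singleton.1 hp
      rw [map_mul, aeval_self_charpoly, zero_mul])
  let θ := AdjoinRoot.root X.1.charpoly
  have hL : ∀ p : Polynomial F, L (Polynomial.aeval θ p) = Polynomial.aeval X.1 p := by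
    intro p
    rw [AdjoinRoot.aeval_eq]
    rfl
  have hLθ : L θ = X.1 := by
    have := hL Polynomial.X
    rwa [Polynomial.aeval_X, Polynomial.aeval_X] at this
  have hsurj : ∀ k : AdjoinRoot X.1.charpoly, ∃ p : Polynomial F, Polynomial.aeval θ p = k := by
    intro k
    obtain ⟨p, rfl⟩ := AdjoinRoot.mk_surjective k
    exact ⟨p, AdjoinRoot.aeval_eq p⟩
  have hfin : Module.finrank F (AdjoinRoot X.1.charpoly) = 3 := by
    rw [(AdjoinRoot.powerBasis hirr.ne_zero).finrank, AdjoinRoot.powerBasis_dim, hdeg]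
  refine ⟨AdjoinRoot X.1.charpoly, inferInstance, inferInstance, L, θ, hfin, hLθ, ?_, hsurj, ?_⟩
  · rw [Fintype.linearIndependent_iff]
    intro c hc
    simp only [Fin.sum_univ_three, cons_val_zero, cons_val_one, cons_val] at hc
    let p : Polynomial F := Polynomial.C (c 2) * Polynomial.X ^ 2 + Polynomial.C (c 1) *
      Polynomial.X + Polynomial.C (c 0)
    have hp : AdjoinRoot.mk X.1.charpoly p = 0 := by
      rw [← AdjoinRoot.aeval_eq]
      simp only [p, map_add, map_mul, Polynomial.aeval_C, Polynomial.aeval_X, map_pow,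
        ← Algebra.smul_def]
      rw [← hc, Algebra.algebraMap_eq_smul_one]
      abel
    have hp0 : p = 0 := Polynomial.eq_zero_of_dvd_of_natDegree_lt (AdjoinRoot.mk_eq_zero.1 hp) (by
      rw [hdeg]
      exact lt_of_le_of_lt Polynomial.natDegree_quadratic_le (by norm_num))
    intro i
    fin_cases i
    · have := congrArg (fun r => Polynomial.coeff r 0) hp0
      simpa [p] using this
    · have := congrArg (fun r => Polynomial.coeff r 1) hp0
      simpa [p, Polynomial.coeff_X, Polynomial.coeff_C] using this
    · have := congrArg (fun r => Polynomial.coeff r 2) hp0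
      simpa [p, Polynomial.coeff_X, Polynomial.coeff_C] using this
  · intro Y hY
    let v : Fin 3 → F := Pi.single 0 1
    have hv : v ≠ 0 := by simp [v]
    obtain ⟨E, hE⟩ := exists_linearEquiv_of_cubic L hfin hv
    have hcomm : ∀ k, Commute Y (L k) := by
      intro k
      obtain ⟨p, rfl⟩ := hsurj k
      rw [hL]
      have h1 : Polynomial.aeval X.1 p ∈ Subalgebra.centralizer F {Y} := by
        have h2 : X.1 ∈ Subalgebra.centralizer F {Y} := by
          rw [Subalgebra.mem_centralizer_iff]
          rintro _ rfl
          exact hY.eq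
        exact Algebra.adjoin_le (Set.singleton_subset_iff.2 h2)
          (Polynomial.aeval_mem_adjoin_singleton F X.1)
      exact (Subalgebra.mem_centralizer_iff F).1 h1 Y rfl
    -- A matrix commuting with the field is determined by its value at v, and the field carries v to
    -- every vector.
    obtain ⟨k, hk⟩ := E.surjective (Y *ᵥ v)
    refine ⟨k, Matrix.toLin'.injective (LinearMap.ext fun w => ?_)⟩
    obtain ⟨k', rfl⟩ := E.surjective w
    rw [toLin'_apply, toLin'_apply, hE, mulVec_mulVec, mulVec_mulVec, (hcomm k').eq,
      ← mulVec_mulVec _ (L k') Y, ← hk, hE, mulVec_mulVec, ← map_mul, ← map_mul, mul_comm]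

/-- An automorphism of a finite extension of finite fields has determinant `±1`. -/
lemma det_algEquiv_sq {K : Type*} [Field K] [Algebra F K] [FiniteDimensional F K]
    [Algebra.IsSeparable F K] (σ : K ≃ₐ[F] K) : (LinearMap.det σ.toLinearMap) ^ 2 = 1 := by
  let b := Module.finBasis F K
  -- The discriminant of a basis is unchanged by σ, but a change of basis multiplies it by the
  -- square of the determinant.
  have h1 := Algebra.discr_eq_discr_of_algEquiv b σ
  have h2 : (σ ∘ b : _ → K) =
      (b : _ → K) ᵥ* (LinearMap.toMatrix b b σ.toLinearMap).map (algebraMap F K) := by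
    funext j
    have h3 := b.sum_repr (σ (b j))
    simp only [vecMul, dotProduct, map_apply, Function.comp_apply]
    rw [← h3]
    refine Finset.sum_congr rfl fun i _ => ?_
    rw [LinearMap.toMatrix_apply, mul_comm, ← Algebra.smul_def]
    rfl
  rw [h2, Algebra.discr_of_matrix_vecMul, LinearMap.det_toMatrix] at h1
  have h4 := Algebra.discr_not_zero_of_basis F b
  exact mul_right_cancel₀ h4 (by rw [one_mul]; exact h1.symm)

/-- The map k ↦ L(k)v is an isomorphism from the cubic field to F³ and carries 1, θ, θ² to these
vectors. -/
lemma linearIndependent_cyclic {X : SL(3, F)} (hX : ¬ IsReducible X) {v : Fin 3 → F}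
    (hv : v ≠ 0) : LinearIndependent F ![v, X.1 *ᵥ v, X.1 *ᵥ (X.1 *ᵥ v)] := by
  obtain ⟨K, _, _, L, θ, hK, hθ, hli, -, -⟩ := exists_cubic_field hX
  obtain ⟨E, hE⟩ := exists_linearEquiv_of_cubic L hK hv
  have h := hli.map' E.toLinearMap E.ker
  have h2 : (E.toLinearMap ∘ ![1, θ, θ ^ 2] : Fin 3 → Fin 3 → F) =
      ![v, X.1 *ᵥ v, X.1 *ᵥ (X.1 *ᵥ v)] := by
    funext i
    fin_cases i
    · simp [hE]
    · simp [hE, hθ]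
    · simp [hE, hθ, pow_two]
  rw [← h2]
  exact h

lemma exists_eq_companion {X : SL(3, F)} (hX : ¬ IsReducible X) :
    ∃ (P : GL (Fin 3) F) (C : SL(3, F)) (c d : F),
      C.1 = !![0, 0, 1; 1, 0, c; 0, 1, d] ∧ X = conjGL P C := by
  have hv : (Pi.single 0 1 : Fin 3 → F) ≠ 0 := by simp
  have hli := linearIndependent_cyclic hX hv
  obtain ⟨c, hc⟩ := exists_eq_of_linearIndependent hli
    (X.1 *ᵥ (X.1 *ᵥ (X.1 *ᵥ Pi.single 0 1)))
  obtain ⟨P, C, hC, h, -⟩ := exists_eq_conjGL X hli !![0, 0, c 0; 1, 0, c 1; 0, 1, c 2] (by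
    intro j
    fin_cases j
    · simp [Fin.sum_univ_three]
    · simp [Fin.sum_univ_three]
    · simpa [Fin.sum_univ_three] using hc)
  have hdet := C.2
  rw [hC] at hdet
  have h0 : c 0 = 1 := by simpa [det_fin_three] using hdet
  rw [h0] at hC
  exact ⟨P, C, c 1, c 2, hC, h⟩

/-- D is the conjugate of diag(a, b, a) by the companion matrix. Its only entry off the diagonal
links the first and third coordinates, where diag(a, b, a) has the same entry a; hence the two
commute. -/
lemma exists_commute_diagonal (c d a b : F) : ∃ D : Matrix (Fin 3) (Fin 3) F,
    D * !![0, 0, 1; 1, 0, c; 0, 1, d] = !![0, 0, 1; 1, 0, c; 0, 1, d] * diagonal ![a, b, a] ∧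
      D * diagonal ![a, b, a] = diagonal ![a, b, a] * D := by
  refine ⟨!![a, 0, 0; 0, a, 0; (a - b) * d, 0, b], ?_, ?_⟩
  · ext i j
    fin_cases i <;> fin_cases j <;>
      simp [Matrix.mul_apply, Fin.sum_univ_three, diagonal_apply, mul_comm]
    ring
  · ext i j
    fin_cases i <;> fin_cases j <;>
      simp [Matrix.mul_apply, diagonal_apply, mul_comm]

lemma commute_conj_inv {G : Type*} [Group G] {x y : G} (h : Commute y (x * y * x⁻¹)) :
    Commute y (x⁻¹ * y * x) := by
  have := h.map (MulAut.conj x⁻¹).toMonoidHom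
  have h2 : x⁻¹ * (x * y * x⁻¹) * x = y := by group
  simp only [MulEquiv.coe_toMonoidHom, MulAut.conj_apply, inv_inv, h2] at this
  exact this.symm

variable [Finite F]

lemma exists_cube_ne_one (hF : 4 < Nat.card F) : ∃ a : F, a ≠ 0 ∧ a ^ 3 ≠ 1 := by
  by_contra! h
  have h1 : Monoid.exponent Fˣ ∣ 3 := by
    rw [Monoid.exponent_dvd_iff_forall_pow_eq_one]
    intro a
    exact Units.ext (by simpa using h a a.ne_zero)
  rw [IsCyclic.exponent_eq_card, Nat.card_units] at h1
  have := Nat.le_of_dvd (by norm_num) h1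
  omega

/-- If `4 < |F|`, an irreducible matrix has an arc to a reducible noncentral one. -/
lemma exists_reducible_of_irreducible (hF : 4 < Nat.card F) {X : SL(3, F)}
    (hX : ¬ IsReducible X) : ∃ Y : SL(3, F), IsReducible Y ∧ Y ∉ Subgroup.center SL(3, F) ∧
      Commute Y (X⁻¹ * Y * X) := by
  obtain ⟨P, C, c, d, hC, rfl⟩ := exists_eq_companion hX
  obtain ⟨a, ha, ha3⟩ := exists_cube_ne_one hF
  have hdet : (diagonal ![a, (a ^ 2)⁻¹, a]).det = 1 := by
    rw [det_diagonal, Fin.prod_univ_three]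
    simp
    field_simp
  obtain ⟨D, hD1, hD2⟩ := exists_commute_diagonal c d a (a ^ 2)⁻¹
  -- The middle entry makes the determinant 1, and a³ ≠ 1 makes Y nonscalar.
  let Y : SL(3, F) := ⟨diagonal ![a, (a ^ 2)⁻¹, a], hdet⟩
  have hY : ((C * Y * C⁻¹ : SL(3, F)) : Matrix (Fin 3) (Fin 3) F) = D := by
    have h1 : C.1 * (C⁻¹ : SL(3, F)).1 = 1 := by
      have := coe_congr (mul_inv_cancel C)
      rwa [Matrix.SpecialLinearGroup.coe_mul, Matrix.SpecialLinearGroup.coe_one] at this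
    rw [Matrix.SpecialLinearGroup.coe_mul, Matrix.SpecialLinearGroup.coe_mul, hC]
    change _ * diagonal ![a, (a ^ 2)⁻¹, a] * _ = _
    rw [← hD1, mul_assoc, ← hC]
    exact (congrArg (D * ·) h1).trans (mul_one D)
  have hcomm : Commute Y (C⁻¹ * Y * C) := by
    apply commute_conj_inv
    apply coe_injective
    rw [Matrix.SpecialLinearGroup.coe_mul Y, Matrix.SpecialLinearGroup.coe_mul _ Y, hY]
    exact hD2.symm
  refine ⟨conjGL P Y, ?_, ?_, commute_conj_conjGL hcomm⟩
  · refine ⟨P.1 *ᵥ Pi.single 0 1, ?_, a, ?_⟩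
    · intro h
      have h1 := congrArg (fun w => (P⁻¹ : GL (Fin 3) F).1 *ᵥ w) h
      simp only [mulVec_mulVec, mulVec_zero] at h1
      rw [← Units.val_mul, inv_mul_cancel, Units.val_one, one_mulVec] at h1
      simp at h1
    · rw [coe_conjGL, mulVec_mulVec, mul_assoc, ← Units.val_mul, inv_mul_cancel, Units.val_one,
        mul_one, ← mulVec_mulVec, ← mulVec_smul]
      congr 1
      change diagonal ![a, (a ^ 2)⁻¹, a] *ᵥ _ = _
      ext i
      fin_cases i <;> simp
  · intro h
    obtain ⟨r, hr⟩ := mem_center_iff_scalar.1 h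
    rw [coe_conjGL] at hr
    have h1 : Y.1 = r • 1 := by
      have h2 := congrArg (fun M => (P⁻¹ : GL (Fin 3) F).1 * M * P.1) hr
      simp only [mul_assoc, smul_mul_assoc, mul_smul_comm, Units.inv_mul, mul_one] at h2
      rwa [Units.inv_mul_cancel_left] at h2
    have h2 : a = r := by simpa [Y] using congrFun (congrFun h1 0) 0
    have h3 : (a ^ 2)⁻¹ = r := by simpa [Y] using congrFun (congrFun h1 1) 1
    rw [← h2] at h3
    apply ha3
    calc a ^ 3 = a ^ 2 * (a ^ 2)⁻¹ := by rw [h3]; ring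
      _ = 1 := mul_inv_cancel₀ (pow_ne_zero 2 ha)

variable [CharP F 2]

/-- An irreducible matrix can be reached along an arc from a reducible noncentral one. -/
lemma exists_reducible_to_irreducible {X : SL(3, F)} (hX : ¬ IsReducible X) :
    ∃ Y : SL(3, F), IsReducible Y ∧ Y ∉ Subgroup.center SL(3, F) ∧
      Commute X (Y⁻¹ * X * Y) := by
  obtain ⟨K, _, _, L, θ, hK, hθ, hli, hgen, -⟩ := exists_cubic_field hX
  have : FiniteDimensional F K := FiniteDimensional.of_finrank_pos (by rw [hK]; norm_num)
  have : Finite K := Module.finite_of_finite F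
  have hv : (Pi.single 0 1 : Fin 3 → F) ≠ 0 := by simp
  obtain ⟨E, hE⟩ := exists_linearEquiv_of_cubic L hK hv
  have hcard : Nat.card (K ≃ₐ[F] K) = 3 := by rw [IsGalois.card_aut_eq_finrank, hK]
  have : Nontrivial (K ≃ₐ[F] K) := Finite.one_lt_card_iff_nontrivial.1 (by rw [hcard]; norm_num)
  obtain ⟨σ, hσ⟩ := exists_ne (1 : K ≃ₐ[F] K)
  -- The Galois automorphism σ, transported to F³: conjugation by P acts on the embedded cubic field
  -- as σ.
  let P := LinearMap.toMatrix' (E.toLinearMap ∘ₗ σ.toLinearMap ∘ₗ E.symm.toLinearMap)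
  have hP : ∀ k, P *ᵥ E k = E (σ k) := by
    intro k
    rw [LinearMap.toMatrix'_mulVec]
    simp
  have hdet : P.det = 1 := by
    rw [LinearMap.det_toMatrix', LinearMap.det_conj]
    exact eq_one_of_sq_eq_one (det_algEquiv_sq σ)
  have hmul : ∀ k k', L k *ᵥ E k' = E (k * k') := by
    intro k k'
    rw [hE, hE, map_mul, mulVec_mulVec]
  let Y : SL(3, F) := ⟨P, hdet⟩
  have hXY : X.1 * P = P * L (σ.symm θ) := by
    apply Matrix.toLin'.injective
    apply LinearMap.ext
    intro w
    obtain ⟨k, rfl⟩ := E.surjective w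
    rw [toLin'_apply, toLin'_apply, ← mulVec_mulVec, ← mulVec_mulVec, hP, hmul, hP, ← hθ, hmul,
      map_mul σ, AlgEquiv.apply_symm_apply]
  have hconj : ((Y⁻¹ * X * Y : SL(3, F)) : Matrix (Fin 3) (Fin 3) F) = L (σ.symm θ) := by
    have h1 : (Y⁻¹ : SL(3, F)).1 * P = 1 := by
      have := coe_congr (inv_mul_cancel Y)
      rwa [Matrix.SpecialLinearGroup.coe_mul, Matrix.SpecialLinearGroup.coe_one] at this
    rw [Matrix.SpecialLinearGroup.coe_mul, Matrix.SpecialLinearGroup.coe_mul, mul_assoc]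
    change (Y⁻¹ : SL(3, F)).1 * (X.1 * P) = _
    rw [hXY, ← mul_assoc, h1, one_mul]
  have hYX : Commute X (Y⁻¹ * X * Y) := by
    apply coe_injective
    rw [Matrix.SpecialLinearGroup.coe_mul X, Matrix.SpecialLinearGroup.coe_mul _ X, hconj]
    rw [← hθ, ← map_mul, ← map_mul, mul_comm]
  -- Since σ fixes 1, the vector `E 1` is fixed by Y. If Y were central, σ would fix the generator θ
  -- and be trivial.
  refine ⟨Y, ⟨E 1, ?_, 1, ?_⟩, ?_, hYX⟩
  · rw [hE, map_one, one_mulVec]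
    exact hv
  · change P *ᵥ E 1 = _
    rw [hP, map_one, one_smul]
  · intro hc
    apply hσ
    have h1 : Y⁻¹ * X * Y = X := by
      rw [mul_assoc, ← Subgroup.mem_center_iff.1 hc X |>.symm, inv_mul_cancel_left]
    rw [h1] at hconj
    have h2 : L θ = L (σ.symm θ) := hθ.trans hconj
    have h3 : θ = σ.symm θ := L.toRingHom.injective h2
    have h4 : σ θ = θ := by
      conv_lhs => rw [h3]
      exact AlgEquiv.apply_symm_apply _ _
    ext k
    obtain ⟨p, rfl⟩ := hgen k
    have : σ (Polynomial.aeval θ p) = Polynomial.aeval (σ θ) p :=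
      (Polynomial.aeval_algHom_apply σ.toAlgHom θ p).symm
    rw [this, h4]
    rfl

end Irreducible

end EngelGraphs

namespace EngelGraphs

open Matrix

/-! ### Paths in Γ_2 between involutions and arbitrary elements of PSL(3, F). -/

section Paths

variable {F : Type*} [Field F] {G : Type*} [Group G] {φ : SL(3, F) →* G}

lemma map_ne_one_iff (hφ : φ.ker = Subgroup.center SL(3, F)) {A : SL(3, F)} :
    φ A ≠ 1 ↔ A ∉ Subgroup.center SL(3, F) := by
  rw [← hφ, MonoidHom.mem_ker]

lemma exists_isInvol_of_ne_zero [CharP F 2] {v : Fin 3 → F} (hv : v ≠ 0) (w : Fin 3 → F) :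
    ∃ (f : Fin 3 → F) (h : f ⬝ᵥ v = 0), f ⬝ᵥ w = 0 ∧ IsInvol (tv v f h) := by
  obtain ⟨f, hf, h1, h2⟩ := exists_dotProduct_eq_zero v w
  exact ⟨f, h1, h2, isInvol_tv h1 hv hf⟩

variable [CharP F 2]

lemma engelPath_of_isReducible (hφ : φ.ker = Subgroup.center SL(3, F)) {X T : SL(3, F)}
    (hX : IsReducible X) (hX1 : φ X ≠ 1) (hT : IsInvol T) : EngelPath 2 (φ X) (φ T) := by
  obtain ⟨v, hv, l, hl⟩ := hX
  obtain ⟨f, h, -, hi⟩ := exists_isInvol_of_ne_zero hv 0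
  refine EngelPath.trans (EngelPath.of_commute_conj hX1 (hi.map_ne_one hφ) ?_)
    (engelPath_of_isInvol hφ hi hT)
  have := (commute_tv_conj hl h).map φ
  simpa using this

variable [Finite F]

lemma engelPath_to_isReducible (hφ : φ.ker = Subgroup.center SL(3, F)) {X T : SL(3, F)}
    (hX : IsReducible X) (hX1 : φ X ≠ 1) (hT : IsInvol T) : EngelPath 2 (φ T) (φ X) := by
  obtain ⟨U, hU, hc⟩ := hX.exists_isInvol
  refine EngelPath.trans (engelPath_of_isInvol hφ hT hU)
    (EngelPath.of_commute_conj (hU.map_ne_one hφ) hX1 ?_)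
  have := hc.map φ
  simpa using this

/-- Every nontrivial element of `PSL(3, F)` can be reached from every involution. -/
lemma engelPath_from_isInvol (hφ : φ.ker = Subgroup.center SL(3, F)) {X T : SL(3, F)}
    (hX1 : φ X ≠ 1) (hT : IsInvol T) : EngelPath 2 (φ T) (φ X) := by
  by_cases hX : IsReducible X
  · exact engelPath_to_isReducible hφ hX hX1 hT
  · obtain ⟨Y, hY, hYc, hc⟩ := exists_reducible_to_irreducible hX
    have hY1 := (map_ne_one_iff hφ).2 hYc
    refine (engelPath_to_isReducible hφ hY hY1 hT).trans
      (EngelPath.of_commute_conj hY1 hX1 ?_)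
    have := hc.map φ
    simpa using this

/-- If `4 < |F|`, every involution of `PSL(3, F)` can be reached from every nontrivial element. -/
lemma engelPath_to_isInvol (hφ : φ.ker = Subgroup.center SL(3, F)) (hF : 4 < Nat.card F)
    {X T : SL(3, F)} (hX1 : φ X ≠ 1) (hT : IsInvol T) : EngelPath 2 (φ X) (φ T) := by
  by_cases hX : IsReducible X
  · exact engelPath_of_isReducible hφ hX hX1 hT
  · obtain ⟨Y, hY, hYc, hc⟩ := exists_reducible_of_irreducible hF hX
    have hY1 := (map_ne_one_iff hφ).2 hYc
    refine EngelPath.trans (EngelPath.of_commute_conj hX1 hY1 ?_)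
      (engelPath_of_isReducible hφ hY hY1 hT)
    have := hc.map φ
    simpa using this

end Paths

/-! ### The third Engel graph of PSL(3, F). -/

section ThirdEngelGraph

/-- The involution t inverts m = [x, t], and [w, t] = w⁻² for every w inverted by t. Two such steps
turn m into m⁴. -/
lemma engelWord_three_of_mul_self {G : Type*} [Group G] {x t : G} (ht : t * t = 1) :
    engelWord 3 x t = (x⁻¹ * t * x * t) ^ 4 := by
  have hinv : t⁻¹ = t := inv_eq_of_mul_eq_one_left ht
  set m := x⁻¹ * t * x * t with hm
  have h0 : engelWord 1 x t = m := by
    change x⁻¹ * t⁻¹ * x * t = m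
    rw [hinv]
  have hinvert : ∀ w : G, t * w * t = w⁻¹ → comm w t = (w⁻¹) ^ 2 := by
    intro w hw
    have : comm w t = w⁻¹ * (t * w * t) := by
      simp only [comm, hinv, mul_assoc]
    rw [this, hw, pow_two]
  have hmt : t * m * t = m⁻¹ := by
    rw [hm]
    simp only [_root_.mul_inv_rev, inv_inv, hinv, mul_assoc, ht, mul_one]
  have hmt2 : t * (m⁻¹ ^ 2) * t = (m⁻¹ ^ 2)⁻¹ := by
    have h1 : t * m⁻¹ * t = m := by
      rw [← hmt]
      simp only [mul_assoc, ht, mul_one]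
      rw [← mul_assoc, ht, one_mul]
    have h2 : t * (m⁻¹ ^ 2) * t = (t * m⁻¹ * t) * (t * m⁻¹ * t) := by
      have h3 : (t * m⁻¹ * t) * (t * m⁻¹ * t) = t * m⁻¹ * (t * t) * m⁻¹ * t := by group
      rw [h3, ht, pow_two]
      group
    rw [h2, h1, inv_pow, inv_inv, pow_two]
  rw [engelWord_succ, engelWord_succ, h0, hinvert m hmt, hinvert _ hmt2]
  group

variable {F : Type*} [Field F] [CharP F 2]

lemma one_add_pow_four (N : Matrix (Fin 3) (Fin 3) F) : (1 + N) ^ 4 = 1 + N ^ 4 := by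
  have h : ∀ M : Matrix (Fin 3) (Fin 3) F, (1 + M) ^ 2 = 1 + M ^ 2 := by
    intro M
    have : (1 + M) ^ 2 = 1 + M ^ 2 + (M + M) := by noncomm_ring
    rw [this, CharTwo.add_self_eq_zero, add_zero]
  rw [show 4 = 2 * 2 from rfl, pow_mul, h, h, pow_mul]

variable {G : Type*} [Group G] {φ : SL(3, F) →* G}

/-- Every element has an arc to some involution in the third Engel graph. -/
lemma exists_isInvol_engelWord_three (X : SL(3, F)) :
    ∃ T : SL(3, F), IsInvol T ∧ engelWord 3 X T = 1 := by
  have hv : (Pi.single 0 1 : Fin 3 → F) ≠ 0 := by simp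
  -- For the first basis vector a, the axis contains both a and Xa. With T^X T = 1 + N, this gives
  -- N² = (f·b) a⊗g with g·a = f·Xa = 0, so N⁴ = 0 and (T^X T)⁴ = 1.
  obtain ⟨f, h, hf, hT⟩ := exists_isInvol_of_ne_zero hv (X.1 *ᵥ Pi.single 0 1)
  refine ⟨_, hT, ?_⟩
  rw [engelWord_three_of_mul_self hT.2]
  obtain ⟨h', hc⟩ := mulVec_tv_conj (X := X) h
  rw [hc]
  apply coe_injective
  rw [Matrix.SpecialLinearGroup.coe_pow, tv_mul_tv, one_add_pow_four]
  rw [← dotProduct_mulVec, hf, zero_smul, add_zero]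
  set a : Fin 3 → F := Pi.single 0 1
  set b := (X⁻¹ : SL(3, F)).1 *ᵥ a
  set g := f ᵥ* X.1 with hg
  have hga : g ⬝ᵥ a = 0 := by rw [hg, ← dotProduct_mulVec, hf]
  have hsq : (vecMulVec b g + vecMulVec a f) ^ 2 = (f ⬝ᵥ b) • vecMulVec a g := by
    rw [pow_two, mul_add, add_mul, add_mul]
    simp only [vecMulVec_mul_vecMulVec', h, h', hga, zero_smul, add_zero, zero_add]
  rw [show 4 = 2 * 2 from rfl, pow_mul, hsq, pow_two, smul_mul_smul_comm,
    vecMulVec_mul_vecMulVec', hga, zero_smul, smul_zero, add_zero]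
  rfl

omit [CharP F 2] in
-- Some coordinate i of v × w is nonzero, and f = e_i × v satisfies f·w = (v × w)_i.
lemma exists_separating {v w : Fin 3 → F} (hv : v ≠ 0) (hw : ∀ l : F, w ≠ l • v) :
    ∃ f : Fin 3 → F, f ⬝ᵥ v = 0 ∧ f ⬝ᵥ w ≠ 0 := by
  have h : v ⨯₃ w ≠ 0 := by
    rw [crossProduct_ne_zero_iff_linearIndependent]
    exact (LinearIndependent.pair_iff' hv).2 fun l h => hw l h.symm
  obtain ⟨i, hi⟩ := Function.ne_iff.1 h
  refine ⟨Pi.single i 1 ⨯₃ v, ?_, ?_⟩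
  · rw [dotProduct_comm, dot_cross_self]
  · rw [dotProduct_comm, triple_product_permutation, single_one_dotProduct]
    exact hi

omit [CharP F 2] in
lemma exists_not_eigenvector {X : SL(3, F)} (hX : X ∉ Subgroup.center SL(3, F)) :
    ∃ v : Fin 3 → F, v ≠ 0 ∧ ∀ l : F, X.1 *ᵥ v ≠ l • v := by
  by_contra! h
  apply hX
  rw [mem_center_iff_scalar]
  have h1 : ∀ i : Fin 3, ∃ l, X.1 *ᵥ Pi.single i 1 = l • (Pi.single i 1 : Fin 3 → F) :=
    fun i => h _ (by simp)
  choose l hl using h1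
  have h2 : ∀ i j, i ≠ j → l i = l j := by
    intro i j hij
    obtain ⟨m, hm⟩ := h (Pi.single i 1 + Pi.single j 1) (by
      intro h0
      have := congrFun h0 i
      simp [hij] at this)
    rw [mulVec_add, hl, hl] at hm
    have hi := congrFun hm i
    have hj := congrFun hm j
    simp [hij, hij.symm] at hi hj
    rw [hi, hj]
  refine ⟨l 0, ?_⟩
  ext i j
  have h3 := congrFun (hl j) i
  rw [mulVec_single_one] at h3
  have h4 : l j = l 0 := by
    by_cases hj : j = 0
    · rw [hj]
    · exact h2 _ _ hj
  rw [h4] at h3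
  simpa [Pi.single_apply, Matrix.one_apply] using h3

/-- Pick a transvection T with center v and axis f such that f·Xv and f·X⁻¹v are nonzero, and write
T^X T = 1 + N. If (1 + N)⁴ = 1 + N⁴ were scalar, it would be 1, because N kills a nonzero vector;
then N would be nilpotent, although its trace is (f·Xv)(f·X⁻¹v) ≠ 0. -/
lemma notMem_biEngelSet_three (hφ : φ.ker = Subgroup.center SL(3, F)) {X : SL(3, F)}
    (hX : φ X ≠ 1) : φ X ∉ biEngelSet 3 G := by
  intro hI
  obtain ⟨v, hv, hXv⟩ := exists_not_eigenvector ((map_ne_one_iff hφ).1 hX)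
  have hX' : X.1 * (X⁻¹ : SL(3, F)).1 = 1 := by
    have := coe_congr (mul_inv_cancel X)
    rwa [Matrix.SpecialLinearGroup.coe_mul, Matrix.SpecialLinearGroup.coe_one] at this
  have hXv' : ∀ l : F, (X⁻¹ : SL(3, F)).1 *ᵥ v ≠ l • v := by
    intro l hl
    have h1 := congrArg (fun w => X.1 *ᵥ w) hl
    simp only [mulVec_mulVec, hX', one_mulVec, mulVec_smul] at h1
    have hl0 : l ≠ 0 := by
      rintro rfl
      rw [zero_smul] at h1
      exact hv h1
    apply hXv l⁻¹
    rw [eq_inv_smul_iff₀ hl0]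
    exact h1.symm
  obtain ⟨f, hfv, h1, h2⟩ : ∃ f : Fin 3 → F, f ⬝ᵥ v = 0 ∧ f ⬝ᵥ (X.1 *ᵥ v) ≠ 0 ∧
      f ⬝ᵥ ((X⁻¹ : SL(3, F)).1 *ᵥ v) ≠ 0 := by
    obtain ⟨f, hf, hf1⟩ := exists_separating hv hXv
    obtain ⟨g, hg, hg1⟩ := exists_separating hv hXv'
    -- The functionals vanishing at v are not the union of two proper subspaces: if neither f nor g
    -- works, f + g does.
    by_cases h1 : f ⬝ᵥ ((X⁻¹ : SL(3, F)).1 *ᵥ v) = 0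
    · by_cases h2 : g ⬝ᵥ (X.1 *ᵥ v) = 0
      · refine ⟨f + g, ?_, ?_, ?_⟩
        · rw [add_dotProduct, hf, hg, add_zero]
        · rwa [add_dotProduct, h2, add_zero]
        · rwa [add_dotProduct, h1, zero_add]
      · exact ⟨g, hg, h2, hg1⟩
    · exact ⟨f, hf, hf1, h1⟩
  have hf0 : f ≠ 0 := by
    rintro rfl
    rw [zero_dotProduct] at h1
    exact h1 rfl
  have hT := isInvol_tv hfv hv hf0
  have h3 := (hI (φ (tv v f hfv))).1
  rw [← map_engelWord, engelWord_three_of_mul_self hT.2] at h3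
  obtain ⟨h', hc⟩ := mulVec_tv_conj (X := X) hfv
  rw [hc] at h3
  obtain ⟨r, hr⟩ := (map_eq_one_iff_scalar hφ).1 h3
  rw [Matrix.SpecialLinearGroup.coe_pow, tv_mul_tv, one_add_pow_four, ← dotProduct_mulVec] at hr
  set b := (X⁻¹ : SL(3, F)).1 *ᵥ v
  set g := f ᵥ* X.1 with hg
  set N := vecMulVec b g + vecMulVec v f + (f ⬝ᵥ X.1 *ᵥ v) • vecMulVec b f with hN
  obtain ⟨u, hu, huf, hug⟩ := exists_dotProduct_eq_zero f g
  have hNu : N *ᵥ u = 0 := by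
    rw [hN, add_mulVec, add_mulVec, smul_mulVec]
    simp only [vecMulVec_mulVec, dotProduct_comm f u, dotProduct_comm g u, huf, hug]
    simp
  have hN4u : N ^ 4 *ᵥ u = 0 := by
    rw [pow_succ, ← mulVec_mulVec, hNu, mulVec_zero]
  have hr1 : r = 1 := by
    have h4 := congrArg (fun M => M *ᵥ u) hr
    simp only [add_mulVec, one_mulVec, hN4u, add_zero, smul_mulVec] at h4
    obtain ⟨i, hi⟩ := Function.ne_iff.1 hu
    have h5 := congrFun h4 i
    rw [Pi.smul_apply, smul_eq_mul] at h5
    exact (mul_eq_right₀ hi).1 h5.symm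
  rw [hr1, one_smul] at hr
  have hnil : IsNilpotent N := ⟨4, add_eq_left.1 hr⟩
  have htr := (Matrix.isNilpotent_trace_of_isNilpotent hnil).eq_zero
  rw [hN, trace_add, trace_add, trace_smul, trace_vecMulVec, trace_vecMulVec, trace_vecMulVec,
    dotProduct_comm b g, h', dotProduct_comm v f, hfv, zero_add, zero_add, smul_eq_mul,
    dotProduct_comm b f] at htr
  exact (mul_ne_zero h1 h2) htr

variable [Finite F]

lemma engelPath_three (hφ : φ.ker = Subgroup.center SL(3, F)) {X Y : SL(3, F)}
    (hX : φ X ≠ 1) (hY : φ Y ≠ 1) : EngelPath 3 (φ X) (φ Y) := by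
  obtain ⟨T, hT, h⟩ := exists_isInvol_engelWord_three X
  refine EngelPath.trans (EngelPath.single hX (hT.map_ne_one hφ) ?_)
    (engelPath_from_isInvol hφ hY hT).succ
  rw [← map_engelWord, h, map_one]

/-- The third Engel graph of `PSL(3, F)` is strongly connected. -/
lemma isStronglyConnected_three : IsStronglyConnected (engelGraph 3 PSL(3, F)) := by
  have hφ : (QuotientGroup.mk' (Subgroup.center SL(3, F))).ker = Subgroup.center SL(3, F) :=
    QuotientGroup.ker_mk' _
  refine isStronglyConnected_of_engelPath (by norm_num) ?_ ?_
  · intro x hx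
    obtain ⟨X, rfl⟩ := QuotientGroup.mk'_surjective _ x
    exact notMem_biEngelSet_three hφ hx
  · intro x y hx hy
    obtain ⟨X, rfl⟩ := QuotientGroup.mk'_surjective _ x
    obtain ⟨Y, rfl⟩ := QuotientGroup.mk'_surjective _ y
    exact engelPath_three hφ hx hy

end ThirdEngelGraph

end EngelGraphs

namespace EngelGraphs

open Matrix

/-! ### Root elements of SL(3, F): relations and generation. -/

section RootElements

variable {F : Type*} [Field F] {G : Type*} [Group G]

/-- The root element `1 + c E_{ij}`. -/
abbrev root {i j : Fin 3} (hij : i ≠ j) (c : F) : SL(3, F) :=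
  Matrix.SpecialLinearGroup.transvection hij c

lemma coe_root {i j : Fin 3} (hij : i ≠ j) (c : F) :
    (root hij c).1 = 1 + c • vecMulVec (Pi.single i 1) (Pi.single j 1) := by
  rw [← single_eq_single_vecMulVec_single, smul_single, smul_eq_mul, mul_one]
  rfl

lemma root_eq_tv {i j : Fin 3} (hij : i ≠ j) (c : F) : ∃ h,
    root hij c = tv (c • Pi.single i 1) (Pi.single j 1) h := by
  refine ⟨by simp [hij], ?_⟩
  apply coe_injective
  rw [coe_tv, smul_vecMulVec]
  exact coe_root hij c

lemma isInvol_root [CharP F 2] {i j : Fin 3} (hij : i ≠ j) {c : F} (hc : c ≠ 0) :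
    IsInvol (root hij c) := by
  obtain ⟨h, he⟩ := root_eq_tv hij c
  rw [he]
  exact isInvol_tv h (by simp [hc]) (by simp)

lemma commute_root_iff {i j k l : Fin 3} (hij : i ≠ j) (hkl : k ≠ l) {c d : F} (hc : c ≠ 0)
    (hd : d ≠ 0) : Commute (root hij c) (root hkl d) ↔ j ≠ k ∧ l ≠ i := by
  obtain ⟨h, he⟩ := root_eq_tv hij c
  obtain ⟨h', he'⟩ := root_eq_tv hkl d
  rw [he, he', commute_tv_iff h h' (by simp [hc]) (by simp) (by simp [hd]) (by simp)]
  simp only [dotProduct_smul, single_one_dotProduct, Pi.single_apply, smul_eq_mul, mul_ite, mul_one,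
    mul_zero, ite_eq_right_iff, hc, hd, imp_false, ne_eq]

/-- The Chevalley commutator relation [x_ij(a), x_jk(b)] = x_ik(ab), written without inverses. -/
lemma root_mul_root {i j k : Fin 3} (hij : i ≠ j) (hjk : j ≠ k) (hik : i ≠ k) (a b : F) :
    root hij a * root hjk b = root hik (a * b) * root hjk b * root hij a := by
  apply coe_injective
  simp only [Matrix.SpecialLinearGroup.coe_mul, Matrix.SpecialLinearGroup.transvection_coe]
  simp only [add_mul, mul_add, one_mul, mul_one, single_mul_single_same,
    single_mul_single_of_ne _ _ _ _ hik.symm, single_mul_single_of_ne _ _ _ _ hjk.symm, add_zero]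
  abel

lemma root_injective_map {φ : SL(3, F) →* G} (hφ : φ.ker = Subgroup.center SL(3, F))
    {i j : Fin 3} (hij : i ≠ j) {a b : F} (h : φ (root hij a) = φ (root hij b)) : a = b := by
  rw [← mul_inv_eq_one, ← map_inv, ← map_mul, Matrix.SpecialLinearGroup.transvection_inv,
    ← Matrix.SpecialLinearGroup.transvection_add, ← MonoidHom.mem_ker, hφ,
    Matrix.SpecialLinearGroup.transvection_mem_center_iff, ← sub_eq_add_neg, sub_eq_zero] at h
  exact h

lemma root_zero {i j : Fin 3} (hij : i ≠ j) : root hij (0 : F) = 1 :=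
  Matrix.SpecialLinearGroup.transvection_coeff_zero hij

lemma root_add {i j : Fin 3} (hij : i ≠ j) (a b : F) :
    root hij (a + b) = root hij a * root hij b :=
  Matrix.SpecialLinearGroup.transvection_add hij a b

lemma coe_weyl {i j : Fin 3} (hij : i ≠ j) {a : F} (ha : a ≠ 0) :
    (root hij a * root hij.symm (-a⁻¹) * root hij a).1 =
      1 + single i j a + single j i (-a⁻¹) - single i i 1 - single j j 1 := by
  have h : ∀ A B : Matrix (Fin 3) (Fin 3) F, (1 + A) * (1 + B) * (1 + A) =
      1 + A + A + B + A * B + B * A + A * A + A * B * A := by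
    intro A B
    noncomm_ring
  rw [Matrix.SpecialLinearGroup.coe_mul, Matrix.SpecialLinearGroup.coe_mul,
    Matrix.SpecialLinearGroup.transvection_coe, Matrix.SpecialLinearGroup.transvection_coe, h,
    single_mul_single_same, single_mul_single_same, single_mul_single_of_ne _ _ _ _ hij.symm,
    single_mul_single_same]
  simp only [mul_neg, neg_mul, mul_inv_cancel₀ ha, inv_mul_cancel₀ ha, one_mul, ← single_neg]
  abel

/-- A torus element is the product of the Weyl elements with parameters a and -1; hence the root
elements generate. -/
lemma diag2n_eq_root_mul {i j : Fin 3} (hij : i ≠ j) (a : F) (ha : a ≠ 0) :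
    Matrix.SpecialLinearGroup.diag2n hij a ha =
      (root hij a * root hij.symm (-a⁻¹) * root hij a) *
      (root hij (-1) * root hij.symm (-(-1)⁻¹) * root hij (-1)) := by
  apply coe_injective
  rw [Matrix.SpecialLinearGroup.coe_mul, coe_weyl hij ha, coe_weyl hij (neg_ne_zero.2 one_ne_zero),
    Matrix.SpecialLinearGroup.diag2n_coe]
  -- Each Weyl element is an antidiagonal block on {i, j} plus the idempotent 1 - E_ii - E_jj. The
  -- cross terms vanish, and only the product of the blocks matters.
  have h1 : (single i j a + single j i (-a⁻¹) : Matrix (Fin 3) (Fin 3) F) *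
      (single i j (-1) + single j i (-(-1)⁻¹)) = single i i a + single j j a⁻¹ := by
    rw [add_mul, mul_add, mul_add, single_mul_single_same, single_mul_single_same,
      single_mul_single_of_ne _ _ _ _ hij.symm, single_mul_single_of_ne _ _ _ _ hij]
    simp [inv_neg]
  have h2 : ∀ c d : F, (1 - single i i 1 - single j j 1 : Matrix (Fin 3) (Fin 3) F) *
      (single i j c + single j i d) = 0 := by
    intro c d
    rw [sub_mul, sub_mul, one_mul, mul_add, mul_add, single_mul_single_same,
      single_mul_single_same, single_mul_single_of_ne _ _ _ _ hij,
      single_mul_single_of_ne _ _ _ _ hij.symm]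
    simp
  have h3 : ∀ c d : F, (single i j c + single j i d : Matrix (Fin 3) (Fin 3) F) *
      (1 - single i i 1 - single j j 1) = 0 := by
    intro c d
    rw [mul_sub, mul_sub, mul_one, add_mul, add_mul, single_mul_single_same,
      single_mul_single_same, single_mul_single_of_ne _ _ _ _ hij,
      single_mul_single_of_ne _ _ _ _ hij.symm]
    simp
  have h4 : (1 - single i i 1 - single j j 1 : Matrix (Fin 3) (Fin 3) F) *
      (1 - single i i 1 - single j j 1) = 1 - single i i 1 - single j j 1 := by
    rw [mul_sub, mul_sub, mul_one, sub_mul, sub_mul, sub_mul, sub_mul, single_mul_single_same,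
      single_mul_single_same, single_mul_single_of_ne _ _ _ _ hij,
      single_mul_single_of_ne _ _ _ _ hij.symm]
    simp
  have h5 : ∀ A B A' : Matrix (Fin 3) (Fin 3) F, 1 + A + B - A' - single j j 1 =
      (1 - A' - single j j 1) + (A + B) := by
    intro A B A'
    abel
  have h6 : ∀ A B A' B' : Matrix (Fin 3) (Fin 3) F,
      (A + B) * (A' + B') = A * A' + A * B' + (B * A' + B * B') := by
    intro A B A' B'
    rw [add_mul, mul_add, mul_add]
  rw [h5, h5, h6, h1, h2, h3, h4, add_zero, zero_add]
  ext k l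
  simp only [diagonal_apply, Matrix.add_apply, Matrix.sub_apply, Matrix.one_apply, single_apply]
  by_cases hkl : k = l
  · subst hkl
    by_cases hk : k = i
    · subst hk
      simp [hij.symm]
    · by_cases hk' : k = j
      · subst hk'
        simp [hij, hk]
      · simp [hk, hk', Ne.symm hk, Ne.symm hk']
  · have h7 : ∀ m : Fin 3, ¬ (m = k ∧ m = l) := fun m h => hkl (h.1.symm.trans h.2)
    simp [hkl, h7]

/-- Homomorphisms from `SL(3, F)` are determined by their values on the root elements. -/
lemma hom_ext_root {ρ σ : SL(3, F) →* G}
    (h : ∀ (i j : Fin 3) (hij : i ≠ j) (c : F), ρ (root hij c) = σ (root hij c)) (A : SL(3, F)) :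
    ρ A = σ A := by
  refine Matrix.SpecialLinearGroup.diagonal_transvection_induction' (fun A => ρ A = σ A) A ?_ h ?_
  · intro i j hij c hc
    rw [diag2n_eq_root_mul]
    simp only [map_mul, h]
  · intro A B hA hB
    rw [map_mul, map_mul, hA, hB]

/-- The diagonal element of `GL(3, F)` with given nonzero entries. -/
def diagGL (d : Fin 3 → F) (hd : ∀ i, d i ≠ 0) : GL (Fin 3) F :=
  ⟨diagonal d, diagonal fun i => (d i)⁻¹, by
    rw [diagonal_mul_diagonal, ← diagonal_one]; congr; funext i; exact mul_inv_cancel₀ (hd i), by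
    rw [diagonal_mul_diagonal, ← diagonal_one]; congr; funext i; exact inv_mul_cancel₀ (hd i)⟩

lemma conjGL_diagGL_root (d : Fin 3 → F) (hd : ∀ i, d i ≠ 0) {i j : Fin 3} (hij : i ≠ j) (c : F) :
    conjGL (diagGL d hd) (root hij c) = root hij (d i * c * (d j)⁻¹) := by
  symm
  rw [eq_conjGL_iff]
  change (root hij (d i * c * (d j)⁻¹)).1 * diagonal d = diagonal d * (root hij c).1
  rw [coe_root, coe_root, add_mul, mul_add, one_mul, mul_one, smul_mul_assoc, mul_smul_comm,
    vecMulVec_mul, mul_vecMulVec]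
  congr 1
  rw [← smul_vecMulVec, ← smul_vecMulVec]
  ext k l
  simp only [vecMulVec_apply, Pi.smul_apply, smul_eq_mul, vecMul_diagonal, mulVec_diagonal]
  by_cases hk : k = i
  · by_cases hl : l = j
    · subst hk hl
      have := hd l
      simp only [Pi.single_eq_same]
      field_simp
    · simp [Pi.single_eq_of_ne hl]
  · simp [Pi.single_eq_of_ne hk]

end RootElements

/-! ### Homomorphisms matching root subgroups: diagonal and field automorphisms. -/

section Steinberg

variable {F : Type*} [Field F] [CharP F 2] {G : Type*} [Group G]

/-- For U = 1 + a⊗f, the three commutations kill every coordinate of a except the i-th and every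
coordinate of f except the j-th. -/
lemma IsInvol.eq_root {U : SL(3, F)} (hU : IsInvol U) {i j k : Fin 3} (hij : i ≠ j) (hik : i ≠ k)
    (hkj : k ≠ j) {m n p : F} (hm : m ≠ 0) (hn : n ≠ 0) (hp : p ≠ 0)
    (h1 : Commute U (root hij m)) (h2 : Commute U (root hik n)) (h3 : Commute U (root hkj p)) :
    ∃ c, U = root hij c := by
  obtain ⟨a, f, h, ha, hf, rfl⟩ := hU.exists_eq_tv
  obtain ⟨h', he⟩ := root_eq_tv hij m
  rw [he, commute_tv_iff h h' ha hf (by simp [hm]) (by simp)] at h1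
  obtain ⟨h', he⟩ := root_eq_tv hik n
  rw [he, commute_tv_iff h h' ha hf (by simp [hn]) (by simp)] at h2
  obtain ⟨h', he⟩ := root_eq_tv hkj p
  rw [he, commute_tv_iff h h' ha hf (by simp [hp]) (by simp)] at h3
  simp [hm] at h1
  simp [hn] at h2
  simp [hp] at h3
  have hcases : ∀ l : Fin 3, l = i ∨ l = j ∨ l = k := by omega
  have ha' : a = a i • Pi.single i 1 := by
    funext l
    rcases hcases l with rfl | rfl | rfl
    · simp
    · simp [h1.2, hij.symm]
    · simp [h2.2, hik.symm]
  have hf' : f = f j • Pi.single j 1 := by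
    funext l
    rcases hcases l with rfl | rfl | rfl
    · simp [h1.1, hij]
    · simp
    · simp [h3.1, hkj]
  refine ⟨a i * f j, ?_⟩
  apply coe_injective
  rw [coe_tv, ha', hf', smul_vecMulVec, vecMulVec_smul, smul_smul]
  simp only [Pi.smul_apply, Pi.single_eq_same, smul_eq_mul, mul_one]
  exact (coe_root hij _).symm

variable {φ ρ : SL(3, F) →* G}

/-- x_ij(a) commutes with x_ij(1), x_ik(1) and x_kj(1). These relations pass to the image, where
`IsInvol.eq_root` forces a root element. -/
lemma exists_map_root (hφ : φ.ker = Subgroup.center SL(3, F))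
    (hρ : ρ.ker = Subgroup.center SL(3, F)) (hr : ρ.range ≤ φ.range)
    (h : ∀ (i j : Fin 3) (hij : i ≠ j), ∃ m : F, m ≠ 0 ∧ ρ (root hij 1) = φ (root hij m))
    (i j : Fin 3) (hij : i ≠ j) (a : F) : ∃ c, ρ (root hij a) = φ (root hij c) := by
  by_cases ha : a = 0
  · exact ⟨0, by rw [ha, root_zero, map_one, map_one]⟩
  · obtain ⟨U, hU, hUa⟩ := IsInvol.exists_lift hφ ((isInvol_root hij ha).map_isInvol hρ)
      (hr (MonoidHom.mem_range.2 ⟨root hij a, rfl⟩))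
    obtain ⟨k, hik, hkj⟩ : ∃ k : Fin 3, i ≠ k ∧ k ≠ j :=
      (by decide : ∀ i j : Fin 3, i ≠ j → ∃ k : Fin 3, i ≠ k ∧ k ≠ j) i j hij
    have key : ∀ (k l : Fin 3) (hkl : k ≠ l) (m : F) (_ : m ≠ 0)
        (_ : ρ (root hkl 1) = φ (root hkl m)) (_ : j ≠ k ∧ l ≠ i), Commute U (root hkl m) := by
      intro k l hkl m hm he hne
      refine IsInvol.commute_of_map hφ (isInvol_root hkl hm) ?_
      rw [hUa, ← he]
      exact ((commute_root_iff hij hkl ha one_ne_zero).2 hne).map ρ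
    obtain ⟨m, hm, h1⟩ := h i j hij
    obtain ⟨n, hn, h2⟩ := h i k hik
    obtain ⟨p, hp, h3⟩ := h k j hkj
    obtain ⟨c, rfl⟩ := hU.eq_root hij hik hkj hm hn hp
      (key _ _ _ _ hm h1 ⟨hij.symm, hij.symm⟩) (key _ _ _ _ hn h2 ⟨hij.symm, hik.symm⟩)
      (key _ _ _ _ hp h3 ⟨hkj.symm, hij.symm⟩)
    exact ⟨c, hUa.symm⟩

/-- Two projective representations with the same image that match the root subgroups differ by a
diagonal automorphism and a field automorphism. -/
lemma exists_diagonal_field (hφ : φ.ker = Subgroup.center SL(3, F))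
    (hρ : ρ.ker = Subgroup.center SL(3, F)) (hr : ρ.range ≤ φ.range)
    (h : ∀ (i j : Fin 3) (hij : i ≠ j), ∃ m : F, m ≠ 0 ∧ ρ (root hij 1) = φ (root hij m)) :
    ∃ (P : GL (Fin 3) F) (f : F →+* F), ∀ A,
      ρ A = φ (conjGL P (Matrix.SpecialLinearGroup.map f A)) := by
  have hex := exists_map_root hφ hρ hr h
  -- s_ij describes the action of `ρ` on the parameters of the root subgroup X_ij. It is additive,
  -- and the commutator relation gives s_ij(a)s_jk(b) = s_ik(ab).
  choose s hs using hex
  have hadd : ∀ i j hij a b, s i j hij (a + b) = s i j hij a + s i j hij b := by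
    intro i j hij a b
    apply root_injective_map hφ hij
    rw [← hs, root_add, root_add, map_mul, map_mul, hs, hs]
  have hmul : ∀ (i j k : Fin 3) (hij : i ≠ j) (hjk : j ≠ k) (hik : i ≠ k) (a b : F),
      s i j hij a * s j k hjk b = s i k hik (a * b) := by
    intro i j k hij hjk hik a b
    apply root_injective_map hφ hik
    have h1 := congrArg ρ (root_mul_root hij hjk hik a b)
    have h2 := congrArg φ (root_mul_root hij hjk hik (s i j hij a) (s j k hjk b))
    simp only [map_mul, hs] at h1 h2
    rw [h1] at h2
    exact (mul_right_cancel (mul_right_cancel h2)).symm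
  have hne : ∀ i j hij, s i j hij 1 ≠ 0 := by
    intro i j hij h0
    have := (isInvol_root (F := F) hij one_ne_zero).map_ne_one hρ
    rw [hs, h0, root_zero, map_one] at this
    exact this rfl
  have n01 : (0 : Fin 3) ≠ 1 := by decide
  have n02 : (0 : Fin 3) ≠ 2 := by decide
  have n12 : (1 : Fin 3) ≠ 2 := by decide
  set u := s 0 1 n01 1 with hu
  set w := s 1 2 n12 1 with hw
  have hu0 : u ≠ 0 := hne _ _ _
  have hw0 : w ≠ 0 := hne _ _ _
  have h02 : s 0 2 n02 1 = u * w := by rw [hu, hw, hmul 0 1 2 n01 n12 n02, one_mul]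
  -- Dividing s_02 by s_02(1) = uw makes it multiplicative, since s_01(a)s_12(b) = s_02(ab).
  let f : F →+* F :=
    { toFun := fun a => s 0 2 n02 a / (u * w)
      map_one' := by rw [h02]; exact div_self (mul_ne_zero hu0 hw0)
      map_zero' := by
        have := hadd 0 2 n02 0 0
        rw [add_zero, left_eq_add] at this
        rw [this, zero_div]
      map_add' := fun a b => by rw [hadd, add_div]
      map_mul' := fun a b => by
        have h1 := hmul 0 1 2 n01 n12 n02 a b
        have h2 := hmul 0 1 2 n01 n12 n02 a 1
        have h3 := hmul 0 1 2 n01 n12 n02 1 b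
        rw [mul_one, ← hw] at h2
        rw [one_mul, ← hu] at h3
        rw [← h1, ← h2, ← h3]
        field_simp }
  have hf : ∀ a, s 0 2 n02 a = u * w * f a := fun a =>
    (mul_div_cancel₀ _ (mul_ne_zero hu0 hw0)).symm
  have hf01 : ∀ a, s 0 1 n01 a = u * f a := by
    intro a
    have h2 := hmul 0 1 2 n01 n12 n02 a 1
    rw [mul_one, ← hw, hf] at h2
    exact mul_right_cancel₀ hw0 (by rw [h2]; ring)
  have hf12 : ∀ a, s 1 2 n12 a = w * f a := by
    intro a
    have h2 := hmul 0 1 2 n01 n12 n02 1 a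
    rw [one_mul, ← hu, hf] at h2
    exact mul_left_cancel₀ hu0 (by rw [h2]; ring)
  have hf10 : ∀ a, s 1 0 n01.symm a = u⁻¹ * f a := by
    intro a
    have h2 := hmul 1 0 2 n01.symm n02 n12 a 1
    rw [mul_one, h02, hf12] at h2
    refine mul_right_cancel₀ (mul_ne_zero hu0 hw0) (h2.trans ?_)
    field_simp
  have hf21 : ∀ a, s 2 1 n12.symm a = w⁻¹ * f a := by
    intro a
    have h2 := hmul 0 2 1 n02 n12.symm n01 1 a
    rw [one_mul, h02, hf01] at h2
    refine mul_left_cancel₀ (mul_ne_zero hu0 hw0) (h2.trans ?_)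
    field_simp
  have hf20 : ∀ a, s 2 0 n02.symm a = (u * w)⁻¹ * f a := by
    intro a
    have h2 := hmul 2 1 0 n12.symm n01.symm n02.symm 1 a
    rw [one_mul, hf21, hf10, map_one] at h2
    rw [← h2]
    field_simp
  -- Conjugation by diag(d_0, d_1, d_2) multiplies the parameter of x_ij by d_i/d_j. The entries uw,
  -- w, 1 give the required factors u on x_01 and w on x_12.
  have hd : ∀ i, (![u * w, w, 1] : Fin 3 → F) i ≠ 0 := by
    intro i
    fin_cases i
    · exact mul_ne_zero hu0 hw0
    · exact hw0
    · exact one_ne_zero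
  refine ⟨diagGL ![u * w, w, 1] hd, f, fun A => ?_⟩
  refine hom_ext_root (ρ := ρ)
    (σ := (φ.comp (conjGL (diagGL ![u * w, w, 1] hd))).comp
      (Matrix.SpecialLinearGroup.map f)) ?_ A
  intro i j hij c
  have hmap : Matrix.SpecialLinearGroup.map f (root hij c) = root hij (f c) := by
    apply coe_injective
    rw [Matrix.SpecialLinearGroup.map_apply_coe, Matrix.SpecialLinearGroup.transvection_coe,
      Matrix.SpecialLinearGroup.transvection_coe, map_add, map_one, RingHom.mapMatrix_apply,
      map_single]
  rw [MonoidHom.comp_apply, MonoidHom.comp_apply, hmap, conjGL_diagGL_root, hs]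
  congr 2
  fin_cases i <;> fin_cases j <;> first | exact absurd rfl hij | skip
  · change s 0 1 n01 c = u * w * f c * w⁻¹
    rw [hf01]; field_simp
  · change s 0 2 n02 c = u * w * f c * 1⁻¹
    rw [hf]; field_simp
  · change s 1 0 n01.symm c = w * f c * (u * w)⁻¹
    rw [hf10]; field_simp
  · change s 1 2 n12 c = w * f c * 1⁻¹
    rw [hf12]; field_simp
  · change s 2 0 n02.symm c = 1 * f c * (u * w)⁻¹
    rw [hf20]; field_simp
  · change s 2 1 n12.symm c = 1 * f c * w⁻¹
    rw [hf21]; field_simp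

end Steinberg

end EngelGraphs

namespace EngelGraphs

open Matrix

/-! ### Automorphisms are semilinear up to inverse transpose: the hexagon of root elements. -/

section Hexagon

variable {F : Type*} [Field F] {G : Type*} [Group G]

/-- The inverse transpose automorphism. -/
def dualSL : SL(3, F) →* SL(3, F) where
  toFun A := (A⁻¹).transpose
  map_one' := coe_injective (by
    change ((1 : SL(3, F))⁻¹).1ᵀ = 1
    rw [inv_one]
    exact transpose_one)
  map_mul' A B := coe_injective (by
    change ((A * B)⁻¹ : SL(3, F)).1ᵀ = (A⁻¹ : SL(3, F)).1ᵀ * (B⁻¹ : SL(3, F)).1ᵀ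
    rw [_root_.mul_inv_rev, Matrix.SpecialLinearGroup.coe_mul, transpose_mul])

lemma coe_dualSL (A : SL(3, F)) : (dualSL A).1 = (A⁻¹ : SL(3, F)).1ᵀ := rfl

lemma dualSL_dualSL (A : SL(3, F)) : dualSL (dualSL A) = A := by
  apply coe_injective
  rw [coe_dualSL, ← map_inv, coe_dualSL, inv_inv, transpose_transpose]

lemma dualSL_mem_center_iff (A : SL(3, F)) :
    dualSL A ∈ Subgroup.center SL(3, F) ↔ A ∈ Subgroup.center SL(3, F) := by
  have key : ∀ A : SL(3, F), A ∈ Subgroup.center SL(3, F) →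
      dualSL A ∈ Subgroup.center SL(3, F) := by
    intro A hA
    rw [Subgroup.mem_center_iff] at hA ⊢
    intro B
    rw [← dualSL_dualSL B, ← map_mul, hA, map_mul]
  exact ⟨fun h => dualSL_dualSL A ▸ key _ h, key A⟩

lemma ker_comp_dualSL {ρ : SL(3, F) →* G} (hρ : ρ.ker = Subgroup.center SL(3, F)) :
    (ρ.comp dualSL).ker = Subgroup.center SL(3, F) := by
  ext A
  rw [MonoidHom.mem_ker, MonoidHom.comp_apply, ← MonoidHom.mem_ker, hρ, dualSL_mem_center_iff]

lemma dualSL_root {i j : Fin 3} (hij : i ≠ j) (c : F) :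
    dualSL (root hij c) = root hij.symm (-c) := by
  apply coe_injective
  rw [coe_dualSL, Matrix.SpecialLinearGroup.transvection_inv,
    Matrix.SpecialLinearGroup.transvection_coe, Matrix.SpecialLinearGroup.transvection_coe,
    transpose_add, transpose_one, transpose_single]

lemma exists_eq_smul_cross {a b k : Fin 3 → F} (h : a ⨯₃ b ≠ 0) (hka : k ⬝ᵥ a = 0)
    (hkb : k ⬝ᵥ b = 0) : ∃ c : F, k = c • (a ⨯₃ b) := by
  by_contra! h'
  apply (crossProduct_ne_zero_iff_linearIndependent).2
    ((LinearIndependent.pair_iff' h).2 fun c hc => h' c hc.symm)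
  rw [← cross_anticomm, cross_cross_eq_smul_sub_smul', dotProduct_comm a k, hka, hkb, zero_smul,
    zero_smul, sub_zero, neg_zero]

/-- Centers or axes of commuting transvections coincide. -/
lemma exists_smul_eq_or {a b f g : Fin 3 → F} (ha : a ≠ 0) (hf : f ≠ 0) (hfa : f ⬝ᵥ a = 0)
    (hfb : f ⬝ᵥ b = 0) (hga : g ⬝ᵥ a = 0) (hgb : g ⬝ᵥ b = 0) :
    (∃ c : F, b = c • a) ∨ ∃ c : F, g = c • f := by
  by_contra! h
  have h1 : a ⨯₃ b ≠ 0 := by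
    rw [crossProduct_ne_zero_iff_linearIndependent]
    exact (LinearIndependent.pair_iff' ha).2 fun l h' => h.1 l h'.symm
  have h2 : f ⨯₃ g ≠ 0 := by
    rw [crossProduct_ne_zero_iff_linearIndependent]
    exact (LinearIndependent.pair_iff' hf).2 fun l h' => h.2 l h'.symm
  -- With a and b independent, both f and g are multiples of a × b.
  obtain ⟨c, hc⟩ := exists_eq_smul_cross h1 hfa hfb
  obtain ⟨d, hd⟩ := exists_eq_smul_cross h1 hga hgb
  apply h2
  rw [hc, hd]
  simp

/-- If the images of the root elements `x₀₁(1)` and `x₀₂(1)` share their centers then the images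
of all root elements are root elements with respect to some basis. -/
lemma exists_basis_of_centers (a f : Fin 3 → Fin 3 → Fin 3 → F)
    (h0 : ∀ i j, i ≠ j → a i j ≠ 0 ∧ f i j ≠ 0 ∧ f i j ⬝ᵥ a i j = 0)
    (hcomm : ∀ i j k l, i ≠ j → k ≠ l → j ≠ k → l ≠ i → f i j ⬝ᵥ a k l = 0)
    (hnc : ∀ i j k, i ≠ j → j ≠ k → ¬ (f i j ⬝ᵥ a j k = 0 ∧ f j k ⬝ᵥ a i j = 0))
    (hc : ∃ c : F, a 0 2 = c • a 0 1) :
    ∃ P : GL (Fin 3) F, ∀ i j (hij : i ≠ j) (h : f i j ⬝ᵥ a i j = 0),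
      ∃ m : F, m ≠ 0 ∧ tv (a i j) (f i j) h = conjGL P (root hij m) := by
  have n01 : (0 : Fin 3) ≠ 1 := by decide
  have n02 : (0 : Fin 3) ≠ 2 := by decide
  have n12 : (1 : Fin 3) ≠ 2 := by decide
  have sw : ∀ {x y : Fin 3 → F}, y ≠ 0 → (∃ c : F, y = c • x) → ∃ c : F, x = c • y := by
    rintro x y hy ⟨c, rfl⟩
    have hc : c ≠ 0 := by
      rintro rfl
      exact hy (zero_smul _ _)
    exact ⟨c⁻¹, by rw [inv_smul_smul₀ hc]⟩
  have tr : ∀ {x y z : Fin 3 → F}, (∃ c : F, y = c • x) → (∃ c : F, z = c • y) →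
      ∃ c : F, z = c • x := by
    rintro x y z ⟨c, rfl⟩ ⟨d, rfl⟩
    exact ⟨d * c, by rw [smul_smul]⟩
  -- consecutive centers determine the next axis, and conversely
  have stepC : ∀ i j k, i ≠ j → i ≠ k → j ≠ k → (∃ c : F, a i k = c • a i j) →
      ∃ c : F, f j k = c • f i k := by
    intro i j k hij hik hjk hac
    have e1 := h0 i k hik
    have e2 := h0 j k hjk
    -- The images of x_ik and x_jk commute, so they share center or axis. A common center would be
    -- that of x_ij too, and then x_ij and x_jk would commute.
    refine (exists_smul_eq_or e1.1 e1.2.1 e1.2.2 (hcomm i k j k hik hjk hjk.symm hik.symm)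
      (hcomm j k i k hjk hik hik.symm hjk.symm) e2.2.2).resolve_left fun hcon => ?_
    apply hnc i j k hij hjk
    obtain ⟨c, hc⟩ := tr hac hcon
    obtain ⟨d, hd⟩ := sw (h0 i k hik).1 hac
    refine ⟨by rw [hc, dotProduct_smul, (h0 i j hij).2.2, smul_zero], ?_⟩
    rw [hd, dotProduct_smul, hcomm j k i k hjk hik hik.symm hjk.symm, smul_zero]
  have stepA : ∀ i j k, i ≠ j → i ≠ k → j ≠ k → (∃ c : F, f j k = c • f i k) →
      ∃ c : F, a j i = c • a j k := by
    intro i j k hij hik hjk hfc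
    have e1 := h0 j k hjk
    have e2 := h0 j i hij.symm
    refine (exists_smul_eq_or e1.1 e1.2.1 e1.2.2 (hcomm j k j i hjk hij.symm hjk.symm hij)
      (hcomm j i j k hij.symm hjk hij hjk.symm) e2.2.2).resolve_right fun hcon => ?_
    apply hnc j i k hij.symm hik
    obtain ⟨c, hc⟩ := tr hfc hcon
    obtain ⟨d, hd⟩ := sw e1.2.1 hfc
    refine ⟨by rw [hc, smul_dotProduct, (h0 i k hik).2.2, smul_zero], ?_⟩
    rw [hd, smul_dotProduct, hcomm j k j i hjk hij.symm hjk.symm hij, smul_zero]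
  -- Around the hexagon 01, 02, 12, 10, 20, 21, neighbors alternately share center and axis.
  have A2 := stepC 0 1 2 n01 n02 n12 hc
  have C1 := stepA 0 1 2 n01 n02 n12 A2
  have A0 := stepC 1 2 0 n12 n01.symm n02.symm C1
  have C2 := stepA 1 2 0 n12 n01.symm n02.symm A0
  have A1 := stepC 2 0 1 n02.symm n12.symm n01 C2
  -- p_i is the common center of the roots starting at i, and l_j the common axis of those ending at
  -- j. They form dual bases up to scalars: l_j·p_j = 0 would make x_ij and x_jk commute.
  let p : Fin 3 → Fin 3 → F := ![a 0 1, a 1 2, a 2 0]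
  let l : Fin 3 → Fin 3 → F := ![f 1 0, f 2 1, f 0 2]
  have hap : ∀ i j, i ≠ j → ∃ c : F, a i j = c • p i := by
    intro i j hij
    fin_cases i <;> fin_cases j <;> first | exact absurd rfl hij | skip
    · exact ⟨1, (one_smul _ _).symm⟩
    · exact hc
    · exact C1
    · exact ⟨1, (one_smul _ _).symm⟩
    · exact ⟨1, (one_smul _ _).symm⟩
    · exact C2
  have hfl : ∀ i j, i ≠ j → ∃ c : F, f i j = c • l j := by
    intro i j hij
    fin_cases i <;> fin_cases j <;> first | exact absurd rfl hij | skip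
    · exact A1
    · exact ⟨1, (one_smul _ _).symm⟩
    · exact ⟨1, (one_smul _ _).symm⟩
    · exact A2
    · exact A0
    · exact ⟨1, (one_smul _ _).symm⟩
  have nz : ∀ {c : F} {x y : Fin 3 → F}, x ≠ 0 → x = c • y → c ≠ 0 := by
    rintro c x y hx hxy rfl
    exact hx (by rw [hxy, zero_smul])
  have hlp : ∀ i j, i ≠ j → l j ⬝ᵥ p i = 0 := by
    intro i j hij
    obtain ⟨c, hc⟩ := hap i j hij
    obtain ⟨d, hd⟩ := hfl i j hij
    obtain ⟨ha, hf, h⟩ := h0 i j hij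
    have hc0 := nz ha hc
    have hd0 := nz hf hd
    rw [hc, hd, smul_dotProduct, dotProduct_smul, smul_eq_mul, smul_eq_mul] at h
    exact (mul_eq_zero.1 ((mul_eq_zero.1 h).resolve_left hd0)).resolve_left hc0
  have hlpi : ∀ j, l j ⬝ᵥ p j ≠ 0 := by
    intro j hj
    obtain ⟨i, k, hij, hjk, hik⟩ : ∃ i k : Fin 3, i ≠ j ∧ j ≠ k ∧ i ≠ k :=
      (by decide : ∀ j : Fin 3, ∃ i k : Fin 3, i ≠ j ∧ j ≠ k ∧ i ≠ k) j
    obtain ⟨c, hc⟩ := hap j k hjk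
    obtain ⟨d, hd⟩ := hfl i j hij
    obtain ⟨c', hc'⟩ := hap i j hij
    obtain ⟨d', hd'⟩ := hfl j k hjk
    apply hnc i j k hij hjk
    constructor
    · rw [hc, hd, smul_dotProduct, dotProduct_smul, hj, smul_zero, smul_zero]
    · rw [hc', hd', smul_dotProduct, dotProduct_smul, hlp i k hik, smul_zero, smul_zero]
  have hdiag : (Matrix.of l) * (Matrix.of p)ᵀ = diagonal fun i => l i ⬝ᵥ p i := by
    ext i j
    rw [diagonal_apply]
    have : ((Matrix.of l) * (Matrix.of p)ᵀ) i j = l i ⬝ᵥ p j := rfl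
    rw [this]
    split_ifs with h
    · rw [h]
    · exact hlp j i (Ne.symm h)
  have hdet : IsUnit ((Matrix.of p)ᵀ) := by
    rw [isUnit_iff_isUnit_det, isUnit_iff_ne_zero]
    intro h
    have h2 := congrArg det hdiag
    rw [det_mul, h, mul_zero, det_diagonal] at h2
    exact (Finset.prod_ne_zero_iff.2 fun i _ => hlpi i) h2.symm
  obtain ⟨P, hP⟩ := hdet
  refine ⟨P, fun i j hij h => ?_⟩
  obtain ⟨c, hc⟩ := hap i j hij
  obtain ⟨d, hd⟩ := hfl i j hij
  have hc0 := nz (h0 i j hij).1 hc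
  have hd0 := nz (h0 i j hij).2.1 hd
  refine ⟨c * d * (l j ⬝ᵥ p j), mul_ne_zero (mul_ne_zero hc0 hd0) (hlpi j), ?_⟩
  rw [eq_conjGL_iff, coe_tv, coe_root, add_mul, one_mul, mul_add, mul_one, vecMulVec_mul,
    mul_smul_comm, mul_vecMulVec]
  congr 1
  have e1 : P.1 *ᵥ Pi.single i 1 = p i := by
    rw [mulVec_single_one, hP]
    rfl
  have e2 : f i j ᵥ* P.1 = (d * (l j ⬝ᵥ p j)) • Pi.single j 1 := by
    rw [hP, hd]
    funext k
    have h3 : ((d • l j) ᵥ* (Matrix.of p)ᵀ) k = (d • l j) ⬝ᵥ p k := rfl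
    rw [h3, smul_dotProduct, Pi.smul_apply, smul_eq_mul, smul_eq_mul]
    by_cases hk : k = j
    · rw [hk, Pi.single_eq_same, mul_one]
    · rw [hlp k j hk, Pi.single_eq_of_ne hk, mul_zero, mul_zero]
  rw [e1, e2, hc, smul_vecMulVec, vecMulVec_smul, smul_smul]
  congr 1
  ring

/-- The inverse transpose of an invertible matrix. -/
def dualGL (P : GL (Fin 3) F) : GL (Fin 3) F :=
  ⟨(P⁻¹ : GL (Fin 3) F).1ᵀ, P.1ᵀ,
    by rw [← transpose_mul, ← Units.val_mul, mul_inv_cancel, Units.val_one, transpose_one],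
    by rw [← transpose_mul, ← Units.val_mul, inv_mul_cancel, Units.val_one, transpose_one]⟩

lemma dualSL_conjGL (P : GL (Fin 3) F) (A : SL(3, F)) :
    dualSL (conjGL P A) = conjGL (dualGL P) (dualSL A) := by
  apply coe_injective
  rw [coe_dualSL, ← map_inv, coe_conjGL, coe_conjGL, transpose_mul, transpose_mul, ← mul_assoc]
  rfl

lemma conjGL_surjective (P : GL (Fin 3) F) : Function.Surjective (conjGL P) := fun A =>
  ⟨conjGL P⁻¹ A, by rw [← conjGL_mul, mul_inv_cancel, conjGL_one]⟩

lemma ker_comp_conjGL {φ : SL(3, F) →* G} (hφ : φ.ker = Subgroup.center SL(3, F))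
    (P : GL (Fin 3) F) : (φ.comp (conjGL P)).ker = Subgroup.center SL(3, F) := by
  ext A
  rw [MonoidHom.mem_ker, MonoidHom.comp_apply, ← MonoidHom.mem_ker, hφ,
    Subgroup.mem_center_iff, Subgroup.mem_center_iff]
  constructor
  · intro h B
    apply conjGL_injective P
    rw [map_mul, map_mul, h]
  · intro h B
    obtain ⟨B, rfl⟩ := conjGL_surjective P B
    rw [← map_mul, ← map_mul, h]

variable [CharP F 2] {φ ρ : SL(3, F) →* G}

lemma dualSL_tv {a f : Fin 3 → F} (h : f ⬝ᵥ a = 0) (h' : a ⬝ᵥ f = 0) (ha : a ≠ 0) (hf : f ≠ 0) :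
    dualSL (tv a f h) = tv f a h' := by
  apply coe_injective
  rw [coe_dualSL, (isInvol_tv h ha hf).inv_eq, coe_tv, coe_tv, transpose_add, transpose_one,
    transpose_vecMulVec]

/-- Two projective representations of `SL(3, F)` with the same image differ by a semilinear
automorphism, possibly composed with the inverse transpose. -/
theorem exists_semilinear (hφ : φ.ker = Subgroup.center SL(3, F))
    (hρ : ρ.ker = Subgroup.center SL(3, F)) (hr : ρ.range ≤ φ.range) :
    ∃ (P : GL (Fin 3) F) (f : F →+* F),
      (∀ A, ρ A = φ (conjGL P (Matrix.SpecialLinearGroup.map f A))) ∨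
      ∀ A, ρ (dualSL A) = φ (conjGL P (Matrix.SpecialLinearGroup.map f A)) := by
  have hex : ∀ i j : Fin 3, ∃ a f : Fin 3 → F, ∀ hij : i ≠ j, a ≠ 0 ∧ f ≠ 0 ∧
      ∃ h : f ⬝ᵥ a = 0, ρ (root hij 1) = φ (tv a f h) := by
    intro i j
    by_cases hij : i = j
    · exact ⟨0, 0, fun h => absurd hij h⟩
    · obtain ⟨U, hU, hUa⟩ := IsInvol.exists_lift hφ
        ((isInvol_root hij one_ne_zero).map_isInvol hρ)
        (hr (MonoidHom.mem_range.2 ⟨root hij 1, rfl⟩))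
      obtain ⟨a, f, h, ha, hf, rfl⟩ := hU.exists_eq_tv
      exact ⟨a, f, fun _ => ⟨ha, hf, h, hUa.symm⟩⟩
  choose a f haf using hex
  have h0 : ∀ i j, i ≠ j → a i j ≠ 0 ∧ f i j ≠ 0 ∧ f i j ⬝ᵥ a i j = 0 := fun i j hij =>
    ⟨(haf i j hij).1, (haf i j hij).2.1, (haf i j hij).2.2.1⟩
  -- Commuting of root elements carries over to the transvections lifting their images, since both
  -- kernels are central.
  have hcomm_iff : ∀ i j k l, i ≠ j → k ≠ l →
      ((f i j ⬝ᵥ a k l = 0 ∧ f k l ⬝ᵥ a i j = 0) ↔ (j ≠ k ∧ l ≠ i)) := by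
    intro i j k l hij hkl
    obtain ⟨ha, hf, h, he⟩ := haf i j hij
    obtain ⟨ha', hf', h', he'⟩ := haf k l hkl
    rw [← commute_tv_iff h h' ha hf ha' hf', ← commute_root_iff hij hkl (one_ne_zero (α := F))
      one_ne_zero]
    constructor
    · intro hc
      apply (isInvol_root hkl one_ne_zero).commute_of_map hρ
      rw [he, he']
      exact hc.map φ
    · intro hc
      apply (isInvol_tv h' ha' hf').commute_of_map hφ
      rw [← he, ← he']
      exact hc.map ρ
  have hcomm : ∀ i j k l, i ≠ j → k ≠ l → j ≠ k → l ≠ i → f i j ⬝ᵥ a k l = 0 :=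
    fun i j k l hij hkl hjk hli => ((hcomm_iff i j k l hij hkl).2 ⟨hjk, hli⟩).1
  have hnc : ∀ i j k, i ≠ j → j ≠ k → ¬ (f i j ⬝ᵥ a j k = 0 ∧ f j k ⬝ᵥ a i j = 0) :=
    fun i j k hij hjk h => ((hcomm_iff i j j k hij hjk).1 h).1 rfl
  have conclude : ∀ ρ' : SL(3, F) →* G, ρ'.ker = Subgroup.center SL(3, F) → ρ'.range ≤ φ.range →
      (∃ P : GL (Fin 3) F, ∀ i j (hij : i ≠ j), ∃ m : F, m ≠ 0 ∧
        ρ' (root hij 1) = φ (conjGL P (root hij m))) →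
      ∃ (P : GL (Fin 3) F) (g : F →+* F), ∀ A,
        ρ' A = φ (conjGL P (Matrix.SpecialLinearGroup.map g A)) := by
    rintro ρ' hρ' hr' ⟨P, hP⟩
    have hrange : ρ'.range ≤ (φ.comp (conjGL P)).range := by
      intro x hx
      obtain ⟨A, rfl⟩ := hr' hx
      obtain ⟨B, rfl⟩ := conjGL_surjective P A
      exact ⟨B, rfl⟩
    obtain ⟨Q, g, hQ⟩ := exists_diagonal_field (ker_comp_conjGL hφ P) hρ' hrange hP
    refine ⟨P * Q, g, fun A => ?_⟩
    rw [hQ, conjGL_mul]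
    rfl
  have n01 : (0 : Fin 3) ≠ 1 := by decide
  have n02 : (0 : Fin 3) ≠ 2 := by decide
  have n12 : (1 : Fin 3) ≠ 2 := by decide
  -- The images of x_01(1) and x_02(1) commute. A common center leads to the linear case; a common
  -- axis becomes a common center after exchanging centers with axes, that is, after inverse
  -- transpose.
  rcases exists_smul_eq_or (h0 0 1 n01).1 (h0 0 1 n01).2.1 (h0 0 1 n01).2.2
    (hcomm 0 1 0 2 n01 n02 n01.symm n02.symm) (hcomm 0 2 0 1 n02 n01 n02.symm n01.symm)
    (h0 0 2 n02).2.2 with hc | hc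
  · obtain ⟨P, hP⟩ := exists_basis_of_centers a f h0 hcomm hnc hc
    obtain ⟨Q, g, hQ⟩ := conclude ρ hρ hr ⟨P, fun i j hij => by
      obtain ⟨-, -, h, he⟩ := haf i j hij
      obtain ⟨m, hm, hm'⟩ := hP i j hij h
      exact ⟨m, hm, by rw [he, hm']⟩⟩
    exact ⟨Q, g, Or.inl hQ⟩
  · obtain ⟨P, hP⟩ := exists_basis_of_centers f a
      (fun i j hij => ⟨(h0 i j hij).2.1, (h0 i j hij).1, by
        rw [dotProduct_comm]; exact (h0 i j hij).2.2⟩)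
      (fun i j k l hij hkl hjk hli => by
        rw [dotProduct_comm]; exact hcomm k l i j hkl hij hli hjk)
      (fun i j k hij hjk h => hnc i j k hij hjk
        ⟨by rw [dotProduct_comm]; exact h.2, by rw [dotProduct_comm]; exact h.1⟩) hc
    have hr' : (ρ.comp dualSL).range ≤ φ.range := by
      rintro x ⟨A, rfl⟩
      exact hr ⟨dualSL A, rfl⟩
    obtain ⟨Q, g, hQ⟩ := conclude (ρ.comp dualSL) (ker_comp_dualSL hρ) hr'
      ⟨dualGL P, fun i j hij => by
        obtain ⟨ha, hf, h, he⟩ := haf j i hij.symm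
        have h' : a j i ⬝ᵥ f j i = 0 := by rw [dotProduct_comm]; exact h
        obtain ⟨m, hm, hm'⟩ := hP j i hij.symm h'
        refine ⟨-m, neg_ne_zero.2 hm, ?_⟩
        rw [MonoidHom.comp_apply, dualSL_root, CharTwo.neg_eq, he, ← dualSL_tv h' h hf ha, hm',
          dualSL_conjGL, dualSL_root]⟩
    exact ⟨Q, g, Or.inr hQ⟩

end Hexagon

end EngelGraphs

namespace EngelGraphs

open Matrix

/-! ### Automorphisms whose seventh power is trivial. -/

section OrderSeven

variable {G : Type*} [Group G] {x y : G}

lemma apply_eq_of_iterate {α : MulAut G} (hα : α ^ 7 = 1)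
    (h : α (α (α (α (α (α y))))) = y) : α y = y := by
  have h2 : α (α (α (α (α (α (α y)))))) = y := DFunLike.congr_fun hα y
  rwa [h] at h2

lemma conj_inv_pow_seven (hx : x ^ 7 = 1) : (MulAut.conj x⁻¹) ^ 7 = 1 := by
  rw [← map_pow, inv_pow, hx, inv_one, map_one]

lemma commute_of_conj_inv_apply (h : MulAut.conj x⁻¹ y = y) : Commute y x := by
  rw [MulAut.conj_apply, inv_inv] at h
  calc y * x = x * (x⁻¹ * y * x) := by group
    _ = x * y := by rw [h]

/-- Conjugation by x is α with α⁷ = 1, while k⁶ ≡ 1 mod 21 shows that α⁶ fixes y. The relevant k are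
1, 2 and 4. -/
lemma commute_of_conj_eq_pow (hx : x ^ 7 = 1) (hy : y ^ 21 = 1) {k : ℕ}
    (hk : k ^ 6 % 21 = 1) (h : x⁻¹ * y * x = y ^ k) : Commute y x := by
  have h1 : MulAut.conj x⁻¹ y = y ^ k := by rw [MulAut.conj_apply, inv_inv, h]
  apply commute_of_conj_inv_apply
  have hα := conj_inv_pow_seven hx
  generalize MulAut.conj x⁻¹ = α at h1 hα
  apply apply_eq_of_iterate hα
  have : k * (k * (k * (k * (k * k)))) = 21 * (k ^ 6 / 21) + 1 := by
    have := Nat.div_add_mod (k ^ 6) 21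
    rw [hk] at this
    rw [this]
    ring
  simp only [map_pow, h1, ← pow_mul]
  rw [this, pow_add, pow_mul, hy, one_pow, one_mul, pow_one]

/-- In terms of the generators y, z of an abelian group of exponent dividing 3, conjugation by x is
the companion matrix of λ² - iλ + 1 over F_3. Its order is 4, 6 or 3 for i = 0, 1, 2, always prime
to 7. -/
lemma commute_of_conj_recurrence (hx : x ^ 7 = 1) (hy : y ^ 3 = 1) {z : G}
    (hz : x⁻¹ * y * x = z) (hyz : Commute y z) {i : ℕ} (hi : i < 3)
    (h : x⁻¹ * z * x = z ^ i * y⁻¹) : Commute y x := by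
  have h1 : MulAut.conj x⁻¹ y = z := by rw [MulAut.conj_apply, inv_inv, hz]
  have h2 : MulAut.conj x⁻¹ z = z ^ i * y⁻¹ := by rw [MulAut.conj_apply, inv_inv, h]
  have hz3 : z ^ 3 = 1 := by rw [← h1, ← map_pow, hy, map_one]
  have hzy' : Commute z y⁻¹ := hyz.symm.inv_right
  apply commute_of_conj_inv_apply
  have hα := conj_inv_pow_seven hx
  generalize MulAut.conj x⁻¹ = α at h1 h2 hα
  interval_cases i
  · rw [pow_zero, one_mul] at h2
    have h7 : α (α (α (α (α (α (α y)))))) = y := DFunLike.congr_fun hα y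
    simp only [h1, h2, map_inv, inv_inv] at h7
    have e : α z = α y := by rw [h2, h1, ← h7, inv_inv]
    rw [α.injective e] at h1
    exact h1
  · apply apply_eq_of_iterate hα
    have h3 : α (z ^ 1 * y⁻¹) = y⁻¹ := by
      rw [map_mul, map_inv, map_pow, h2, h1, pow_one, pow_one, hzy'.eq, mul_inv_cancel_right]
    rw [h1, h2, h3, map_inv, h1, map_inv, h2, map_inv, h3, inv_inv]
  · apply apply_eq_of_iterate hα
    have h3 : α (z ^ 2 * y⁻¹) = y := by
      have hy' : (y⁻¹) ^ 2 = y := by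
        rw [inv_pow, inv_eq_iff_mul_eq_one, ← pow_succ, hy]
      have hz' : (z ^ 2) ^ 2 = z := by
        rw [← pow_mul, show 2 * 2 = 3 + 1 by norm_num, pow_succ, hz3, one_mul]
      rw [map_mul, map_inv, map_pow, h2, h1, (hzy'.pow_left 2).mul_pow, hy', hz', hyz.symm.eq,
        mul_inv_cancel_right]
    rw [h1, h2, h3, h1, h2, h3]

end OrderSeven

/-! ### Characteristic polynomials when all nonzero scalars are cube roots of unity. -/

section Charpoly

variable {F : Type*} [Field F] [CharP F 2]

lemma exists_charpoly (X : SL(3, F)) : ∃ s t : F, X.1 ^ 3 = s • X.1 ^ 2 + t • X.1 + 1 ∧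
    ∀ l : F, (∃ v : Fin 3 → F, v ≠ 0 ∧ X.1 *ᵥ v = l • v) ↔ l ^ 3 = s * l ^ 2 + t * l + 1 := by
  have hdeg : X.1.charpoly.natDegree = 3 := by
    rw [charpoly_natDegree_eq_dim]; simp
  have h3 : X.1.charpoly.coeff 3 = 1 := by
    have := X.1.charpoly_monic
    rwa [Polynomial.Monic, Polynomial.leadingCoeff, hdeg] at this
  have h0 : X.1.charpoly.coeff 0 = 1 := by
    have := det_eq_sign_charpoly_coeff X.1
    rw [X.2] at this
    simpa [CharTwo.neg_eq] using this.symm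
  have hsum : X.1.charpoly = 1 + Polynomial.C (X.1.charpoly.coeff 1) * Polynomial.X +
      Polynomial.C (X.1.charpoly.coeff 2) * Polynomial.X ^ 2 + Polynomial.X ^ 3 := by
    conv_lhs => rw [Polynomial.as_sum_range_C_mul_X_pow X.1.charpoly, hdeg]
    simp [Finset.sum_range_succ, h0, h3]
  refine ⟨X.1.charpoly.coeff 2, X.1.charpoly.coeff 1, ?_, fun l => ?_⟩
  · have h := aeval_self_charpoly X.1
    rw [hsum] at h
    simp only [map_add, map_mul, map_pow, map_one, Polynomial.aeval_C, Polynomial.aeval_X,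
      ← Algebra.smul_def] at h
    have h' := eq_neg_of_add_eq_zero_right h
    rw [h', CharTwo.neg_eq]
    abel
  · have h1 : X.1.charpoly.eval l = 1 + X.1.charpoly.coeff 1 * l + X.1.charpoly.coeff 2 * l ^ 2
        + l ^ 3 := by
      conv_lhs => rw [hsum]
      simp
    have h2 : (∃ v : Fin 3 → F, v ≠ 0 ∧ X.1 *ᵥ v = l • v) ↔ X.1.charpoly.eval l = 0 := by
      rw [eval_charpoly, ← Matrix.exists_mulVec_eq_zero_iff]
      refine exists_congr fun v => and_congr_right fun _ => ?_
      rw [sub_mulVec, sub_eq_zero, scalar_apply, ← smul_one_eq_diagonal, smul_mulVec, one_mulVec]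
      exact eq_comm
    rw [h2, h1, add_eq_zero_iff_eq_neg', CharTwo.neg_eq]
    constructor <;> intro h <;> rw [h] <;> ring

/-- Over a field with four elements, the three possible types of characteristic polynomial. -/
lemma cubic_of_not_isReducible (h4 : ∀ a : F, a ≠ 0 → a ^ 3 = 1) {X : SL(3, F)}
    (hX : ¬ IsReducible X) : (∃ t : F, t ≠ 0 ∧ X.1 ^ 3 = t • X.1 + 1) ∨
      ∃ s : F, s ≠ 0 ∧ X.1 ^ 3 = s • X.1 ^ 2 + 1 := by
  obtain ⟨s, t, h, hl⟩ := exists_charpoly X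
  have hno : ∀ l : F, l ^ 3 ≠ s * l ^ 2 + t * l + 1 := fun l hl' => by
    obtain ⟨v, hv, h⟩ := (hl l).2 hl'
    exact hX ⟨v, hv, l, h⟩
  by_cases hs : s = 0
  · subst hs
    left
    refine ⟨t, ?_, by rw [h, zero_smul, zero_add]⟩
    rintro rfl
    exact hno 1 (by ring)
  · right
    refine ⟨s, hs, ?_⟩
    suffices ht : t = 0 by rw [h, ht, zero_smul, add_zero]
    by_contra ht
    -- If s and t are both nonzero, t/s is a root: its cube is 1 and the terms s(t/s)² and t(t/s)
    -- cancel.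
    apply hno (t / s)
    rw [h4 _ (div_ne_zero ht hs)]
    have : s * (t / s) ^ 2 = t * (t / s) := by field_simp
    rw [this, CharTwo.add_self_eq_zero, zero_add]

lemma pow_seven_eq_smul (h4 : ∀ a : F, a ≠ 0 → a ^ 3 = 1) {X : SL(3, F)}
    (hX : ¬ IsReducible X) : ∃ r : F, X.1 ^ 7 = r • 1 := by
  have h2 : (2 : F) = 0 := CharTwo.two_eq_zero
  have hX' := cubic_of_not_isReducible h4 hX
  generalize X.1 = M at hX' ⊢
  rcases hX' with ⟨t, ht, h⟩ | ⟨s, hs, h⟩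
  · refine ⟨t ^ 2, ?_⟩
    have h3 := h4 t ht
    have key : M ^ 7 = (t ^ 3 + 1) • M + (2 * t) • M ^ 2 + t ^ 2 • 1 := by
      have e4 : M ^ 4 = t • M ^ 2 + M := by
        rw [pow_succ, h, add_mul, smul_mul_assoc, one_mul, pow_two]
      rw [show 7 = 3 + 4 by norm_num, pow_add, h, e4, add_mul, mul_add, smul_mul_assoc,
        smul_mul_assoc, mul_smul_comm, one_mul, ← pow_succ', h, ← pow_two]
      module
    rw [key, h3, h2, zero_mul, CharTwo.add_self_eq_zero, zero_smul, zero_smul, zero_add, zero_add]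
  · refine ⟨s, ?_⟩
    have h3 := h4 s hs
    have key : M ^ 7 = (s ^ 2 * s ^ 3 + 3 * s ^ 2) • M ^ 2 + (s ^ 3 + 1) • M
        + (s * s ^ 3 + 2 * s) • 1 := by
      have e4 : M ^ 4 = s • M ^ 3 + M := by
        rw [pow_succ, h, add_mul, smul_mul_assoc, one_mul, ← pow_succ, h]
      have e5 : M ^ 5 = s • M ^ 4 + M ^ 2 := by
        calc M ^ 5 = M ^ 4 * M := pow_succ _ _
          _ = s • (M ^ 3 * M) + M * M := by rw [e4, add_mul, smul_mul_assoc]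
          _ = s • M ^ 4 + M ^ 2 := by rw [← pow_succ, pow_two]
      have e6 : M ^ 6 = s • M ^ 5 + M ^ 3 := by
        calc M ^ 6 = M ^ 5 * M := pow_succ _ _
          _ = s • (M ^ 4 * M) + M ^ 2 * M := by rw [e5, add_mul, smul_mul_assoc]
          _ = s • M ^ 5 + M ^ 3 := by rw [← pow_succ, ← pow_succ]
      rw [pow_succ, e6, add_mul, smul_mul_assoc, ← pow_succ, ← pow_succ, e6, e5, e4, h]
      module
    have e1 : s ^ 2 * s ^ 3 + 3 * s ^ 2 = 0 := by linear_combination s ^ 2 * h3 + 2 * s ^ 2 * h2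
    have e2 : s ^ 3 + 1 = 0 := by linear_combination h3 + h2
    have e3 : s * s ^ 3 + 2 * s = s := by linear_combination s * h3 + s * h2
    rw [key, e1, e2, e3, zero_smul, zero_smul, zero_add, zero_add]

variable {G : Type*} [Group G] {φ : SL(3, F) →* G}

lemma map_pow_seven (h4 : ∀ a : F, a ≠ 0 → a ^ 3 = 1)
    (hφ : φ.ker = Subgroup.center SL(3, F)) {X : SL(3, F)} (hX : ¬ IsReducible X) :
    φ X ^ 7 = 1 := by
  obtain ⟨r, hr⟩ := pow_seven_eq_smul h4 hX
  rw [← map_pow, map_eq_one_iff_scalar hφ]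
  exact ⟨r, hr⟩

/-- The matrices commute up to c with c³ = 1. As X⁷ is a nonzero scalar, also c⁷ = 1, and therefore
c = 1. -/
lemma commute_of_commute_map (h4 : ∀ a : F, a ≠ 0 → a ^ 3 = 1)
    (hφ : φ.ker = Subgroup.center SL(3, F)) {X Y : SL(3, F)} (hX : ¬ IsReducible X)
    (h : Commute (φ Y) (φ X)) : Commute Y X := by
  obtain ⟨r, hr⟩ := pow_seven_eq_smul h4 hX
  have h1 : φ (Y * X) = φ (X * Y) := by rw [map_mul, map_mul, h.eq]
  obtain ⟨c, hc⟩ := (map_eq_map_iff_smul hφ).1 h1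
  have hc3 := pow_three_eq_one_of_smul hc
  rw [Matrix.SpecialLinearGroup.coe_mul, Matrix.SpecialLinearGroup.coe_mul] at hc
  have hn : ∀ n : ℕ, Y.1 * X.1 ^ n = c ^ n • (X.1 ^ n * Y.1) := by
    intro n
    induction n with
    | zero => simp
    | succ n ih =>
      rw [pow_succ X.1, ← mul_assoc, ih, smul_mul_assoc, mul_assoc, hc, mul_smul_comm, smul_smul,
        mul_assoc, pow_succ]
  have h7 := hn 7
  have hr0 : r ≠ 0 := by
    rintro rfl
    have h2 := congrArg det hr
    rw [det_pow, X.2, zero_smul] at h2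
    simp at h2
  rw [hr, mul_smul_comm, smul_mul_assoc, mul_one, one_mul, smul_smul] at h7
  have hY : Y.1 ≠ 0 := by
    intro h0
    have := Y.2
    rw [h0] at this
    simp at this
  have h8 : r = c ^ 7 * r := smul_left_injective F hY h7
  have h9 : c ^ 7 = 1 := mul_right_cancel₀ hr0 (by rw [one_mul]; exact h8.symm)
  have h10 : c = 1 := by
    calc c = c ^ 7 * (c ^ 3 * c ^ 3)⁻¹ := by rw [hc3, show c ^ 7 = c ^ 3 * c ^ 3 * c by ring, hc3]; simp
      _ = 1 := by rw [h9, hc3]; simp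
  apply coe_injective
  rw [Matrix.SpecialLinearGroup.coe_mul, Matrix.SpecialLinearGroup.coe_mul, hc, h10, one_smul]

end Charpoly

end EngelGraphs

namespace EngelGraphs

open Matrix

/-! ### Centralizers over the field with four elements. -/

section FieldFour

universe u

variable {F : Type u} [Field F]

/-- Y lies in the field generated by X; subtracting an eigenvalue gives a singular element of that
field, that is, zero. -/
lemma exists_smul_one_of_isReducible_of_commute {X Y : SL(3, F)} (hX : ¬ IsReducible X)
    (h : Commute Y X) (hY : IsReducible Y) : ∃ l : F, Y.1 = l • 1 := by
  obtain ⟨K, _, _, L, θ, -, hθ, -, -, hL⟩ := exists_cubic_field hX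
  obtain ⟨k, hk⟩ := hL Y.1 (by
    have := coe_congr h.eq
    rwa [Matrix.SpecialLinearGroup.coe_mul, Matrix.SpecialLinearGroup.coe_mul] at this)
  obtain ⟨v, hv, l, hl⟩ := hY
  refine ⟨l, ?_⟩
  have h1 : L (k - algebraMap F K l) *ᵥ v = 0 := by
    rw [map_sub, sub_mulVec, hk, hl, AlgHom.commutes, Algebra.algebraMap_eq_smul_one, smul_mulVec,
      one_mulVec, sub_self]
  have h2 : k - algebraMap F K l = 0 := by
    by_contra h0
    apply hv
    calc v = L ((k - algebraMap F K l)⁻¹ * (k - algebraMap F K l)) *ᵥ v := by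
          rw [inv_mul_cancel₀ h0, map_one, one_mulVec]
      _ = 0 := by rw [map_mul, ← mulVec_mulVec, h1, mulVec_zero]
  rw [← hk, sub_eq_zero.1 h2, AlgHom.commutes, Algebra.algebraMap_eq_smul_one]

lemma commute_of_commute_irreducible {X Y Z : SL(3, F)} (hX : ¬ IsReducible X)
    (hY : Commute Y X) (hZ : Commute Z X) : Commute Y Z := by
  obtain ⟨K, _, _, L, θ, -, hθ, -, -, hL⟩ := exists_cubic_field hX
  have key : ∀ A : SL(3, F), Commute A X → ∃ k, L k = A.1 := fun A hA => hL A.1 (by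
    have := coe_congr hA.eq
    rwa [Matrix.SpecialLinearGroup.coe_mul, Matrix.SpecialLinearGroup.coe_mul] at this)
  obtain ⟨k, hk⟩ := key Y hY
  obtain ⟨k', hk'⟩ := key Z hZ
  apply coe_injective
  rw [Matrix.SpecialLinearGroup.coe_mul, Matrix.SpecialLinearGroup.coe_mul, ← hk, ← hk',
    ← map_mul, ← map_mul, mul_comm]

variable [CharP F 2] {G : Type*} [Group G] {φ : SL(3, F) →* G}

/-- Over the field with four elements, the centralizer of a semisimple element with three distinct
eigenvalues is generated by it modulo scalars. -/
lemma exists_map_eq_pow (h4 : ∀ a : F, a ≠ 0 → a ^ 3 = 1) {w : F} (hw : w ^ 2 = w + 1)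
    (hφ : φ.ker = Subgroup.center SL(3, F)) {Y M : SL(3, F)}
    (hev : ∀ l : F, l ≠ 0 → ∃ v : Fin 3 → F, v ≠ 0 ∧ Y.1 *ᵥ v = l • v) (h : Commute M Y) :
    ∃ i < 3, φ M = φ Y ^ i := by
  have h2 : (2 : F) = 0 := CharTwo.two_eq_zero
  have hw0 : w ≠ 0 := by
    rintro rfl
    simp at hw
  have hw1 : w ≠ 1 := by
    rintro rfl
    exact one_ne_zero (α := F) (by linear_combination -hw)
  have hw2 : w ^ 2 ≠ 1 := fun h => hw0 (by linear_combination h - hw)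
  have hw3 : w ^ 2 ≠ w := fun h => one_ne_zero (α := F) (by linear_combination h - hw)
  let d : Fin 3 → F := ![1, w, w ^ 2]
  have hd : Function.Injective d := by
    intro i j hij
    fin_cases i <;> fin_cases j <;> simp [d] at hij ⊢
    · exact hw1 hij.symm
    · exact absurd hij.symm hw2
    · exact hw1 hij
    · exact hw3 hij.symm
    · exact (hw2 (by rcases hij with h | h <;> rw [h] <;> ring)).elim
    · exact hw3 hij
  have hd0 : ∀ i, d i ≠ 0 := by
    intro i
    fin_cases i
    · exact one_ne_zero
    · exact hw0
    · exact pow_ne_zero 2 hw0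
  choose v hv0 hv using fun i => hev (d i) (hd0 i)
  have hli : LinearIndependent F v :=
    Module.End.eigenvectors_linearIndependent' (Matrix.toLin' Y.1) d hd v fun i =>
      Module.End.hasEigenvector_iff.2 ⟨Module.End.mem_eigenspace_iff.2 (by
        rw [toLin'_apply, hv]), hv0 i⟩
  obtain ⟨P, D, hD, hY, -⟩ := exists_eq_conjGL Y hli (diagonal d) (by
    intro j
    rw [hv]
    simp [diagonal_apply])
  obtain ⟨M', rfl⟩ : ∃ M', conjGL P M' = M :=
    ⟨conjGL P⁻¹ M, by rw [← conjGL_mul, mul_inv_cancel, conjGL_one]⟩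
  rw [hY] at h
  have hc : Commute M' D := conjGL_injective P (by rw [map_mul, map_mul, h.eq])
  have hc' : M'.1 * diagonal d = diagonal d * M'.1 := by
    have := coe_congr hc.eq
    rwa [Matrix.SpecialLinearGroup.coe_mul, Matrix.SpecialLinearGroup.coe_mul, hD] at this
  have hoff : ∀ i j, i ≠ j → M'.1 i j = 0 := by
    intro i j hij
    have h1 := congrFun (congrFun hc' i) j
    rw [mul_diagonal, diagonal_mul] at h1
    have h3 : M'.1 i j * (d j - d i) = 0 := by linear_combination h1
    exact (mul_eq_zero.1 h3).resolve_right (sub_ne_zero.2 fun h => hij (hd h).symm)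
  have hdiag : M'.1 = diagonal fun i => M'.1 i i := by
    ext i j
    rw [diagonal_apply]
    split_ifs with hij
    · rw [hij]
    · exact hoff i j hij
  set e : Fin 3 → F := fun i => M'.1 i i with he
  have hdet : e 0 * e 1 * e 2 = 1 := by
    have := M'.2
    rw [hdiag, det_diagonal, Fin.prod_univ_three] at this
    exact this
  have he0 : e 0 ≠ 0 := fun h0 => by simp [h0] at hdet
  have he1 : e 1 ≠ 0 := fun h0 => by simp [h0] at hdet
  have ha := h4 _ he0
  have hb := h4 _ he1
  -- In an eigenbasis of Y, determinant 1 and cubes equal to 1 force M = e_0 diag(1, r, r²), where r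
  -- is a power of w. As Y = diag(1, w, w²) there, M is a power of Y up to a scalar.
  obtain ⟨r, hr⟩ : ∃ r, e 1 = e 0 * r := ⟨e 1 / e 0, by field_simp⟩
  have hr0 : r ≠ 0 := fun h0 => he1 (by rw [hr, h0, mul_zero])
  have hr3 := h4 r hr0
  have hr2 : e 2 = e 0 * r ^ 2 := by
    rw [hr] at hdet
    calc e 2 = (e 0 ^ 3 * r ^ 3) * e 2 := by rw [ha, hr3, one_mul, one_mul]
      _ = (e 0 * (e 0 * r) * e 2) * (e 0 * r ^ 2) := by ring
      _ = e 0 * r ^ 2 := by rw [hdet, one_mul]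
  have hri : ∃ i < 3, r = w ^ i := by
    have : (r - 1) * ((r - w) * (r - w ^ 2)) = 0 := by
      have e1 : w ^ 2 + w + 1 = 0 := by linear_combination hw + (w + 1) * h2
      have e2 : w ^ 3 = 1 := h4 w hw0
      linear_combination hr3 - r ^ 2 * e1 + r * e1 + r * e2 - e2
    rcases mul_eq_zero.1 this with h | h
    · exact ⟨0, by norm_num, by rw [pow_zero]; exact sub_eq_zero.1 h⟩
    rcases mul_eq_zero.1 h with h | h
    · exact ⟨1, by norm_num, by rw [pow_one]; exact sub_eq_zero.1 h⟩
    · exact ⟨2, by norm_num, sub_eq_zero.1 h⟩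
  obtain ⟨i, hi, hri⟩ := hri
  refine ⟨i, hi, ?_⟩
  rw [hY, ← map_pow, ← map_pow]
  refine (map_eq_map_iff_smul (ker_comp_conjGL hφ P)).2 ⟨e 0, ?_⟩
  rw [Matrix.SpecialLinearGroup.coe_pow, hD, hdiag, diagonal_pow, ← diagonal_smul]
  congr 1
  funext j
  fin_cases j
  · simp [d]
  · simp [d, hr, hri]
  · change e 2 = e 0 * (w ^ 2) ^ i
    rw [hr2, hri, ← pow_mul, ← pow_mul, mul_comm i]

/-- A matrix with a two-dimensional eigenspace is a transvection up to a scalar. -/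
lemma exists_isInvol_of_eigenspace (h4 : ∀ a : F, a ≠ 0 → a ^ 3 = 1)
    (hφ : φ.ker = Subgroup.center SL(3, F)) {Y : SL(3, F)} (hY : φ Y ≠ 1) {v w : Fin 3 → F}
    {l : F} (hl : l ≠ 0) (hv : v ≠ 0) (hw : ∀ m : F, w ≠ m • v) (hYv : Y.1 *ᵥ v = l • v)
    (hYw : Y.1 *ᵥ w = l • w) : ∃ T, IsInvol T ∧ φ T = φ Y := by
  have hvw : v ⨯₃ w ≠ 0 := by
    rw [crossProduct_ne_zero_iff_linearIndependent]
    exact (LinearIndependent.pair_iff' hv).2 fun m h' => hw m h'.symm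
  -- The rows of Y - l annihilate v and w, so they are multiples of v × w. Since l³ = 1, the matrix
  -- l⁻¹Y still has determinant 1.
  have hrow : ∀ i, ∃ c : F, (Y.1 - l • 1) i = c • (v ⨯₃ w) := by
    intro i
    apply exists_eq_smul_cross hvw
    · change ((Y.1 - l • 1) *ᵥ v) i = 0
      rw [sub_mulVec, hYv, smul_mulVec, one_mulVec, sub_self, Pi.zero_apply]
    · change ((Y.1 - l • 1) *ᵥ w) i = 0
      rw [sub_mulVec, hYw, smul_mulVec, one_mulVec, sub_self, Pi.zero_apply]
  choose a ha using hrow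
  have hl3 : (l⁻¹) ^ 3 = 1 := by rw [inv_pow, h4 l hl, inv_one]
  have hT : (scaleSL l⁻¹ hl3 Y).1 = 1 + vecMulVec (l⁻¹ • a) (v ⨯₃ w) := by
    have h1 : Y.1 = l • 1 + vecMulVec a (v ⨯₃ w) := by
      rw [← sub_eq_iff_eq_add']
      ext i j
      rw [ha, vecMulVec_apply]
      rfl
    rw [coe_scaleSL, h1, smul_add, smul_smul, inv_mul_cancel₀ hl, one_smul, smul_vecMulVec]
  have hdot : (v ⨯₃ w) ⬝ᵥ (l⁻¹ • a) = 0 := by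
    have h1 := (scaleSL l⁻¹ hl3 Y).2
    rw [hT, vecMulVec_eq Unit, det_one_add_replicateCol_mul_replicateRow] at h1
    exact add_eq_left.1 h1
  have h1 : scaleSL l⁻¹ hl3 Y = tv _ _ hdot := coe_injective hT
  refine ⟨tv _ _ hdot, isInvol_tv hdot (fun h0 => hY ?_) hvw, ?_⟩
  · rw [← map_scaleSL hφ l⁻¹ hl3, h1]
    have : tv _ _ hdot = 1 := coe_injective (by
      rw [coe_tv, h0, zero_vecMulVec, add_zero]
      rfl)
    rw [this, map_one]
  · rw [← h1, map_scaleSL hφ]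

/-- Commuting would make f vanish at X⁻¹a, a and Xa, which form a basis because X is irreducible. -/
lemma not_commute_conj_of_isInvol {X T : SL(3, F)} (hX : ¬ IsReducible X) (hT : IsInvol T) :
    ¬ Commute T (X⁻¹ * T * X) := by
  intro hc
  obtain ⟨a, f, h, ha, hf, rfl⟩ := hT.exists_eq_tv
  obtain ⟨h', he⟩ := mulVec_tv_conj (X := X) h
  have hXX : X.1 * (X⁻¹ : SL(3, F)).1 = 1 := by
    have := coe_congr (mul_inv_cancel X)
    rwa [Matrix.SpecialLinearGroup.coe_mul, Matrix.SpecialLinearGroup.coe_one] at this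
  have hXX' : (X⁻¹ : SL(3, F)).1 * X.1 = 1 := by
    have := coe_congr (inv_mul_cancel X)
    rwa [Matrix.SpecialLinearGroup.coe_mul, Matrix.SpecialLinearGroup.coe_one] at this
  have ha' : (X⁻¹ : SL(3, F)).1 *ᵥ a ≠ 0 := by
    intro h0
    apply ha
    rw [← one_mulVec a, ← hXX, ← mulVec_mulVec, h0, mulVec_zero]
  have hf' : f ᵥ* X.1 ≠ 0 := by
    intro h0
    apply hf
    rw [← vecMul_one f, ← hXX, ← vecMul_vecMul, h0, zero_vecMul]
  rw [he] at hc
  obtain ⟨h1, h2⟩ := (commute_tv_iff h h' ha hf ha' hf').1 hc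
  have hli := linearIndependent_cyclic hX ha'
  have e1 : X.1 *ᵥ ((X⁻¹ : SL(3, F)).1 *ᵥ a) = a := by rw [mulVec_mulVec, hXX, one_mulVec]
  rw [e1] at hli
  apply hf
  obtain hall : ∀ y, f ⬝ᵥ y = 0 := by
    intro y
    obtain ⟨c, rfl⟩ := exists_eq_of_linearIndependent hli y
    rw [← dotProduct_mulVec] at h2
    generalize (X⁻¹ : SL(3, F)).1 *ᵥ a = b at h1
    simp [Fin.sum_univ_three, h1, h2, h]
  exact dotProduct_eq_zero _ hall

/-- A root in a cubic extension of the field with four elements of the minimal polynomial of a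
generator is conjugate to it by a power of the Frobenius automorphism. -/
lemma eq_or_of_cubic {K : Type*} [Field K] [Algebra F K] (h4 : ∀ a : F, a ≠ 0 → a ^ 3 = 1)
    {k θ : K} (h : (∃ t : F, t ≠ 0 ∧ θ ^ 3 = t • θ + 1 ∧ k ^ 3 = t • k + 1) ∨
      ∃ s : F, s ≠ 0 ∧ θ ^ 3 = s • θ ^ 2 + 1 ∧ k ^ 3 = s • k ^ 2 + 1) :
    k = θ ∨ k = θ ^ 4 ∨ ∃ r : F, k = r • θ ^ 2 := by
  have h2 : (2 : K) = 0 := by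
    rw [← map_ofNat (algebraMap F K) 2, CharTwo.two_eq_zero, map_zero]
  rcases h with ⟨t, ht, h1, hk⟩ | ⟨s, hs, h1, hk⟩
  · have h3 : (algebraMap F K t) ^ 3 = 1 := by rw [← map_pow, h4 t ht, map_one]
    simp only [Algebra.smul_def] at h1 hk ⊢
    -- The conjugates of θ are θ, θ⁴ and θ¹⁶, and θ¹⁶ is a scalar multiple of θ² because θ⁷ is a
    -- scalar.
    have : (k - θ) * ((k - θ ^ 4) * (k - algebraMap F K t * θ ^ 2)) = 0 := by
      generalize algebraMap F K t = t at h1 hk h3 ⊢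
      linear_combination hk - h1 + (k - θ) * ((-θ * k + t * θ ^ 3 + t ^ 2 * θ + t) * h1
        + θ ^ 2 * h3 + (-t * θ ^ 2 * k - θ * k + t ^ 2 * θ + t) * h2)
    rcases mul_eq_zero.1 this with h | h
    · exact Or.inl (sub_eq_zero.1 h)
    rcases mul_eq_zero.1 h with h | h
    · exact Or.inr (Or.inl (sub_eq_zero.1 h))
    · exact Or.inr (Or.inr ⟨t, sub_eq_zero.1 h⟩)
  · have h3 : (algebraMap F K s) ^ 3 = 1 := by rw [← map_pow, h4 s hs, map_one]
    simp only [Algebra.smul_def] at h1 hk ⊢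
    have : (k - θ) * ((k - θ ^ 4) * (k - algebraMap F K (s ^ 2) * θ ^ 2)) = 0 := by
      rw [map_pow]
      generalize algebraMap F K s = s at h1 hk h3 ⊢
      linear_combination hk - h1 + (k - θ) * ((-(θ + s) * k + s ^ 2 * θ ^ 2 * (θ + s)
        + s ^ 4 * (θ + s) + s ^ 2) * h1 + ((s ^ 3 + 1) * θ ^ 2 + s * θ + s ^ 2) * h3
        + (-s ^ 2 * θ ^ 2 * k - θ * k + s * θ + s ^ 2 + s ^ 3 * θ ^ 2) * h2)
    rcases mul_eq_zero.1 this with h | h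
    · exact Or.inl (sub_eq_zero.1 h)
    rcases mul_eq_zero.1 h with h | h
    · exact Or.inr (Or.inl (sub_eq_zero.1 h))
    · exact Or.inr (Or.inr ⟨s ^ 2, sub_eq_zero.1 h⟩)

end FieldFour

end EngelGraphs

namespace EngelGraphs

open Matrix

/-! ### Γ_2(PSL(3, 4)) is not strongly connected. -/

section FieldFour

universe u

variable {F : Type u} [Field F] {G : Type*} [Group G] {φ : SL(3, F) →* G}

lemma exists_smul_mul_of_commute_map (hφ : φ.ker = Subgroup.center SL(3, F)) {Y Z : SL(3, F)}
    (h : Commute (φ Y) (φ Z)) : ∃ c : F, c ^ 3 = 1 ∧ Y.1 * Z.1 = c • (Z.1 * Y.1) := by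
  obtain ⟨c, hc⟩ := (map_eq_map_iff_smul hφ (A := Y * Z) (B := Z * Y)).1
    (by rw [map_mul, map_mul, h.eq])
  refine ⟨c, pow_three_eq_one_of_smul hc, ?_⟩
  rwa [Matrix.SpecialLinearGroup.coe_mul, Matrix.SpecialLinearGroup.coe_mul] at hc

lemma coe_conj_pow (X Y : SL(3, F)) (n : ℕ) :
    (X⁻¹ * Y * X).1 ^ n = (X⁻¹ : SL(3, F)).1 * Y.1 ^ n * X.1 := by
  have h := conj_pow (a := X⁻¹) (b := Y) (i := n)
  rw [inv_inv] at h
  calc (X⁻¹ * Y * X).1 ^ n = ((X⁻¹ * Y * X) ^ n).1 :=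
        (Matrix.SpecialLinearGroup.coe_pow _ n).symm
    _ = (X⁻¹ * Y ^ n * X).1 := by rw [h]
    _ = _ := by
      rw [Matrix.SpecialLinearGroup.coe_mul, Matrix.SpecialLinearGroup.coe_mul,
        Matrix.SpecialLinearGroup.coe_pow]

lemma coe_inv_mul (X : SL(3, F)) : (X⁻¹ : SL(3, F)).1 * X.1 = 1 := by
  have := coe_congr (inv_mul_cancel X)
  rwa [Matrix.SpecialLinearGroup.coe_mul, Matrix.SpecialLinearGroup.coe_one] at this

lemma coe_mul_inv (X : SL(3, F)) : X.1 * (X⁻¹ : SL(3, F)).1 = 1 := by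
  have := coe_congr (mul_inv_cancel X)
  rwa [Matrix.SpecialLinearGroup.coe_mul, Matrix.SpecialLinearGroup.coe_one] at this

lemma pow_three_eq_one_of_card (hF : Nat.card F = 4) (a : F) (ha : a ≠ 0) : a ^ 3 = 1 := by
  have : Finite F := Nat.finite_of_card_ne_zero (by rw [hF]; norm_num)
  have := Fintype.ofFinite F
  have h := FiniteField.pow_card_sub_one_eq_one a ha
  rwa [← Nat.card_eq_fintype_card, hF] at h

/-- The companion matrix of `T³ + T + 1`. -/
def companionSL (F : Type*) [Field F] : SL(3, F) :=
  ⟨!![0, 0, 1; 1, 0, 1; 0, 1, 0], by simp [det_fin_three]⟩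

lemma coe_companionSL : (companionSL F).1 = !![0, 0, 1; 1, 0, 1; 0, 1, 0] := rfl

lemma not_isReducible_companionSL (h4 : ∀ a : F, a ≠ 0 → a ^ 3 = 1) :
    ¬ IsReducible (companionSL F) := by
  rintro ⟨v, hv, l, h⟩
  rw [coe_companionSL] at h
  have e0 := congrFun h 0
  have e1 := congrFun h 1
  have e2 := congrFun h 2
  simp [mulVec, dotProduct, Fin.sum_univ_three] at e0 e1 e2
  have hv0 : v 0 ≠ 0 := by
    intro h0
    apply hv
    have h2 : v 2 = 0 := by rw [e0, h0, mul_zero]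
    have h1 : v 1 = 0 := by rw [e2, h2, mul_zero]
    funext i
    fin_cases i <;> assumption
  have hl : l ^ 3 = l + 1 := by
    apply mul_right_cancel₀ hv0
    linear_combination -e1 - (l ^ 2 - 1) * e0 - l * e2
  by_cases hl0 : l = 0
  · simp [hl0] at hl
  · rw [h4 l hl0] at hl
    exact hl0 (by linear_combination -hl)

variable [CharP F 2]

/-- X⁻¹YX lies in the field F[Y] and satisfies the same cubic as Y, so modulo scalars X conjugates Y
to its power 1, 4 or 2. As X has seventh power 1 modulo scalars, it must centralize Y. -/
lemma commute_of_commute_conj_of_not_isReducible (h4 : ∀ a : F, a ≠ 0 → a ^ 3 = 1)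
    (hφ : φ.ker = Subgroup.center SL(3, F)) {X Y : SL(3, F)} (hX : ¬ IsReducible X)
    (hY : ¬ IsReducible Y) (h : Commute (φ Y) (φ (X⁻¹ * Y * X))) : Commute Y X := by
  have hc := commute_of_commute_map h4 hφ hY h.symm
  obtain ⟨K, _, _, L, θ, -, hθ, -, -, hL⟩ := exists_cubic_field hY
  obtain ⟨k, hk⟩ := hL (X⁻¹ * Y * X).1 (by
    have := coe_congr hc.eq
    rwa [Matrix.SpecialLinearGroup.coe_mul _ Y, Matrix.SpecialLinearGroup.coe_mul Y] at this)
  have hinj : Function.Injective L := L.toRingHom.injective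
  have hconj : ∀ n : ℕ, L k ^ n = (X⁻¹ : SL(3, F)).1 * Y.1 ^ n * X.1 := by
    intro n
    rw [hk, coe_conj_pow]
  have hk1 : L k = (X⁻¹ : SL(3, F)).1 * Y.1 * X.1 := by simpa using hconj 1
  have hcub : (∃ t : F, t ≠ 0 ∧ θ ^ 3 = t • θ + 1 ∧ k ^ 3 = t • k + 1) ∨
      ∃ s : F, s ≠ 0 ∧ θ ^ 3 = s • θ ^ 2 + 1 ∧ k ^ 3 = s • k ^ 2 + 1 := by
    rcases cubic_of_not_isReducible h4 hY with ⟨t, ht, e⟩ | ⟨s, hs, e⟩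
    · refine Or.inl ⟨t, ht, hinj ?_, hinj ?_⟩
      · rw [map_pow, map_add, map_smul, map_one, hθ, e]
      · rw [map_pow, map_add, map_smul, map_one, hconj, e, hk1, mul_add, add_mul, mul_one,
          coe_inv_mul, mul_smul_comm, smul_mul_assoc]
    · refine Or.inr ⟨s, hs, hinj ?_, hinj ?_⟩
      · rw [map_pow, map_add, map_smul, map_one, map_pow, hθ, e]
      · rw [map_pow, map_add, map_smul, map_one, map_pow, hconj, hconj, e, mul_add, add_mul,
          mul_one, coe_inv_mul, mul_smul_comm, smul_mul_assoc]
  have hx7 := map_pow_seven h4 hφ hX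
  have hy21 : φ Y ^ 21 = 1 := by
    rw [show 21 = 7 * 3 by norm_num, pow_mul, map_pow_seven h4 hφ hY, one_pow]
  have hz : φ (X⁻¹ * Y * X) = (φ X)⁻¹ * φ Y * φ X := by rw [map_mul, map_mul, map_inv]
  apply commute_of_commute_map h4 hφ hX
  rcases eq_or_of_cubic h4 hcub with e | e | ⟨r, e⟩
  · refine commute_of_conj_eq_pow hx7 hy21 (k := 1) (by norm_num) ?_
    rw [← hz, pow_one]
    congr 1
    apply coe_injective
    rw [← hk, e, hθ]
  · refine commute_of_conj_eq_pow hx7 hy21 (k := 4) (by norm_num) ?_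
    rw [← hz, ← map_pow]
    congr 1
    apply coe_injective
    rw [← hk, e, map_pow, hθ, Matrix.SpecialLinearGroup.coe_pow]
  · refine commute_of_conj_eq_pow hx7 hy21 (k := 2) (by norm_num) ?_
    rw [← hz, ← map_pow, map_eq_map_iff_smul hφ]
    refine ⟨r, ?_⟩
    rw [← hk, e, map_smul, map_pow, hθ, Matrix.SpecialLinearGroup.coe_pow]

/-- Let Z = X⁻¹YX. If Y has characteristic polynomial λ³ - 1, its eigenvalues are distinct, and the
centralizer of Z, generated by Z modulo scalars, contains X⁻¹ZX·Y; `commute_of_conj_recurrence`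
applies. Otherwise Y has a single eigenvalue with an eigenspace of dimension at least two, hence is
an involution up to scalars, contradicting `not_commute_conj_of_isInvol`. -/
lemma commute_of_commute_conj_of_isReducible (h4 : ∀ a : F, a ≠ 0 → a ^ 3 = 1)
    (hw : ∃ w : F, w ^ 2 = w + 1)
    (hφ : φ.ker = Subgroup.center SL(3, F)) {X Y : SL(3, F)} (hX : ¬ IsReducible X)
    (hY : IsReducible Y) (hY1 : φ Y ≠ 1) (h : Commute (φ Y) (φ (X⁻¹ * Y * X))) :
    Commute Y X := by
  have h2 : (2 : F) = 0 := CharTwo.two_eq_zero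
  obtain ⟨s, t, hch, hl⟩ := exists_charpoly Y
  obtain ⟨c, hc3, hc⟩ := exists_smul_mul_of_commute_map hφ h
  obtain ⟨Z, hZ⟩ : ∃ Z, Z = X⁻¹ * Y * X := ⟨_, rfl⟩
  rw [← hZ] at h hc
  have hXZ : X.1 * Z.1 = Y.1 * X.1 := by
    have : X * Z = Y * X := by rw [hZ]; group
    have := coe_congr this
    rwa [Matrix.SpecialLinearGroup.coe_mul, Matrix.SpecialLinearGroup.coe_mul] at this
  by_cases hst : s = 0 ∧ t = 0
  · obtain ⟨rfl, rfl⟩ := hst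
    obtain ⟨w, hw⟩ := hw
    have hev : ∀ l : F, l ≠ 0 → ∃ v : Fin 3 → F, v ≠ 0 ∧ Y.1 *ᵥ v = l • v := by
      intro l hl0
      rw [hl, h4 l hl0]
      ring
    have hevZ : ∀ l : F, l ≠ 0 → ∃ v : Fin 3 → F, v ≠ 0 ∧ Z.1 *ᵥ v = l • v := by
      intro l hl0
      obtain ⟨v, hv, hlv⟩ := hev l hl0
      refine ⟨(X⁻¹ : SL(3, F)).1 *ᵥ v, fun h0 => hv ?_, ?_⟩
      · rw [← one_mulVec v, ← coe_mul_inv X, ← mulVec_mulVec, h0, mulVec_zero]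
      · have : Z * X⁻¹ = X⁻¹ * Y := by rw [hZ]; group
        have := coe_congr this
        rw [Matrix.SpecialLinearGroup.coe_mul, Matrix.SpecialLinearGroup.coe_mul] at this
        rw [mulVec_mulVec, this, ← mulVec_mulVec, hlv, mulVec_smul]
    have hY3 : φ Y ^ 3 = 1 := by
      have : Y ^ 3 = 1 := coe_injective (by
        rw [Matrix.SpecialLinearGroup.coe_pow, hch, zero_smul, zero_smul, zero_add, zero_add]
        rfl)
      rw [← map_pow, this, map_one]
    -- Moving Z past X⁻¹ZX and past Y produces the factors c and c⁻¹, which cancel.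
    have hcomm : Commute (X⁻¹ * Z * X * Y) Z := by
      have hconj : Z.1 * (X⁻¹ * Z * X).1 = c • ((X⁻¹ * Z * X).1 * Z.1) := by
        have e1 : Z * (X⁻¹ * Z * X) = X⁻¹ * (Y * Z) * X := by
          nth_rewrite 1 [hZ]
          group
        have e2 : X⁻¹ * Z * X * Z = X⁻¹ * (Z * Y) * X := by
          nth_rewrite 2 [hZ]
          group
        have e3 := coe_congr e1
        have e4 := coe_congr e2
        simp only [Matrix.SpecialLinearGroup.coe_mul] at e3 e4 ⊢
        rw [e3, e4, hc, mul_smul_comm, smul_mul_assoc]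
      apply coe_injective
      rw [Matrix.SpecialLinearGroup.coe_mul _ Z, Matrix.SpecialLinearGroup.coe_mul Z,
        Matrix.SpecialLinearGroup.coe_mul _ Y, ← mul_assoc, hconj, mul_assoc, hc, mul_smul_comm,
        smul_mul_assoc, ← mul_assoc]
    obtain ⟨i, hi, he⟩ := exists_map_eq_pow h4 hw hφ hevZ hcomm
    apply commute_of_commute_map h4 hφ hX
    refine commute_of_conj_recurrence (map_pow_seven h4 hφ hX) hY3 (z := φ Z) ?_ h hi ?_
    · rw [hZ, map_mul, map_mul, map_inv]
    · rw [← he, map_mul, mul_inv_cancel_right, map_mul, map_mul, map_inv]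
  · exfalso
    have h0 : ∀ l : F, l ^ 3 = s * l ^ 2 + t * l + 1 → l ≠ 0 ∧ s * l = t := by
      intro l hl
      have hl0 : l ≠ 0 := by
        rintro rfl
        simp at hl
      refine ⟨hl0, ?_⟩
      rw [h4 l hl0] at hl
      have : l * (s * l - t) = 0 := by linear_combination -hl - t * l * h2
      exact sub_eq_zero.1 ((mul_eq_zero.1 this).resolve_left hl0)
    have huniq : ∀ l m : F, l ^ 3 = s * l ^ 2 + t * l + 1 → m ^ 3 = s * m ^ 2 + t * m + 1 →
        l = m := by
      intro l m hl hm
      have e1 := (h0 l hl).2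
      have e2 := (h0 m hm).2
      have hs : s ≠ 0 := by
        rintro rfl
        exact hst ⟨rfl, by rw [← e1, zero_mul]⟩
      exact mul_left_cancel₀ hs (e1.trans e2.symm)
    obtain ⟨v, hv, l, hlv⟩ := hY
    have hlr := (hl l).1 ⟨v, hv, hlv⟩
    have hl0 := (h0 l hlr).1
    have hZv : Z.1 *ᵥ v ≠ 0 := by
      intro h0
      apply hv
      rw [← one_mulVec v, ← coe_inv_mul Z, ← mulVec_mulVec, h0, mulVec_zero]
    have hYZ : Y.1 *ᵥ (Z.1 *ᵥ v) = (c * l) • (Z.1 *ᵥ v) := by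
      rw [mulVec_mulVec, hc, smul_mulVec, ← mulVec_mulVec, hlv, mulVec_smul, smul_smul]
    have hcl : c * l = l := huniq _ _ ((hl _).1 ⟨_, hZv, hYZ⟩) hlr
    rw [hcl] at hYZ
    -- Zv is an eigenvector of Y. If it is proportional to v, then Xv is an eigenvector, and it is
    -- not proportional to v since X is irreducible.
    obtain ⟨w, hw, hYw⟩ : ∃ w, (∀ m : F, w ≠ m • v) ∧ Y.1 *ᵥ w = l • w := by
      by_cases hm : ∃ m : F, Z.1 *ᵥ v = m • v
      · obtain ⟨m, hm⟩ := hm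
        have hXv : X.1 *ᵥ v ≠ 0 := by
          intro h0
          apply hv
          rw [← one_mulVec v, ← coe_inv_mul X, ← mulVec_mulVec, h0, mulVec_zero]
        have e1 : Y.1 *ᵥ (X.1 *ᵥ v) = m • (X.1 *ᵥ v) := by
          rw [mulVec_mulVec, ← hXZ, ← mulVec_mulVec, hm, mulVec_smul]
        have hml : m = l := huniq _ _ ((hl _).1 ⟨_, hXv, e1⟩) hlr
        exact ⟨X.1 *ᵥ v, fun k hk => hX ⟨v, hv, k, hk⟩, by rw [e1, hml]⟩
      · push Not at hm
        exact ⟨Z.1 *ᵥ v, hm, hYZ⟩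
    obtain ⟨T, hT, hTY⟩ := exists_isInvol_of_eigenspace h4 hφ hY1 hl0 hv hw hlv hYw
    apply not_commute_conj_of_isInvol hX hT
    refine IsInvol.commute_of_map hφ ⟨fun h1 => hT.1 ?_, ?_⟩ ?_
    · calc T = X * (X⁻¹ * T * X) * X⁻¹ := by group
        _ = 1 := by rw [h1]; group
    · calc X⁻¹ * T * X * (X⁻¹ * T * X) = X⁻¹ * (T * T) * X := by group
        _ = 1 := by rw [hT.2]; group
    · rw [hZ, map_mul, map_mul] at h
      rw [map_mul, map_mul, hTY]
      exact h

lemma commute_of_commute_conj (h4 : ∀ a : F, a ≠ 0 → a ^ 3 = 1)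
    (hw : ∃ w : F, w ^ 2 = w + 1) (hφ : φ.ker = Subgroup.center SL(3, F)) {X Y : SL(3, F)}
    (hX : ¬ IsReducible X) (hY1 : φ Y ≠ 1) (h : Commute (φ Y) (φ (X⁻¹ * Y * X))) :
    Commute Y X := by
  by_cases hY : IsReducible Y
  · exact commute_of_commute_conj_of_isReducible h4 hw hφ hX hY hY1 h
  · exact commute_of_commute_conj_of_not_isReducible h4 hφ hX hY h

open scoped Classical in
lemma exists_sq_eq_add_one (hF : Nat.card F = 4) : ∃ w : F, w ^ 2 = w + 1 := by
  have : Finite F := Nat.finite_of_card_ne_zero (by rw [hF]; norm_num)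
  have := Fintype.ofFinite F
  obtain ⟨w, hw⟩ : ∃ w : F, w ∉ ({0, 1} : Finset F) := by
    by_contra! h
    have h1 := Finset.card_le_card (fun x _ => h x : Finset.univ ⊆ ({0, 1} : Finset F))
    rw [Finset.card_univ, ← Nat.card_eq_fintype_card, hF] at h1
    have h2 := Finset.card_le_two (a := (0 : F)) (b := 1)
    omega
  simp only [Finset.mem_insert, Finset.mem_singleton, not_or] at hw
  refine ⟨w, ?_⟩
  have h3 := pow_three_eq_one_of_card hF w hw.1
  have h2 : (2 : F) = 0 := CharTwo.two_eq_zero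
  have : (w - 1) * (w ^ 2 - (w + 1)) = 0 := by linear_combination h3 + (-w ^ 2 + 1) * h2
  exact sub_eq_zero.1 ((mul_eq_zero.1 this).resolve_left (sub_ne_zero.2 hw.2))

/-- The second Engel graph of `PSL(3, 4)` is not strongly connected. -/
theorem not_isStronglyConnected_two (hF : Nat.card F = 4) :
    ¬ IsStronglyConnected (engelGraph 2 PSL(3, F)) := by
  intro hsc
  have h4 := pow_three_eq_one_of_card hF
  have hw := exists_sq_eq_add_one hF
  let φ : SL(3, F) →* PSL(3, F) := QuotientGroup.mk' _
  have hφ : φ.ker = Subgroup.center SL(3, F) := QuotientGroup.ker_mk' _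
  have hI : ∀ X, φ X ≠ 1 → φ X ∉ biEngelSet 2 PSL(3, F) := fun X hX h =>
    notMem_biEngelSet_three hφ hX (biEngelSet_subset_succ 2 h)
  have hC := not_isReducible_companionSL h4
  have hred : ∀ X : SL(3, F), φ X = 1 → IsReducible X := by
    intro X hX
    obtain ⟨r, hr⟩ := (map_eq_one_iff_scalar hφ).1 hX
    exact ⟨Pi.single 0 1, by simp, r, by rw [hr, smul_mulVec, one_mulVec]⟩
  have hC1 : φ (companionSL F) ≠ 1 := fun h => hC (hred _ h)
  have n01 : (0 : Fin 3) ≠ 1 := by decide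
  have hT : IsInvol (root n01 (1 : F)) := isInvol_root n01 one_ne_zero
  have hT1 := hT.map_ne_one hφ
  -- Everything reached lifts to the centralizer of the companion matrix: a noncentral element there
  -- is again irreducible and has the same centralizer.
  have hreach : ∀ w, Relation.ReflTransGen (engelGraph 2 PSL(3, F)).Adj
      ⟨φ (companionSL F), hI _ hC1⟩ w → ∃ Y, φ Y = w.1 ∧ Commute Y (companionSL F) := by
    intro w hw'
    induction hw' with
    | refl => exact ⟨_, rfl, Commute.refl _⟩
    | @tail b c _ hbc ih =>
      obtain ⟨X, hX, hXC⟩ := ih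
      obtain ⟨Y, hY⟩ := QuotientGroup.mk'_surjective _ c.1
      have hX1 : φ X ≠ 1 := hX ▸ ne_one_of_notMem_biEngelSet two_ne_zero b.2
      have hY1 : φ Y ≠ 1 := hY ▸ ne_one_of_notMem_biEngelSet two_ne_zero c.2
      have hXi : ¬ IsReducible X := fun h => hX1 ((map_eq_one_iff_scalar hφ).2
        (exists_smul_one_of_isReducible_of_commute hC hXC h))
      have hadj : engelWord 2 b.1 c.1 = 1 := hbc
      rw [engelWord_two_eq_one_iff, ← hX, ← hY] at hadj
      have hYX := commute_of_commute_conj h4 hw hφ hXi hY1 (by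
        rw [map_mul, map_mul, map_inv]
        exact hadj)
      exact ⟨Y, hY, commute_of_commute_irreducible hXi hYX hXC.symm⟩
  obtain ⟨Y, hY, hYC⟩ := hreach _ (hsc ⟨_, hI _ hC1⟩ ⟨_, hI _ hT1⟩)
  have hY1 : φ Y ≠ 1 := hY ▸ hT1
  obtain ⟨r, hr⟩ := (map_eq_map_iff_smul hφ).1 hY
  refine hY1 ((map_eq_one_iff_scalar hφ).2
    (exists_smul_one_of_isReducible_of_commute hC hYC ⟨Pi.single 0 1, by simp, r, ?_⟩))
  rw [hr, smul_mulVec, coe_root, add_mulVec, one_mulVec, smul_mulVec, vecMulVec_mulVec]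
  simp

end FieldFour

end EngelGraphs

namespace EngelGraphs

open Matrix

/-! ### Outer elements as exits from irreducible elements when q = 4. -/

section OuterAutomorphisms

variable {F : Type*} [Field F] {G : Type*} [Group G]

/-- The element `x` has an arc to a nontrivial element commuting with an involution of the image
of `SL(3, F)`. -/
def ReachesInvol (φ : SL(3, F) →* G) (x : G) : Prop :=
  ∃ y : G, y ≠ 1 ∧ Commute y (x⁻¹ * y * x) ∧ ∃ T, IsInvol T ∧ Commute y (φ T)

lemma ReachesInvol.of_inv {φ : SL(3, F) →* G} {x : G} (h : ReachesInvol φ x⁻¹) :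
    ReachesInvol φ x := by
  obtain ⟨y, hy, hc, hT⟩ := h
  rw [inv_inv] at hc
  exact ⟨y, hy, commute_conj_inv hc, hT⟩

lemma ReachesInvol.of_comp_conjGL {φ : SL(3, F) →* G} {x : G} {P : GL (Fin 3) F}
    (h : ReachesInvol (φ.comp (conjGL P)) x) : ReachesInvol φ x := by
  obtain ⟨y, hy, hc, T, hT, hyT⟩ := h
  exact ⟨y, hy, hc, conjGL P T, hT.map_injective _ (conjGL_injective P), hyT⟩

lemma exists_conjGL_eq {P : GL (Fin 3) F} (hP : P.1.det = 1) :
    ∃ Q : SL(3, F), Q.1 = P.1 ∧ ∀ A, conjGL P A = Q * A * Q⁻¹ := by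
  obtain ⟨Q, hQ⟩ : ∃ Q : SL(3, F), Q.1 = P.1 := ⟨⟨P.1, hP⟩, rfl⟩
  refine ⟨Q, hQ, fun A => Eq.symm ?_⟩
  rw [eq_conjGL_iff, ← hQ, ← Matrix.SpecialLinearGroup.coe_mul,
    ← Matrix.SpecialLinearGroup.coe_mul, inv_mul_cancel_right]

/-- The entries lie in the prime field, which is why this irreducible matrix is the model. -/
lemma map_companionSL (f : F →+* F) :
    Matrix.SpecialLinearGroup.map f (companionSL F) = companionSL F := by
  apply coe_injective
  rw [Matrix.SpecialLinearGroup.map_apply_coe, coe_companionSL]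
  ext i j
  fin_cases i <;> fin_cases j <;> simp

lemma map_root (f : F →+* F) {i j : Fin 3} (hij : i ≠ j) (c : F) :
    Matrix.SpecialLinearGroup.map f (root hij c) = root hij (f c) := by
  apply coe_injective
  rw [Matrix.SpecialLinearGroup.map_apply_coe, Matrix.SpecialLinearGroup.transvection_coe,
    Matrix.SpecialLinearGroup.transvection_coe, map_add, map_one]
  congr 1
  exact map_single _ _ _ f

lemma dualSL_eq_of_mul {A B : SL(3, F)} (h : B.1ᵀ * A.1 = 1) : dualSL A = B := by
  apply coe_injective
  rw [coe_dualSL, ← transpose_transpose B.1]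
  congr 1
  rw [← one_mul (A⁻¹ : SL(3, F)).1, ← h, mul_assoc, coe_mul_inv, mul_one]

lemma dualSL_map (f : F →+* F) (A : SL(3, F)) :
    dualSL (Matrix.SpecialLinearGroup.map f A) = Matrix.SpecialLinearGroup.map f (dualSL A) := by
  apply dualSL_eq_of_mul
  have : (Matrix.SpecialLinearGroup.map f (dualSL A)).1ᵀ =
      (Matrix.SpecialLinearGroup.map f A⁻¹).1 := rfl
  rw [this, map_inv, coe_inv_mul]

lemma map_conjGL (f : F →+* F) (P : GL (Fin 3) F) (A : SL(3, F)) :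
    Matrix.SpecialLinearGroup.map f (conjGL P A) =
      conjGL (Matrix.GeneralLinearGroup.map f P) (Matrix.SpecialLinearGroup.map f A) := by
  apply coe_injective
  rw [coe_conjGL, Matrix.SpecialLinearGroup.map_apply_coe, coe_conjGL, map_mul, map_mul, ← map_inv]
  rfl

lemma commute_mul_conj {y x : G} {e : G} (h : x * y * x⁻¹ = e * y) (he : y * e * y⁻¹ = e) :
    Commute y (x⁻¹ * y * x) := by
  apply commute_conj_inv
  rw [h]
  have : y * e = e * y := by
    calc y * e = (y * e * y⁻¹) * y := by group
      _ = e * y := by rw [he]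
  exact Commute.mul_right this (Commute.refl y)

lemma det_inv_GL (P : GL (Fin 3) F) : (P⁻¹ : GL (Fin 3) F).1.det = P.1.det⁻¹ := by
  apply eq_inv_of_mul_eq_one_left
  rw [← det_mul, ← Units.val_mul, inv_mul_cancel, Units.val_one, det_one]

lemma det_map_GL (f : F →+* F) (P : GL (Fin 3) F) :
    (Matrix.GeneralLinearGroup.map f P).1.det = f P.1.det := by
  rw [RingHom.map_det]
  rfl

lemma det_dualGL (P : GL (Fin 3) F) : (dualGL P).1.det = P.1.det⁻¹ := by
  rw [← det_inv_GL, ← det_transpose (P⁻¹ : GL (Fin 3) F).1]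
  rfl

variable [CharP F 2] {φ : SL(3, F) →* G}

/-- Field automorphisms commute with the companion matrix. -/
lemma reachesInvol_of_field {g : G} (hg : g ∉ φ.range) {P : GL (Fin 3) F} (hP : P.1.det = 1)
    {f : F →+* F}
    (h : ∀ A, g * φ A * g⁻¹ = φ (conjGL P (Matrix.SpecialLinearGroup.map f A))) :
    ReachesInvol φ (φ (companionSL F)) := by
  obtain ⟨Q, -, hQ⟩ := exists_conjGL_eq hP
  have hk : ∀ A, Matrix.SpecialLinearGroup.map f A = A → Commute ((φ Q)⁻¹ * g) (φ A) := by
    intro A hA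
    have h1 := h A
    rw [hA, hQ, map_mul, map_mul, map_inv] at h1
    calc (φ Q)⁻¹ * g * φ A = (φ Q)⁻¹ * (g * φ A * g⁻¹) * g := by group
      _ = φ A * ((φ Q)⁻¹ * g) := by rw [h1]; group
  have n02 : (0 : Fin 3) ≠ 2 := by decide
  have hc := hk _ (map_companionSL f)
  -- This element acts on the image of SL(3, F) as the field automorphism f, so it centralizes the
  -- images of the companion matrix and of x_02(1).
  refine ⟨(φ Q)⁻¹ * g, ?_, ?_, root n02 1, isInvol_root n02 one_ne_zero, hk _ ?_⟩
  · intro h1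
    exact hg ⟨Q, inv_mul_eq_one.1 h1⟩
  · rw [mul_assoc, hc.eq, inv_mul_cancel_left]
  · rw [map_root, map_one]

/-- Automorphisms involving the inverse transpose. -/
lemma reachesInvol_of_dual {g : G} (hg : g ∉ φ.range) {P : GL (Fin 3) F} (hP : P.1.det = 1)
    {f : F →+* F}
    (h : ∀ A, g * φ A * g⁻¹ = φ (conjGL P (dualSL (Matrix.SpecialLinearGroup.map f A)))) :
    ReachesInvol φ (φ (companionSL F)) := by
  obtain ⟨Q, -, hQ⟩ := exists_conjGL_eq hP
  have hk : ∀ A, (φ Q)⁻¹ * g * φ A =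
      φ (dualSL (Matrix.SpecialLinearGroup.map f A)) * ((φ Q)⁻¹ * g) := by
    intro A
    have h1 := h A
    rw [hQ, map_mul, map_mul, map_inv] at h1
    calc (φ Q)⁻¹ * g * φ A = (φ Q)⁻¹ * (g * φ A * g⁻¹) * g := by group
      _ = _ := by rw [h1]; group
  have hneg : (-1 : F) = 1 := CharTwo.neg_eq 1
  have htwo : (1 + 1 : F) = 0 := CharTwo.add_self_eq_zero 1
  -- Let k = φ(Q)⁻¹g, which acts as f followed by inverse transpose. The exit is y = φ(S0)k, and its
  -- conjugate by the companion matrix is φ(S1)k. The identity `m2` says that these commute, and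
  -- `m3` that y commutes with x_12(1).
  let S0 : SL(3, F) := ⟨!![1, 0, 0; 0, 1, 1; 0, 1, 0], by simp [det_fin_three, hneg]⟩
  let S1 : SL(3, F) := ⟨!![0, 1, 1; 1, 0, 0; 1, 0, 1], by simp [det_fin_three, hneg]⟩
  let D0 : SL(3, F) := ⟨!![1, 0, 0; 0, 0, 1; 0, 1, 1], by simp [det_fin_three, hneg]⟩
  let D1 : SL(3, F) := ⟨!![0, 1, 0; 1, 1, 1; 0, 1, 1], by simp [det_fin_three, hneg]⟩
  let C : SL(3, F) := ⟨!![1, 0, 1; 1, 0, 0; 0, 1, 0], by simp [det_fin_three]⟩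
  have hmap : ∀ A : SL(3, F), (∀ i j, A.1 i j = 0 ∨ A.1 i j = 1) →
      Matrix.SpecialLinearGroup.map f A = A := by
    intro A hA
    apply coe_injective
    rw [Matrix.SpecialLinearGroup.map_apply_coe]
    ext i j
    rcases hA i j with h | h <;> simp [h]
  have hS0 : Matrix.SpecialLinearGroup.map f S0 = S0 := hmap _ (by
    intro i j
    fin_cases i <;> fin_cases j <;> simp [S0])
  have hS1 : Matrix.SpecialLinearGroup.map f S1 = S1 := hmap _ (by
    intro i j
    fin_cases i <;> fin_cases j <;> simp [S1])
  have e0 : dualSL S0 = D0 := dualSL_eq_of_mul (by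
    ext i j
    fin_cases i <;> fin_cases j <;> simp [S0, D0, Matrix.mul_apply, Fin.sum_univ_three, htwo])
  have e1 : dualSL S1 = D1 := dualSL_eq_of_mul (by
    ext i j
    fin_cases i <;> fin_cases j <;> simp [S1, D1, Matrix.mul_apply, Fin.sum_univ_three, htwo])
  have eC : dualSL (companionSL F) = C := dualSL_eq_of_mul (by
    ext i j
    fin_cases i <;> fin_cases j <;>
      simp [coe_companionSL, C, Matrix.mul_apply, Fin.sum_univ_three, htwo])
  have m1 : S0 * C = companionSL F * S1 := coe_injective (by
    rw [Matrix.SpecialLinearGroup.coe_mul, Matrix.SpecialLinearGroup.coe_mul, coe_companionSL]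
    ext i j
    fin_cases i <;> fin_cases j <;> simp [S0, S1, C, Matrix.mul_apply, Fin.sum_univ_three, htwo])
  have m2 : S0 * D1 = S1 * D0 := coe_injective (by
    rw [Matrix.SpecialLinearGroup.coe_mul, Matrix.SpecialLinearGroup.coe_mul]
    ext i j
    fin_cases i <;> fin_cases j <;>
      simp [S0, S1, D0, D1, Matrix.mul_apply, Fin.sum_univ_three, htwo])
  have n12 : (1 : Fin 3) ≠ 2 := by decide
  have m3 : S0 * root n12.symm 1 = root n12 1 * S0 := coe_injective (by
    rw [Matrix.SpecialLinearGroup.coe_mul, Matrix.SpecialLinearGroup.coe_mul,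
      Matrix.SpecialLinearGroup.transvection_coe, Matrix.SpecialLinearGroup.transvection_coe]
    ext i j
    fin_cases i <;> fin_cases j <;>
      simp [S0, Matrix.mul_apply, Fin.sum_univ_three, htwo, single_apply])
  generalize S0 = S0 at *
  obtain ⟨k, hkdef⟩ : ∃ k, k = (φ Q)⁻¹ * g := ⟨_, rfl⟩
  rw [← hkdef] at hk
  have hconj : (φ (companionSL F))⁻¹ * (φ S0 * k) * φ (companionSL F) = φ S1 * k := by
    rw [mul_assoc, mul_assoc (φ S0), hk, map_companionSL, eC, ← mul_assoc (φ S0), ← map_mul, m1,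
      map_mul]
    group
  refine ⟨φ S0 * k, ?_, ?_, root n12 1, isInvol_root n12 one_ne_zero, ?_⟩
  · intro h1
    apply hg
    refine ⟨Q * S0⁻¹, ?_⟩
    rw [map_mul, map_inv, ← eq_inv_of_mul_eq_one_right h1, hkdef, mul_inv_cancel_left]
  · rw [hconj]
    calc φ S0 * k * (φ S1 * k) = φ S0 * (k * φ S1) * k := by simp only [mul_assoc]
      _ = φ (S0 * D1) * k * k := by rw [hk, hS1, e1, map_mul]; simp only [mul_assoc]
      _ = φ S1 * (k * φ S0) * k := by
        rw [hk, hS0, e0, m2, map_mul]; simp only [mul_assoc]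
      _ = φ S1 * k * (φ S0 * k) := by simp only [mul_assoc]
  · calc φ S0 * k * φ (root n12 1) = φ S0 * (k * φ (root n12 1)) := mul_assoc _ _ _
      _ = φ (S0 * root n12.symm 1) * k := by
        rw [hk, map_root, map_one, dualSL_root, hneg, map_mul, mul_assoc]
      _ = φ (root n12 1) * (φ S0 * k) := by rw [m3, map_mul, mul_assoc]

/-- Diagonal automorphisms. -/
lemma reachesInvol_of_diagonal (hφ : φ.ker = Subgroup.center SL(3, F)) {g : G} {P : GL (Fin 3) F}
    (hP : P.1.det ≠ 1) (h : ∀ A, g * φ A * g⁻¹ = φ (conjGL P A)) :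
    ReachesInvol φ (φ (companionSL F)) := by
  have hP0 : P.1.det ≠ 0 := (P.isUnit.map detMonoidHom).ne_zero
  have hd : ∀ i, (![1, P.1.det, 1] : Fin 3 → F) i ≠ 0 := by
    intro i
    fin_cases i
    · exact one_ne_zero
    · exact hP0
    · exact one_ne_zero
  -- Since D has the determinant of P, multiplying g by an element of the image makes it act as
  -- conjugation by D. This D commutes with its conjugate by the companion matrix
  -- (`exists_commute_diagonal`), centralizes x_02(1), and moves x_01(1) because det P ≠ 1.
  set D := diagGL ![1, P.1.det, 1] hd with hD
  have hDdet : D.1.det = P.1.det := by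
    change (diagonal ![1, P.1.det, 1]).det = _
    rw [det_diagonal, Fin.prod_univ_three]
    simp
  obtain ⟨Q, -, hQ⟩ := exists_conjGL_eq (P := D * P⁻¹) (by
    rw [Units.val_mul, det_mul, hDdet, ← det_mul, ← Units.val_mul, mul_inv_cancel, Units.val_one,
      det_one])
  have hy : ∀ A, φ Q * g * φ A = φ (conjGL D A) * (φ Q * g) := by
    intro A
    have h1 : conjGL D A = Q * conjGL P A * Q⁻¹ := by
      rw [← hQ, ← conjGL_mul, inv_mul_cancel_right]
    rw [h1, map_mul, map_mul, ← h, map_inv]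
    group
  obtain ⟨y, hydef⟩ : ∃ y, y = φ Q * g := ⟨_, rfl⟩
  rw [← hydef] at hy
  have n01 : (0 : Fin 3) ≠ 1 := by decide
  have n02 : (0 : Fin 3) ≠ 2 := by decide
  refine ⟨y, ?_, ?_, root n02 1, isInvol_root n02 one_ne_zero, ?_⟩
  · intro h1
    have h2 := hy (root n01 1)
    rw [h1, one_mul, mul_one, conjGL_diagGL_root] at h2
    have h3 := root_injective_map hφ n01 h2
    simp at h3
    exact hP h3
  · obtain ⟨M, hM1, hM2⟩ := exists_commute_diagonal (1 : F) 0 1 P.1.det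
    rw [← coe_companionSL] at hM1
    have hM : M = (companionSL F).1 * D.1 * ((companionSL F)⁻¹ : SL(3, F)).1 := by
      change _ = (companionSL F).1 * diagonal _ * _
      rw [← hM1, mul_assoc, coe_mul_inv, mul_one]
    refine commute_mul_conj (e := φ (companionSL F * conjGL D (companionSL F)⁻¹)) ?_ ?_
    · rw [mul_assoc, ← map_inv, hy, map_mul, mul_assoc]
    · rw [hy, mul_inv_cancel_right]
      congr 1
      symm
      rw [eq_conjGL_iff, Matrix.SpecialLinearGroup.coe_mul, coe_conjGL]
      have h5 : (companionSL F).1 * (D.1 * ((companionSL F)⁻¹ : SL(3, F)).1 *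
          (D⁻¹ : GL (Fin 3) F).1) = M * (D⁻¹ : GL (Fin 3) F).1 := by
        rw [hM]
        simp only [mul_assoc]
      rw [h5, mul_assoc, ← Units.val_mul, inv_mul_cancel, Units.val_one, mul_one, ← mul_assoc]
      have h6 : D.1 * M = M * D.1 := hM2.symm
      rw [h6, mul_assoc, ← Units.val_mul, mul_inv_cancel, Units.val_one, mul_one]
  · change _ * _ = _ * _
    rw [hy, conjGL_diagGL_root]
    simp

/-- The companion matrix commutes with elements of all determinants. -/
lemma exists_commute_companionSL (h4 : ∀ a : F, a ≠ 0 → a ^ 3 = 1) {e : F} (he : e ≠ 0) :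
    ∃ Z : GL (Fin 3) F, Z.1.det = e ∧ conjGL Z (companionSL F) = companionSL F := by
  have h2 : (2 : F) = 0 := CharTwo.two_eq_zero
  -- The determinant is e³ + e + 1, which is e because e³ = 1 and 2 = 0.
  have hdet : ((companionSL F).1 + e • 1).det = e := by
    have h3 := h4 e he
    rw [coe_companionSL]
    simp [det_fin_three]
    linear_combination h3 + (1 - e) * h2
  obtain ⟨Z, hZ⟩ := (isUnit_iff_isUnit_det _).2 (by
    rw [hdet]
    exact isUnit_iff_ne_zero.2 he : IsUnit ((companionSL F).1 + e • 1).det)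
  refine ⟨Z, by rw [hZ, hdet], Eq.symm ?_⟩
  rw [eq_conjGL_iff, hZ, mul_add, add_mul, mul_smul_comm, smul_mul_assoc, mul_one, one_mul]

/-- The image of w is again a root of λ² + λ + 1, so it is w or w². -/
lemma eq_or_eq_of_ringHom (h4 : ∀ a : F, a ≠ 0 → a ^ 3 = 1) {w : F} (hw : w ^ 2 = w + 1)
    (f : F →+* F) : (∀ a, f a = a) ∨ ∀ a, f a = a ^ 2 := by
  have h2 : (2 : F) = 0 := CharTwo.two_eq_zero
  have hw0 : w ≠ 0 := by
    rintro rfl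
    simp at hw
  have hcases : ∀ a : F, a = 0 ∨ a = 1 ∨ a = w ∨ a = w ^ 2 := by
    intro a
    by_cases ha : a = 0
    · exact Or.inl ha
    · right
      have : (a - 1) * ((a - w) * (a - w ^ 2)) = 0 := by
        linear_combination h4 a ha - (a ^ 2 - a) * (hw + (w + 1) * h2) + (a - 1) * h4 w hw0
      rcases mul_eq_zero.1 this with h | h
      · exact Or.inl (sub_eq_zero.1 h)
      rcases mul_eq_zero.1 h with h | h
      · exact Or.inr (Or.inl (sub_eq_zero.1 h))
      · exact Or.inr (Or.inr (sub_eq_zero.1 h))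
  have hfw : (f w - w) * (f w - w ^ 2) = 0 := by
    have h3 : f w ^ 2 = f w + 1 := by rw [← map_pow, hw, map_add, map_one]
    linear_combination h3 - (f w + 1) * (hw + (w + 1) * h2) + h4 w hw0
      + (f w + 1) * h2 + hw + (w + 1) * h2
  rcases mul_eq_zero.1 hfw with h | h
  · left
    intro a
    rcases hcases a with rfl | rfl | rfl | rfl
    · exact map_zero f
    · exact map_one f
    · exact sub_eq_zero.1 h
    · rw [map_pow, sub_eq_zero.1 h]
  · right
    intro a
    rcases hcases a with rfl | rfl | rfl | rfl
    · simp
    · simp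
    · exact sub_eq_zero.1 h
    · rw [map_pow, sub_eq_zero.1 h]

/-- Every outer automorphism of `PSL(3, 4)` connects the companion matrix to an involution. -/
theorem reachesInvol_companionSL (h4 : ∀ a : F, a ≠ 0 → a ^ 3 = 1) {w : F} (hw : w ^ 2 = w + 1)
    (hφ : φ.ker = Subgroup.center SL(3, F)) (hN : φ.range.Normal) {g : G} (hg : g ∉ φ.range) :
    ReachesInvol φ (φ (companionSL F)) := by
  let ρ : SL(3, F) →* G := (MulAut.conj g).toMonoidHom.comp φ
  have hρA : ∀ A, ρ A = g * φ A * g⁻¹ := fun A => rfl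
  have hρ : ρ.ker = Subgroup.center SL(3, F) := by
    rw [← hφ]
    ext A
    rw [MonoidHom.mem_ker, MonoidHom.mem_ker, hρA, conj_eq_one_iff]
  have hr : ρ.range ≤ φ.range := by
    rintro x ⟨A, rfl⟩
    exact hN.conj_mem _ ⟨A, rfl⟩ g
  obtain ⟨P, f, h⟩ := exists_semilinear hφ hρ hr
  have hδ0 : P.1.det ≠ 0 := (P.isUnit.map detMonoidHom).ne_zero
  -- Let δ = det P. Changing basis by Z, of determinant δ⁻¹, leaves the companion matrix alone but
  -- twists P. In the mixed cases this makes the determinant 1: δ·δ·δ⁻² for Frobenius, δ³ for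
  -- inverse transpose alone.
  obtain ⟨Z, hZ, hZC⟩ := exists_commute_companionSL h4 (inv_ne_zero hδ0)
  have hgZ : g ∉ (φ.comp (conjGL Z)).range := by
    rintro ⟨A, hA⟩
    exact hg ⟨_, hA⟩
  have hgood : ReachesInvol (φ.comp (conjGL Z)) (φ.comp (conjGL Z) (companionSL F)) →
      ReachesInvol φ (φ (companionSL F)) := by
    intro h
    rw [MonoidHom.comp_apply, hZC] at h
    exact h.of_comp_conjGL
  have hZinv : ∀ A, conjGL Z (conjGL Z⁻¹ A) = A := fun A => by
    rw [← conjGL_mul, mul_inv_cancel, conjGL_one]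
  rcases h with h | h
  · by_cases hP : P.1.det = 1
    · exact reachesInvol_of_field hg hP (f := f) h
    rcases eq_or_eq_of_ringHom h4 hw f with hf | hf
    · have hid : f = RingHom.id F := RingHom.ext hf
      subst hid
      exact reachesInvol_of_diagonal hφ hP (g := g) h
    · apply hgood
      refine reachesInvol_of_field hgZ (P := Z⁻¹ * P * Matrix.GeneralLinearGroup.map f Z) ?_
        (f := f) ?_
      · rw [Units.val_mul, Units.val_mul, det_mul, det_mul, det_inv_GL, det_map_GL, hf, hZ]
        field_simp
      · intro A
        rw [MonoidHom.comp_apply, ← hρA, h, map_conjGL, MonoidHom.comp_apply, conjGL_mul,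
          conjGL_mul, hZinv]
  · have h' : ∀ A, g * φ A * g⁻¹ = φ (conjGL P (dualSL (Matrix.SpecialLinearGroup.map f A))) := by
      intro A
      rw [dualSL_map, ← h, dualSL_dualSL]
      rfl
    by_cases hP : P.1.det = 1
    · exact reachesInvol_of_dual hg hP h'
    rcases eq_or_eq_of_ringHom h4 hw f with hf | hf
    · apply hgood
      refine reachesInvol_of_dual hgZ (P := Z⁻¹ * P * dualGL (Matrix.GeneralLinearGroup.map f Z)) ?_
        (f := f) ?_
      · have h3 := h4 _ hδ0
        rw [Units.val_mul, Units.val_mul, det_mul, det_mul, det_inv_GL, det_dualGL, det_map_GL, hf,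
          hZ, inv_inv]
        linear_combination h3
      · intro A
        rw [MonoidHom.comp_apply, h', map_conjGL, MonoidHom.comp_apply, conjGL_mul,
          conjGL_mul, hZinv, dualSL_conjGL]
    -- With both Frobenius and inverse transpose, twisting preserves δ. Instead g² acts linearly, by
    -- a matrix of determinant δ·δ⁻² = δ⁻¹ ≠ 1.
    · refine reachesInvol_of_diagonal hφ (g := g * g)
        (P := P * dualGL (Matrix.GeneralLinearGroup.map f P)) ?_ fun A => ?_
      · rw [Units.val_mul, det_mul, det_dualGL, det_map_GL, hf]
        intro h
        apply hP
        field_simp at h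
        exact h.symm
      · have hff : ∀ A : SL(3, F), Matrix.SpecialLinearGroup.map f
            (Matrix.SpecialLinearGroup.map f A) = A := by
          intro A
          apply coe_injective
          ext i j
          change f (f (A.1 i j)) = A.1 i j
          rw [hf, hf]
          by_cases h0 : A.1 i j = 0
          · rw [h0]
            simp
          · calc (A.1 i j ^ 2) ^ 2 = A.1 i j ^ 3 * A.1 i j := by ring
              _ = A.1 i j := by rw [h4 _ h0, one_mul]
        calc g * g * φ A * (g * g)⁻¹ = g * (g * φ A * g⁻¹) * g⁻¹ := by group
          _ = _ := by
            rw [h', h', map_conjGL, dualSL_conjGL, dualSL_map f, dualSL_dualSL, hff, conjGL_mul]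

end OuterAutomorphisms

end EngelGraphs

namespace EngelGraphs

open Matrix

/-! ### Reduction of irreducible matrices to the companion matrix. -/

section FieldFour

universe u

variable {F : Type u} [Field F]

/-- Scaling by c, a cube root of unity, turns λ³ - cλ - 1 into λ³ - λ - 1. -/
lemma exists_smul_eq_companion (h4 : ∀ a : F, a ≠ 0 → a ^ 3 = 1) {C : SL(3, F)} {c : F}
    (hc : c ≠ 0) (hC : C.1 = !![0, 0, 1; 1, 0, c; 0, 1, 0]) :
    ∃ P : GL (Fin 3) F, (C.1 * P.1) * (c • 1) = P.1 * (companionSL F).1 := by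
  have h3 := h4 c hc
  refine ⟨diagGL ![1, c, c ^ 2] ?_, ?_⟩
  · intro i
    fin_cases i
    · exact one_ne_zero
    · exact hc
    · exact pow_ne_zero 2 hc
  · change C.1 * diagonal _ * _ = diagonal _ * _
    rw [hC, coe_companionSL, mul_smul_comm, mul_one]
    ext i j
    simp only [Matrix.smul_apply, mul_diagonal, diagonal_mul, smul_eq_mul]
    fin_cases i <;> fin_cases j <;> simp
    · linear_combination h3
    · linear_combination c * h3
    · ring

variable [CharP F 2] {G : Type*} [Group G] {φ : SL(3, F) →* G}

/-- Inversion replaces the characteristic polynomial by its reciprocal, moving the coefficient d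
from λ² to λ; scaling by d then normalizes it. -/
lemma exists_smul_inv_eq_companion (h4 : ∀ a : F, a ≠ 0 → a ^ 3 = 1) {C : SL(3, F)} {d : F}
    (hd : d ≠ 0) (hC : C.1 = !![0, 0, 1; 1, 0, 0; 0, 1, d]) :
    ∃ P : GL (Fin 3) F, ((C⁻¹ : SL(3, F)).1 * P.1) * (d • 1) = P.1 * (companionSL F).1 := by
  have h3 := h4 d hd
  have h2 : (2 : F) = 0 := CharTwo.two_eq_zero
  have hdet : (!![0, 0, d ^ 2; 0, d, 0; 1, 0, 0] : Matrix (Fin 3) (Fin 3) F).det = -1 := by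
    simp [det_fin_three]
    linear_combination h3
  obtain ⟨P, hP⟩ := (isUnit_iff_isUnit_det _).2 (by
    rw [hdet]
    exact isUnit_one.neg : IsUnit (!![0, 0, d ^ 2; 0, d, 0; 1, 0, 0] :
      Matrix (Fin 3) (Fin 3) F).det)
  refine ⟨P, ?_⟩
  have key : P.1 * (d • 1) = C.1 * (P.1 * (companionSL F).1) := by
    rw [hP, hC, coe_companionSL, mul_smul_comm, mul_one]
    ext i j
    fin_cases i <;> fin_cases j <;>
      simp [Matrix.mul_apply, Fin.sum_univ_three]
    · linear_combination h3
    · ring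
    · linear_combination -(d * h2)
  rw [mul_assoc, key, ← mul_assoc, coe_inv_mul, one_mul]

/-- Up to scalars and inversion, every irreducible matrix over the field with four elements is
conjugate to the companion matrix of `T³ + T + 1`. -/
lemma exists_map_eq_companionSL (h4 : ∀ a : F, a ≠ 0 → a ^ 3 = 1)
    (hφ : φ.ker = Subgroup.center SL(3, F)) {X : SL(3, F)} (hX : ¬ IsReducible X) :
    ∃ P : GL (Fin 3) F, φ X = φ (conjGL P (companionSL F)) ∨
      φ X⁻¹ = φ (conjGL P (companionSL F)) := by
  have h2 : (2 : F) = 0 := CharTwo.two_eq_zero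
  obtain ⟨P, C, c, d, hC, hXC⟩ := exists_eq_companion hX
  have hirr : ∀ l : F, l ^ 3 ≠ d * l ^ 2 + c * l + 1 := by
    intro l hl
    apply hX
    have hCv : C.1 *ᵥ ![1, l ^ 2 - d * l, l] = l • ![1, l ^ 2 - d * l, l] := by
      rw [hC]
      funext i
      fin_cases i
      · simp [mulVec, dotProduct, Fin.sum_univ_three]
      · simp [mulVec, dotProduct, Fin.sum_univ_three]
        linear_combination -hl
      · simp [mulVec, dotProduct, Fin.sum_univ_three]
        ring
    have hne : (![1, l ^ 2 - d * l, l] : Fin 3 → F) ≠ 0 := fun h0 => by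
      have := congrFun h0 0
      simp at this
    refine ⟨P.1 *ᵥ ![1, l ^ 2 - d * l, l], fun h0 => hne ?_, l, ?_⟩
    · rw [← one_mulVec ![1, l ^ 2 - d * l, l], ← Units.val_one, ← inv_mul_cancel P, Units.val_mul,
        ← mulVec_mulVec, h0, mulVec_zero]
    · rw [mulVec_mulVec, eq_conjGL_iff.1 hXC, ← mulVec_mulVec, hCv, mulVec_smul]
  have conclude : ∀ (A B : SL(3, F)) (r : F) (Q : GL (Fin 3) F), r ≠ 0 →
      (A.1 * Q.1) * (r • 1) = Q.1 * B.1 → φ (conjGL P A) = φ (conjGL (P * Q) B) := by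
    intro A B r Q hr hAB
    have e1 : scaleSL r (h4 r hr) A = conjGL Q B := by
      rw [eq_conjGL_iff, ← hAB, coe_scaleSL, mul_smul_comm, mul_one, smul_mul_assoc]
    rw [conjGL_mul, ← e1]
    exact (map_scaleSL (ker_comp_conjGL hφ P) r (h4 r hr) A).symm
  by_cases hc : c = 0
  · have hd : d ≠ 0 := by
      rintro rfl
      exact hirr 1 (by rw [hc]; ring)
    obtain ⟨Q, hQ⟩ := exists_smul_inv_eq_companion h4 hd (by rw [hC, hc])
    exact ⟨P * Q, Or.inr (by rw [hXC, ← map_inv (conjGL P), conclude _ _ d Q hd hQ])⟩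
  · have hd : d = 0 := by
      by_contra hd
      apply hirr (c / d)
      rw [h4 _ (div_ne_zero hc hd)]
      field_simp
      linear_combination -(c ^ 2 * h2)
    obtain ⟨Q, hQ⟩ := exists_smul_eq_companion h4 hc (by rw [hC, hd])
    exact ⟨P * Q, Or.inl (by rw [hXC, conclude _ _ c Q hc hQ])⟩

/-- An outer element serves every conjugate of the companion matrix, because `φ` composed with a
conjugation has the same range. Inversion is harmless: X and X⁻¹ have the same outgoing arcs. -/
theorem engelPath_to_isInvol_of_range_ne_top (hF : Nat.card F = 4)
    (hφ : φ.ker = Subgroup.center SL(3, F)) (hN : φ.range.Normal) (hne : φ.range ≠ ⊤)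
    {X T : SL(3, F)} (hX1 : φ X ≠ 1) (hT : IsInvol T) : EngelPath 2 (φ X) (φ T) := by
  have : Finite F := Nat.finite_of_card_ne_zero (by rw [hF]; norm_num)
  have h4 := pow_three_eq_one_of_card hF
  obtain ⟨w, hw⟩ := exists_sq_eq_add_one hF
  by_cases hX : IsReducible X
  · exact engelPath_of_isReducible hφ hX hX1 hT
  obtain ⟨g, hg⟩ : ∃ g, g ∉ φ.range := by
    by_contra! h
    exact hne (eq_top_iff.2 fun g _ => h g)
  have hgood : ∀ P : GL (Fin 3) F, ReachesInvol φ (φ (conjGL P (companionSL F))) := by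
    intro P
    have hr : (φ.comp (conjGL P)).range = φ.range := by
      ext x
      constructor
      · rintro ⟨A, rfl⟩
        exact ⟨_, rfl⟩
      · rintro ⟨A, rfl⟩
        obtain ⟨B, rfl⟩ := conjGL_surjective P A
        exact ⟨B, rfl⟩
    exact (reachesInvol_companionSL h4 hw (ker_comp_conjGL hφ P) (hr ▸ hN)
      (hr ▸ hg)).of_comp_conjGL
  have hreach : ReachesInvol φ (φ X) := by
    obtain ⟨P, h | h⟩ := exists_map_eq_companionSL h4 hφ hX
    · exact h ▸ hgood P
    · apply ReachesInvol.of_inv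
      rw [← map_inv, h]
      exact hgood P
  obtain ⟨y, hy, hc, U, hU, hyU⟩ := hreach
  exact ((EngelPath.of_commute_conj hX1 hy hc).trans
    (EngelPath.of_commute hy (hU.map_ne_one hφ) hyU)).trans (engelPath_of_isInvol hφ hU hT)

end FieldFour

/-! ### All involutions of SL(3, F) are conjugate. -/

section Fusion

variable {F : Type*} [Field F]

lemma IsInvol.exists_conj_root [CharP F 2] {T : SL(3, F)} (hT : IsInvol T)
    (h02 : (0 : Fin 3) ≠ 2) : ∃ M : SL(3, F), T = M * root h02 1 * M⁻¹ := by
  obtain ⟨a, f, h, ha, hf, rfl⟩ := hT.exists_eq_tv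
  have hex : ∀ x : Fin 3 → F, x ≠ 0 → ∃ u : Fin 3 → F, x ⬝ᵥ u = 1 := by
    intro x hx
    obtain ⟨i, hi⟩ := Function.ne_iff.1 hx
    exact ⟨Pi.single i (x i)⁻¹, by rw [dotProduct_single, mul_inv_cancel₀ hi]⟩
  obtain ⟨u, hu⟩ := hex a ha
  obtain ⟨c, hc⟩ := hex f hf
  -- As a·u = 1 and f·a = 0, the triple product is f. Hence the columns a, f × u, c have determinant
  -- f·c = 1.
  have hab : a ⨯₃ (f ⨯₃ u) = f := by
    rw [cross_cross_eq_smul_sub_smul', hu, one_smul, h, zero_smul, sub_zero]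
  have hdet : ((Matrix.of ![a, f ⨯₃ u, c])ᵀ).det = 1 := by
    rw [det_transpose]
    have : (Matrix.of ![a, f ⨯₃ u, c]).det = (a ⨯₃ (f ⨯₃ u)) ⬝ᵥ c := by
      generalize f ⨯₃ u = b
      simp [det_fin_three, cross_apply, dotProduct, Fin.sum_univ_three]
      ring
    rw [this, hab, hc]
  obtain ⟨M, hM⟩ : ∃ M : SL(3, F), M.1 = (Matrix.of ![a, f ⨯₃ u, c])ᵀ := ⟨⟨_, hdet⟩, rfl⟩
  refine ⟨M, eq_mul_inv_of_mul_eq (coe_injective ?_)⟩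
  have e1 : M.1 *ᵥ Pi.single 0 1 = a := by
    rw [mulVec_single_one, hM]
    rfl
  have e2 : f ᵥ* M.1 = Pi.single 2 1 := by
    rw [hM]
    funext k
    fin_cases k
    · change f ⬝ᵥ a = _
      rw [h]
      rfl
    · change f ⬝ᵥ (f ⨯₃ u) = _
      rw [dot_self_cross]
      rfl
    · change f ⬝ᵥ c = _
      rw [hc]
      rfl
  rw [Matrix.SpecialLinearGroup.coe_mul, Matrix.SpecialLinearGroup.coe_mul, coe_tv, coe_root,
    one_smul, add_mul, mul_add, one_mul, mul_one, vecMulVec_mul, mul_vecMulVec, e1, e2]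

end Fusion

end EngelGraphs

namespace EngelGraphs

/-! ### Joining elements outside the socle to the socle. -/

section Centralizers

variable {G : Type*} [Group G]

/-- If every automorphism of the normal subgroup `S` fixes the conjugacy class of `t`, then every
nontrivial element of prime order of `G` commutes with a nontrivial element of `S`. -/
lemma exists_commute_of_orderOf_prime [Finite G] {S : Subgroup G} [S.Normal] {t : S} (ht : t ≠ 1)
    (hconj : ∀ α : MulAut S, IsConj t (α t)) {p : ℕ} [hp : Fact p.Prime] {h : G}
    (hh : orderOf h = p) : ∃ s ∈ S, s ≠ 1 ∧ Commute h s := by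
  have hpg : IsPGroup p (Subgroup.zpowers h) :=
    IsPGroup.of_card (n := 1) (by rw [Nat.card_zpowers, hh, pow_one])
  let c : Subgroup.zpowers h →* MulAut S :=
    MulAut.conjNormal.comp (Subgroup.zpowers h).subtype
  have hcomm : ∀ s : S, c ⟨h, Subgroup.mem_zpowers h⟩ s = s → Commute h (s : G) := by
    intro s hs
    have h1 := congrArg Subtype.val hs
    have h2 : h * s * h⁻¹ = s := h1
    exact mul_inv_eq_iff_eq_mul.1 h2
  -- If p divides |S|, the fixed points of h on S number a multiple of p, so there is one besides 1.
  -- If not, h acts on the class of t, whose size divides |S| and is prime to p, so it fixes a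
  -- member.
  by_cases hpS : p ∣ Nat.card S
  · let _ : MulAction (Subgroup.zpowers h) S := MulAction.compHom S c
    obtain ⟨b, hb, h1⟩ := hpg.exists_fixed_point_of_prime_dvd_card_of_fixed_point S hpS
      (a := 1) (fun k => map_one (c k))
    exact ⟨b, b.2, fun h0 => h1 (Subtype.ext h0.symm), hcomm b (hb _)⟩
  · let _ : MulAction (Subgroup.zpowers h) {s : S // IsConj t s} :=
      { smul := fun k s => ⟨c k s.1, (hconj (c k)).trans ((c k).toMonoidHom.map_isConj s.2)⟩
        one_smul := fun s => Subtype.ext (by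
          change c 1 s.1 = s.1
          rw [map_one]
          rfl)
        mul_smul := fun k l s => Subtype.ext (by
          change c (k * l) s.1 = c k (c l s.1)
          rw [map_mul]
          rfl) }
    have hcard : ¬ p ∣ Nat.card {s : S // IsConj t s} := by
      intro hdvd
      apply hpS
      refine hdvd.trans ?_
      have h1 : {s : S | IsConj t s} = MulAction.orbit (ConjAct S) t := by
        ext s
        rw [ConjAct.mem_orbit_conjAct]
        exact ⟨IsConj.symm, IsConj.symm⟩
      have h2 : Nat.card {s : S // IsConj t s} = (MulAction.orbit (ConjAct S) t).ncard := by
        rw [← h1]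
        rfl
      rw [h2, ← MulAction.index_stabilizer]
      exact Subgroup.index_dvd_card _
    obtain ⟨b, hb⟩ := hpg.nonempty_fixed_point_of_prime_not_dvd_card _ hcard
    refine ⟨b.1, b.1.2, fun h0 => ht ?_, hcomm b.1 (congrArg Subtype.val (hb _))⟩
    have h1 : b.1 = 1 := Subtype.ext h0
    have h2 := b.2
    rw [h1] at h2
    exact isConj_one_left.1 h2

/-- A suitable power of g has prime order and commutes with g. -/
lemma exists_commute_commute [Finite G] {S : Subgroup G} [S.Normal] {t : S} (ht : t ≠ 1)
    (hconj : ∀ α : MulAut S, IsConj t (α t)) {g : G} (hg : g ≠ 1) :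
    ∃ h s, h ≠ 1 ∧ s ∈ S ∧ s ≠ 1 ∧ Commute g h ∧ Commute h s := by
  have hp : (orderOf g).minFac.Prime := Nat.minFac_prime fun h => hg (orderOf_eq_one_iff.1 h)
  have : Fact (orderOf g).minFac.Prime := ⟨hp⟩
  have ho : orderOf (g ^ (orderOf g / (orderOf g).minFac)) = (orderOf g).minFac :=
    orderOf_pow_orderOf_div (orderOf_pos g).ne' (Nat.minFac_dvd _)
  obtain ⟨s, hs, hs1, hc⟩ := exists_commute_of_orderOf_prime ht hconj ho
  refine ⟨_, s, fun h1 => ?_, hs, hs1, (Commute.refl g).pow_right _, hc⟩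
  rw [h1, orderOf_one] at ho
  exact hp.ne_one ho.symm

end Centralizers

/-! ### Assembling Γ_2(G) for almost simple G. -/

section StronglyConnected

variable {F : Type*} [Field F] [CharP F 2] {G : Type*} [Group G] {φ : SL(3, F) →* G}

/-- Commuting elements lead from x into S and from S to y; inside S the path goes through an
involution. Only `hp`, the way from S to the involutions, depends on the size of F. -/
lemma isStronglyConnected_two_of_engelPath [Finite F] [Finite G] {S : Subgroup G} (hS : S.Normal)
    [IsSimpleGroup S] (hna : ∃ a b : S, a * b ≠ b * a)
    (hC : Subgroup.centralizer (S : Set G) = ⊥)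
    (hφ : φ.ker = Subgroup.center SL(3, F)) (hr : φ.range = S)
    (hp : ∀ X T : SL(3, F), φ X ≠ 1 → IsInvol T → EngelPath 2 (φ X) (φ T)) :
    IsStronglyConnected (engelGraph 2 G) := by
  have n02 : (0 : Fin 3) ≠ 2 := by decide
  have hT : IsInvol (root n02 (1 : F)) := isInvol_root n02 one_ne_zero
  let t : S := ⟨φ (root n02 1), hr ▸ ⟨_, rfl⟩⟩
  have ht : IsInvol t := ⟨fun h => hT.map_ne_one hφ (congrArg Subtype.val h),
    Subtype.ext (hT.map_isInvol hφ).2⟩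
  have hconj : ∀ α : MulAut S, IsConj t (α t) := by
    intro α
    have hα : IsInvol ((α t : S) : G) :=
      (ht.map_injective α.toMonoidHom α.injective).map_injective S.subtype S.subtype_injective
    obtain ⟨T, hT', hTα⟩ := IsInvol.exists_lift hφ hα (hr ▸ (α t).2)
    obtain ⟨M, rfl⟩ := hT'.exists_conj_root n02
    rw [isConj_iff]
    refine ⟨⟨φ M, hr ▸ ⟨_, rfl⟩⟩, Subtype.ext ?_⟩
    rw [← hTα, map_mul, map_mul, map_inv]
    rfl
  refine isStronglyConnected_of_engelPath two_ne_zero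
    (fun x hx => notMem_biEngelSet_two hS hna hC hx) fun x y hx hy => ?_
  obtain ⟨h, s, hh, hs, hs1, hxh, hhs⟩ := exists_commute_commute ht.1 hconj hx
  obtain ⟨k, u, hk, hu, hu1, hyk, hku⟩ := exists_commute_commute ht.1 hconj hy
  rw [← hr] at hs hu
  obtain ⟨X, rfl⟩ := hs
  obtain ⟨Y, rfl⟩ := hu
  have h1 : EngelPath 2 x (φ X) :=
    (EngelPath.of_commute hx hh hxh).trans (EngelPath.of_commute hh hs1 hhs)
  have h2 : EngelPath 2 (φ Y) y :=
    (EngelPath.of_commute hu1 hk hku.symm).trans (EngelPath.of_commute hk hy hyk.symm)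
  exact ((h1.trans (hp X _ hs1 hT)).trans (engelPath_from_isInvol hφ hu1 hT)).trans h2

theorem isStronglyConnected_two_iff [Finite F] (hF : 4 ≤ Nat.card F) [Finite G]
    (hG : IsAlmostSimple G) (e : socle G ≃* PSL(3, F)) :
    IsStronglyConnected (engelGraph 2 G) ↔ ¬ (Nat.card F = 4 ∧ Nonempty (G ≃* PSL(3, F))) := by
  constructor
  · rintro h ⟨h4, ⟨e'⟩⟩
    exact not_isStronglyConnected_two h4 (h.map_equiv e')
  · intro h
    obtain ⟨S, hS, hsimple, hna, hC⟩ := hG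
    obtain rfl : S = socle G := (socle_eq_of_isSimpleGroup hS hC).symm
    let φ : SL(3, F) →* G := (socle G).subtype.comp
      (e.symm.toMonoidHom.comp (QuotientGroup.mk' (Subgroup.center SL(3, F))))
    have hφ : φ.ker = Subgroup.center SL(3, F) := by
      ext A
      rw [MonoidHom.mem_ker]
      refine Iff.trans ?_ (QuotientGroup.eq_one_iff A)
      change ((e.symm (A : PSL(3, F)) : socle G) : G) = 1 ↔ _
      rw [OneMemClass.coe_eq_one, map_eq_one_iff e.symm e.symm.injective]
    have hr : φ.range = socle G := by
      ext x
      constructor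
      · rintro ⟨A, rfl⟩
        exact (e.symm (A : PSL(3, F))).2
      · intro hx
        obtain ⟨A, hA⟩ := QuotientGroup.mk'_surjective _ (e ⟨x, hx⟩)
        refine ⟨A, ?_⟩
        change ((e.symm (QuotientGroup.mk' _ A) : socle G) : G) = x
        rw [hA, e.symm_apply_apply]
    refine isStronglyConnected_two_of_engelPath hS hna hC hφ hr fun X T hX hT => ?_
    -- For |F| = 4 the socle is proper, since otherwise G would be PSL(3, 4).
    rcases hF.eq_or_lt with h4 | h4
    · refine engelPath_to_isInvol_of_range_ne_top h4.symm hφ (hr ▸ hS) (fun htop => h ?_) hX hT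
      rw [hr] at htop
      exact ⟨h4.symm, ⟨Subgroup.topEquiv.symm.trans
        ((MulEquiv.subgroupCongr htop.symm).trans e)⟩⟩
    · exact engelPath_to_isInvol hφ h4 hX hT

end StronglyConnected

end EngelGraphs

theorem proposition3p2 (q : ℕ) (hq : 4 ≤ q) (hq_even : Even q)
    (F : Type*) [Field F] [Finite F] (hF : Nat.card F = q) :
    -- `Γ_2(G)` is strongly connected, except when `G = PSL_3(4)`
    (∀ (G : Type*) [Group G] [Finite G], EngelGraphs.IsAlmostSimple G →
      Nonempty (EngelGraphs.socle G ≃* PSL(3, F)) →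
      (EngelGraphs.IsStronglyConnected (EngelGraphs.engelGraph 2 G) ↔
        ¬ (q = 4 ∧ Nonempty (G ≃* PSL(3, F))))) ∧
    -- `Γ_3(PSL_3(4))` is strongly connected
    (q = 4 → EngelGraphs.IsStronglyConnected (EngelGraphs.engelGraph 3 PSL(3, F))) ∧
    -- the smallest `n ≥ 2` with `Γ_n(G)` strongly connected is `3` if `G = PSL_3(4)`, else `2`
    (∀ (G : Type*) [Group G] [Finite G], EngelGraphs.IsAlmostSimple G →
      Nonempty (EngelGraphs.socle G ≃* PSL(3, F)) →
      ((q = 4 ∧ Nonempty (G ≃* PSL(3, F))) →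
        IsLeast {n : ℕ | 2 ≤ n ∧
          EngelGraphs.IsStronglyConnected (EngelGraphs.engelGraph n G)} 3) ∧
      (¬ (q = 4 ∧ Nonempty (G ≃* PSL(3, F))) →
        IsLeast {n : ℕ | 2 ≤ n ∧
          EngelGraphs.IsStronglyConnected (EngelGraphs.engelGraph n G)} 2)) := by
  have hchar : CharP F 2 := by
    have := Fintype.ofFinite F
    rw [← FiniteField.even_card_iff_char_two.2 (by
      rw [← Nat.card_eq_fintype_card, hF]
      exact Nat.even_iff.1 hq_even : Fintype.card F % 2 = 0)]
    exact ringChar.charP F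
  subst hF
  refine ⟨fun G _ _ hG ⟨e⟩ => EngelGraphs.isStronglyConnected_two_iff hq hG e,
    fun _ => EngelGraphs.isStronglyConnected_three, fun G _ _ hG ⟨e⟩ => ?_⟩
  have h2 := EngelGraphs.isStronglyConnected_two_iff hq hG e
  refine ⟨fun h => ⟨⟨by norm_num, ?_⟩, ?_⟩, fun h => ⟨⟨le_rfl, h2.2 h⟩, fun n hn => hn.1⟩⟩
  · obtain ⟨-, ⟨e'⟩⟩ := h
    exact EngelGraphs.IsStronglyConnected.map_equiv e'.symm EngelGraphs.isStronglyConnected_three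
  · rintro n ⟨hn, hsc⟩
    by_contra hlt
    obtain rfl : n = 2 := by omega
    exact h2.1 hsc h
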